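/- **Setting.** Let $0<r_1<r_2$ and $\Omega=\{x\in\mathbb{R}^3: r_1<|x|<r_2\}$, with $\Gamma_1=\{|x|=r_1\}$, $\Gamma_2=\{|x|=r_2\}$, outward unit normal $n$, $H=L^2(\Omega)$, $Q=L^2(\Gamma_2)$, $B=L^2(\Gamma_1)$ (surface measure). For constants $g,q,b\in\mathbb{R}$ and $\alpha>0$ let $u$ and $u_\alpha$ be the solutions of $$-\Delta u=g\ \text{in }\Omega,\quad u|_{\Gamma_1}=b,\quad -\tfrac{\partial u}{\partial n}\big|_{\Gamma_2}=q;\qquad -\Delta u_\alpha=g\ \text{in }\Omega,\quad -\tfrac{\partial u_\alpha}{\partial n}\big|_{\Gamma_1}=\alpha(u_\alpha-b),\quad -\tfrac{\partial u_\alpha}{\partial n}\big|_{\Gamma_2}=q,$$ and for $z_d\in\mathbb{R}$ let $p,p_\alpha$ be the adjoint states: $-\Delta p=u-z_d$, $p|_{\Gamma_1}=0$, $\frac{\partial p}{\partial n}|_{\Gamma_2}=0$, and $-\Delta p_\alpha=u_\alpha-z_d$, $-\frac{\partial p_\alpha}{\partial n}|_{\Gamma_1}=\alpha p_\alpha$,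 $\frac{\partial p_\alpha}{\partial n}|_{\Gamma_2}=0$. Solutions are classical: $C^2$ in $\Omega$, continuous on $\overline\Omega$, with one-sided normal derivatives on the boundary. For positive constants $M_1,\dots,M_5$ and real (constant) controls let $$J_1(g)=\tfrac12\|u-z_d\|_H^2+\tfrac{M_1}2\|g\|_H^2,\quad J_2(q)=\tfrac12\|u-z_d\|_H^2+\tfrac{M_2}2\|q\|_Q^2,\quad J_3(b)=\tfrac12\|u-z_d\|_H^2+\tfrac{M_3}2\|b\|_B^2,$$ $$J_4(g,q)=\tfrac12\|u-z_d\|_H^2+\tfrac{M_4}2\|g\|_H^2+\tfrac{M_5}2\|q\|_Q^2,$$ the data that are not controls being fixed, and let $J_{i\alpha}$ be the same functionals with $u_\alpha$ in place of $u$. Put $\rho=r_2/r_1$, $s=1/(\alpha r_1)$, and $$\begin{aligned} G_{1\alpha}&=-\tfrac{2}{945}+\tfrac{2s}{135}-\tfrac{s^2}{27}+\rho^3\big(\tfrac1{45}-\tfrac{4s}{45}+\tfrac{s^2}9\big)-\tfrac{\rho^5}{15}(1-2s)-\tfrac{s^2\rho^6}{9}+\tfrac{\rho^7}7-\tfrac{2\rho^8}{15}(1+s)+\tfrac{\rho^9}{27}(1+2s+s^2),\\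 G_{2\alpha}&=-\tfrac13(1-s+s^2)+\rho-\rho^2(1+s)+\tfrac{\rho^3}3(1+2s+s^2),\qquad G_{3\alpha}=\tfrac13(\rho^3-1),\\ G_{4\alpha}&=-\tfrac7{180}+\tfrac{7s}{45}-\tfrac{2s^2}{9}+\tfrac{\rho^2}6(1-2s)+\tfrac{\rho^3}9(1-s+4s^2)-\tfrac{3\rho^4}4+\tfrac{11\rho^5}{15}(1+s)-\tfrac{2\rho^6}9(1+2s+s^2),\\ G_{5\alpha}&=-\tfrac2{45}+\tfrac{2s}9+\tfrac{2\rho^3}9(1-2s)-\tfrac{2\rho^5}5+\tfrac{2\rho^6}9(1+s),\qquad G_{6\alpha}=-\tfrac13(1-2s)+\rho^2-\tfrac{2\rho^3}3(1+s), \end{aligned}$$ and let $G_i$ be $G_{i\alpha}$ with $s=0$. **Theorem.** Each of the four boundary value problems has a solution, unique on $\overline\Omega$. Moreover, for all real data $g,q,b,z_d$, all $M_i>0$ and all $\alpha>0$, items (i)-(iv) hold, and they hold also for $J_{i\alpha}$ (with optimal controls written $g_{\alpha_{op}},q_{\alpha_{op}},b_{\alpha_{op}},(g_\alpha^{op},q_\alpha^{op})$)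 when every $G_i$ is replaced by $G_{i\alpha}$. (i) $J_1$ has the unique minimizer over $\mathbb{R}$ $$g_{op}=-\frac{G_4q\frac{r_2^2}{r_1}+G_5(b-z_d)}{2r_1^2\left(G_1+G_3\frac{M_1}{r_1^4}\right)},$$ $$J_1(g_{op})=\Big[4\big(G_1+G_3\tfrac{M_1}{r_1^4}\big)\big(G_2q^2\tfrac{r_2^4}{r_1^2}+G_3(b-z_d)^2+G_6q\tfrac{r_2^2}{r_1}(b-z_d)\big)-\big(G_4q\tfrac{r_2^2}{r_1}+G_5(b-z_d)\big)^2\Big]\frac{\pi r_1^3}{2\left(G_1+G_3\frac{M_1}{r_1^4}\right)}.$$ (ii) $J_2$ has the unique minimizer over $\mathbb{R}$ $$q_{op}=-\frac{r_1}{2r_2^2}\,\frac{G_4gr_1^2+G_6(b-z_d)}{G_2+\frac{M_2}{r_1r_2^2}},$$ $$J_2(q_{op})=\Big[4\big(G_2+\tfrac{M_2}{r_1r_2^2}\big)\big(G_1g^2r_1^4+G_3(b-z_d)^2+G_5gr_1^2(b-z_d)\big)-\big(G_4gr_1^2+G_6(b-z_d)\big)^2\Big]\frac{\pi r_1^3}{2\left(G_2+\frac{M_2}{r_1r_2^2}\right)}.$$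 (iii) $J_3$ has the unique minimizer over $\mathbb{R}$ $$b_{op}=-\frac{G_5gr_1^2+G_6q\frac{r_2^2}{r_1}-2G_3z_d}{2\left(G_3+\frac{M_3}{r_1}\right)},$$ $$\begin{aligned}J_3(b_{op})=\Big[&4\big(G_3+\tfrac{M_3}{r_1}\big)\big(G_1g^2r_1^4+G_2q^2\tfrac{r_2^4}{r_1^2}+G_3z_d^2+G_4gqr_1r_2^2-G_5gr_1^2z_d-G_6q\tfrac{r_2^2}{r_1}z_d\big)\\&-\big(-2G_3z_d+G_5gr_1^2+G_6q\tfrac{r_2^2}{r_1}\big)^2\Big]\frac{\pi r_1^3}{2\left(G_3+\frac{M_3}{r_1}\right)}.\end{aligned}$$ (iv) With $A=G_1+G_3\frac{M_4}{r_1^4}$, $C=G_2+\frac{M_5}{r_1r_2^2}$, $J_4$ has the unique minimizer over $\mathbb{R}^2$ $$(g^{op},q^{op})=\Big(\frac{b-z_d}{r_1^2}\,\frac{G_4G_6-2G_5C}{4AC-G_4^2},\ \frac{(b-z_d)r_1}{r_2^2}\,\frac{G_4G_5-2G_6A}{4AC-G_4^2}\Big),$$ $$J_4(g^{op},q^{op})=\big[G_4G_5G_6+4ACG_3-AG_6^2-CG_5^2-G_3G_4^2\big]\frac{2\pi(b-z_d)^2r_1^3}{4AC-G_4^2}.$$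 (v) As $\alpha\to\infty$, all the optimal controls and all the optimal values for $\alpha$ converge to those of the corresponding problem without $\alpha$, and each difference (for the simultaneous problem: each component of the control and the value) is $\mathcal{O}(1/\alpha)$. More precisely, write $d=b-z_d$, $e_2=r_1^2+r_1r_2+r_2^2$, $\delta=r_1-r_2$, and $$D_G=\big[315M_1r_1^2e_2+(2r_1^4+10r_1^3r_2+30r_1^2r_2^2+49r_1r_2^3+35r_2^4)\delta^4\big]^2,\qquad D_Q=\big[r_2^2\delta^3-3M_2r_1^2\big]^2,$$ $$\begin{aligned}D_4=\Big[&33600M_4e_2(3M_5r_1^2-r_2^2\delta^3)\\&+\delta^4\big(320M_5(2r_1^4+10r_1^3r_2+30r_1^2r_2^2+49r_1r_2^3+35r_2^4)-r_2^2\delta^3(99r_1^2+152r_1r_2+64r_2^2)\big)\Big]^2.\end{aligned}$$ Then: $$\begin{aligned}\lim_{\alpha\to\infty}\alpha|g_{\alpha_{op}}-g_{op}|=\tfrac{21(r_2-r_1)}{4D_G}\Big|&4d\,e_2\big(1575M_1r_1^2e_2^2-\delta^4(4r_1^6+24r_1^5r_2+84r_1^4r_2^2+199r_1^3r_2^3+354r_1^2r_2^4+420r_1r_2^5+175r_2^6)\big)\\&-630M_1qr_2^2r_1e_2(-7r_1^4-14r_1^3r_2-6r_1^2r_2^2+7r_1r_2^3+20r_2^4)\\&-3qr_2^2\delta^4(7r_1^7+49r_1^6r_2+146r_1^5r_2^2+198r_1^4r_2^3+105r_1^3r_2^4-170r_1^2r_2^5-265r_1r_2^6-70r_2^7)\Big|;\end{aligned}$$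 $$\begin{aligned}\lim_{\alpha\to\infty}\alpha|q_{\alpha_{op}}-q_{op}|=\tfrac{r_2-r_1}{40D_Q}\Big|&20d\big[6M_2r_1^2e_2-r_2^2\delta^3(r_1^2-2r_1r_2-2r_2^2)\big]\\&+g\delta^2\big[4M_2r_1(7r_1^3+21r_1^2r_2+27r_1r_2^2+20r_2^3)-r_2^2\delta^3(7r_1^2+14r_1r_2+4r_2^2)\big]\Big|;\end{aligned}$$ $$|b_{\alpha_{op}}-b_{op}|=\frac1\alpha\left|\frac{(r_1^3-r_2^3)\big(g(r_1^3-r_2^3)+3qr_2^2\big)}{3r_1^2(-3M_3r_1^2+r_1^3-r_2^3)}\right|\quad\text{for every }\alpha>0;$$ $$\begin{aligned}\lim_{\alpha\to\infty}\alpha|g_\alpha^{op}-g^{op}|=\tfrac{840(r_2-r_1)|d|}{D_4}\Big|&16800M_4e_2\big[240M_5^2r_1^2e_2^2-2M_5r_2^2(59r_1^4+55r_1^3r_2+27r_1^2r_2^2-56r_1r_2^3-40r_2^4)\delta^3\\&\quad+r_2^4(15r_1^2+2r_1r_2-2r_2^2)\delta^6\big]\\&-\delta^4\big[2560M_5^2(4r_1^8+28r_1^7r_2+112r_1^6r_2^2+307r_1^5r_2^3+637r_1^4r_2^4+973r_1^3r_2^5+949r_1^2r_2^6+595r_1r_2^7+175r_2^8)\\&\quad-8M_5r_2^2(417r_1^6+1610r_1^5r_2+2915r_1^4r_2^2+1490r_1^3r_2^3-575r_1^2r_2^4+3448r_1r_2^5+1720r_2^6)\delta^3\\&\quad+r_2^4(297r_1^4+525r_1^3r_2+433r_1^2r_2^2+256r_1r_2^3+64r_2^4)\delta^6\big]\Big|;\end{aligned}$$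 $$\begin{aligned}\lim_{\alpha\to\infty}\alpha|q_\alpha^{op}-q^{op}|=\tfrac{24(r_2-r_1)|d|}{D_4}\Big|&23520000M_4^2e_2^2\big[6M_5r_1^2e_2-r_2^2\delta^3(r_1^2-2r_1r_2-2r_2^2)\big]\\&-1400M_4e_2\delta^4\big[8M_5(281r_1^6+1686r_1^5r_2+4431r_1^4r_2^2+6446r_1^3r_2^3+6441r_1^2r_2^4+4200r_1r_2^5+1400r_2^6)\\&\quad-r_2^2\delta^3(489r_1^4+2153r_1^3r_2+3105r_1^2r_2^2+600r_1r_2^3-152r_2^4)\big]\\&-\delta^8\big[320M_5(4r_1^8+44r_1^7r_2+264r_1^6r_2^2+1049r_1^5r_2^3+2539r_1^4r_2^4+3495r_1^3r_2^5+2055r_1^2r_2^6-315r_1r_2^7-315r_2^8)\\&\quad-r_2^2\delta^3(99r_1^6+106r_1^5r_2-1675r_1^4r_2^2-3270r_1^3r_2^3-3405r_1^2r_2^4-2304r_1r_2^5-576r_2^6)\big]\Big|;\end{aligned}$$ $$\lim_{\alpha\to\infty}\alpha|J_{1\alpha}(g_{\alpha_{op}})-J_1(g_{op})|=\tfrac{\pi(r_2-r_1)}{80D_G}\,|XY|,\quad\text{where}$$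 $$\begin{aligned}X={}&q\big(-2520M_1r_1^3r_2^2+33r_1^7r_2^2-2520M_1r_1^2r_2^3+33r_1^6r_2^3-2520M_1r_1r_2^4-177r_1^5r_2^4-198r_1^4r_2^5+747r_1^3r_2^6-471r_1^2r_2^7-51r_1r_2^8+84r_2^9\big)\\&+d\big(56r_1^8+56r_1^7r_2+56r_1^6r_2^2-280r_1^5r_2^3-280r_1^4r_2^4+224r_1^3r_2^5+224r_1^2r_2^6+224r_1r_2^7-280r_2^8\big),\\ Y={}&q\big(2100M_1r_1^4r_2^2-3r_1^8r_2^2+4200M_1r_1^3r_2^3-6r_1^7r_2^3+21r_1^6r_2^4-2100M_1r_1r_2^5+63r_1^5r_2^5-4200M_1r_2^6-210r_1^4r_2^6+168r_1^3r_2^7+21r_1^2r_2^8-81r_1r_2^9+27r_2^{10}\big)\\&+d\big(4200M_1r_1^5+8r_1^9+8400M_1r_1^4r_2+16r_1^8r_2+12600M_1r_1^3r_2^2+24r_1^7r_2^2+8400M_1r_1^2r_2^3-88r_1^6r_2^3+4200M_1r_1r_2^4-200r_1^5r_2^4+192r_1^4r_2^5+584r_1^3r_2^6-824r_1^2r_2^7+288r_1r_2^8\big);\end{aligned}$$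 $$\begin{aligned}\lim_{\alpha\to\infty}\alpha|J_{2\alpha}(q_{\alpha_{op}})-J_2(q_{op})|=\tfrac{\pi(r_2-r_1)^2}{2400D_Q}\Big|&\Big[g\big(-40M_2r_1^3-40M_2r_1^2r_2-40M_2r_1r_2^2+11r_1^4r_2^2-29r_1^3r_2^3+21r_1^2r_2^4+r_1r_2^5-4r_2^6\big)\\&\quad+d\big(-20r_1^2r_2^2-20r_1r_2^3+40r_2^4\big)\Big]\\&\times\Big[g\big(-16M_2r_1^5-16M_2r_1^4r_2-16M_2r_1^3r_2^2+3r_1^6r_2^2+64M_2r_1^2r_2^3-13r_1^5r_2^3+64M_2r_1r_2^4+20r_1^4r_2^4-80M_2r_2^5-10r_1^3r_2^5-5r_1^2r_2^6+7r_1r_2^7-2r_2^8\big)\\&\quad+d\big(-240M_2r_1^3-240M_2r_1^2r_2-240M_2r_1r_2^2+60r_1^4r_2^2-180r_1^3r_2^3+180r_1^2r_2^4-60r_1r_2^5\big)\Big]\Big|;\end{aligned}$$ $$\begin{aligned}\lim_{\alpha\to\infty}\alpha|J_{3\alpha}(b_{\alpha_{op}})-J_3(b_{op})|=\tfrac{2\pi}{45r_1^2|-3M_3r_1^2+r_1^3-r_2^3|}\Big|&2g^2M_3r_1(r_1^9-6r_1^6r_2^3+9r_1^4r_2^5-9r_1r_2^8+5r_2^9)\\&-3gM_3r_1\big(10r_1z_d(r_1^3-r_2^3)^2-qr_2^2\delta^3(7r_1^3+21r_1^2r_2+27r_1r_2^2+20r_2^3)\big)\\&+45qr_2^2M_3r_1\big(qr_2^2\delta^2(r_1+2r_2)-2r_1z_d(r_1^3-r_2^3)\big)\Big|;\end{aligned}$$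 $$\begin{aligned}\lim_{\alpha\to\infty}\alpha|J_{4\alpha}(g_\alpha^{op},&q_\alpha^{op})-J_4(g^{op},q^{op})|=\tfrac{16\pi r_1(r_2-r_1)^3d^2}{D_4}\Big|35280000M_4^2r_2^2(r_1+2r_2)e_2^2\big(4M_5e_2-r_2^2\delta^3\big)\\&-4200M_4(r_1^3-r_2^3)\big(4480M_5^2e_2^2(r_1^3+3r_1^2r_2+6r_1r_2^2+5r_2^3)\\&\quad-8M_5r_2^2(247r_1^5+856r_1^4r_2+1963r_1^3r_2^2+2840r_1^2r_2^3+2567r_1r_2^4+1292r_2^5)\delta^3\\&\quad+r_2^4(207r_1^3+301r_1^2r_2+177r_1r_2^2+50r_2^3)\delta^6\big)\\&-\delta^5\big(35840M_5^2(r_1^9+10r_1^8r_2+55r_1^7r_2^2+199r_1^6r_2^3+505r_1^5r_2^4+919r_1^4r_2^5+1195r_1^3r_2^6+1060r_1^2r_2^7+601r_1r_2^8+180r_2^9)\\&\quad-16M_5r_2^2(711r_1^7+4763r_1^6r_2+17621r_1^5r_2^2+40700r_1^4r_2^3+57025r_1^3r_2^4+44014r_1^2r_2^5+18712r_1r_2^6+3879r_2^7)\delta^3\\&\quad+r_2^4(891r_1^5+2880r_1^4r_2+3755r_1^3r_2^2+2480r_1^2r_2^3+875r_1r_2^4+144r_2^5)\delta^6\big)\Big|.\end{aligned}$$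 For the states and adjoint states: for every $\alpha>0$, $$\|u_\alpha-u\|_{H^1(\Omega)}=\frac1\alpha\left(\frac{4\pi(r_2^3-r_1^3)\big(3qr_2^2+g(r_1^3-r_2^3)\big)^2}{27r_1^4}\right)^{1/2},$$ and $$\begin{aligned}\lim_{\alpha\to\infty}\alpha\|p_\alpha-p\|_{L^2(\Omega)}=\Big\{&\tfrac{\pi(r_2-r_1)^3}{42525r_1^6}\Big[6300b^2r_1^2e_2^3\\&+420br_1e_2\Big(4g(r_1^5+4r_1^4r_2+10r_1^3r_2^2+14r_1^2r_2^3+11r_1r_2^4+5r_2^5)\delta^2\\&\quad+3\big(qr_2^2(7r_1^4+14r_1^3r_2+6r_1^2r_2^2-7r_1r_2^3-20r_2^4)-10r_1z_de_2^2\big)\Big)\\&+4g^2(31r_1^8+217r_1^7r_2+868r_1^6r_2^2+2248r_1^5r_2^3+4018r_1^4r_2^4+5047r_1^3r_2^5+4336r_1^2r_2^6+2380r_1r_2^7+700r_2^8)\delta^4\\&-24g\delta^2\Big(qr_2^2(-52r_1^7-260r_1^6r_2-675r_1^5r_2^2-970r_1^4r_2^3-440r_1^3r_2^4+612r_1^2r_2^5+1085r_1r_2^6+700r_2^7)\\&\quad+70r_1z_de_2^2(r_1^3+3r_1^2r_2+6r_1r_2^2+5r_2^3)\Big)\\&+45\Big(q^2r_2^4\delta^2(71r_1^4+355r_1^3r_2+771r_1^2r_2^2+952r_1r_2^3+560r_2^4)\\&\quad-28qr_1r_2^2z_d(7r_1^6+21r_1^5r_2+27r_1^4r_2^2+13r_1^3r_2^3-21r_1^2r_2^4-27r_1r_2^5-20r_2^6)+140r_1^2z_d^2e_2^3\Big)\Big]\Big\}^{1/2}.\end{aligned}$$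 -/

import Mathlib

open Real Set Filter Topology MeasureTheory Asymptotics

noncomputable section

namespace ShellControl

/-- Three-dimensional Euclidean space. -/
abbrev E3 : Type := EuclideanSpace ℝ (Fin 3)

/-! ### Geometry of the spherical shell -/

/-- The open spherical shell `r₁ < |x| < r₂`. -/
def shell (r₁ r₂ : ℝ) : Set E3 := {x | r₁ < ‖x‖ ∧ ‖x‖ < r₂}

/-- The closed spherical shell `r₁ ≤ |x| ≤ r₂`. -/
def closedShell (r₁ r₂ : ℝ) : Set E3 := {x | r₁ ≤ ‖x‖ ∧ ‖x‖ ≤ r₂}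

/-- `u` has at the boundary point `x` the (one-sided) normal derivative `m` in the direction of
the outward unit normal `ν`. -/
def HasNormalDeriv (u : E3 → ℝ) (ν x : E3) (m : ℝ) : Prop :=
  HasDerivWithinAt (fun t : ℝ => u (x + t • ν)) m (Iic 0) 0

/-- Outward unit normal of the shell at a point of the inner sphere `Γ₁`. -/
def innerNormal (x : E3) : E3 := -(‖x‖⁻¹ • x)

/-- Outward unit normal of the shell at a point of the outer sphere `Γ₂`. -/
def outerNormal (x : E3) : E3 := ‖x‖⁻¹ • x

/-! ### The two mixed boundary value problems, with classical solutions -/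

/-- `u` is a classical solution of `-Δu = f` in the shell, `u = b` on `Γ₁`, `-∂u/∂n = q` on `Γ₂`. -/
structure IsDirichletSol (r₁ r₂ : ℝ) (f : E3 → ℝ) (q b : ℝ) (u : E3 → ℝ) : Prop where
  contDiffOn : ContDiffOn ℝ 2 u (shell r₁ r₂)
  continuousOn : ContinuousOn u (closedShell r₁ r₂)
  equation : ∀ x ∈ shell r₁ r₂, -(Laplacian.laplacian u x) = f x
  inner_bc : ∀ x : E3, ‖x‖ = r₁ → u x = b
  outer_bc : ∀ x : E3, ‖x‖ = r₂ → HasNormalDeriv u (outerNormal x) x (-q)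

/-- `u` is a classical solution of `-Δu = f` in the shell, `-∂u/∂n = α (u - b)` on `Γ₁`,
`-∂u/∂n = q` on `Γ₂`. -/
structure IsRobinSol (r₁ r₂ α : ℝ) (f : E3 → ℝ) (q b : ℝ) (u : E3 → ℝ) : Prop where
  contDiffOn : ContDiffOn ℝ 2 u (shell r₁ r₂)
  continuousOn : ContinuousOn u (closedShell r₁ r₂)
  equation : ∀ x ∈ shell r₁ r₂, -(Laplacian.laplacian u x) = f x
  inner_bc : ∀ x : E3, ‖x‖ = r₁ → HasNormalDeriv u (innerNormal x) x (-(α * (u x - b)))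
  outer_bc : ∀ x : E3, ‖x‖ = r₂ → HasNormalDeriv u (outerNormal x) x (-q)

/-- `u` solves the problem `P`, and every other solution agrees with it on the closed shell. -/
def IsUniqueSol (r₁ r₂ : ℝ) (P : (E3 → ℝ) → Prop) (u : E3 → ℝ) : Prop :=
  P u ∧ ∀ v : E3 → ℝ, P v → EqOn v u (closedShell r₁ r₂)

/-- The system state `u` for constant data `g, q, b` (Dirichlet condition on `Γ₁`). -/
def state (r₁ r₂ g q b : ℝ) : E3 → ℝ :=
  Classical.epsilon (IsDirichletSol r₁ r₂ (fun _ => g) q b)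

/-- The system state `u_α` for constant data `g, q, b` (convective condition on `Γ₁`). -/
def stateR (r₁ r₂ α g q b : ℝ) : E3 → ℝ :=
  Classical.epsilon (IsRobinSol r₁ r₂ α (fun _ => g) q b)

/-- The adjoint state `p`: `-Δp = u - z_d`, `p = 0` on `Γ₁`, `∂p/∂n = 0` on `Γ₂`. -/
def adjoint (r₁ r₂ g q b z : ℝ) : E3 → ℝ :=
  Classical.epsilon (IsDirichletSol r₁ r₂ (fun x => state r₁ r₂ g q b x - z) 0 0)

/-- The adjoint state `p_α`: `-Δp = u_α - z_d`, `-∂p/∂n = α p` on `Γ₁`, `∂p/∂n = 0` on `Γ₂`. -/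
def adjointR (r₁ r₂ α g q b z : ℝ) : E3 → ℝ :=
  Classical.epsilon (IsRobinSol r₁ r₂ α (fun x => stateR r₁ r₂ α g q b x - z) 0 0)

/-! ### Norms and cost functionals -/

/-- `‖f‖²` in `H = L²(Ω)`, `Ω` the shell. -/
def sqNormH (r₁ r₂ : ℝ) (f : E3 → ℝ) : ℝ := ∫ x in shell r₁ r₂, f x ^ 2

/-- `‖f‖²` in `H¹(Ω)`, `Ω` the shell. -/
def sqNormH1 (r₁ r₂ : ℝ) (f : E3 → ℝ) : ℝ :=
  ∫ x in shell r₁ r₂, (f x ^ 2 + ‖fderiv ℝ f x‖ ^ 2)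

/-- `‖f‖²` in `L²` of the sphere of radius `r` centred at `0`, with respect to its surface
measure, which is `r²` times the image of the surface measure of the unit sphere. -/
def sqNormSphere (r : ℝ) (f : E3 → ℝ) : ℝ :=
  r ^ 2 * ∫ ω : Metric.sphere (0 : E3) 1, f (r • (ω : E3)) ^ 2 ∂((volume : Measure E3).toSphere)

/- In the four cost functionals `S g q b` is the system state for the data `g, q, b`. -/

/-- Cost of the distributed control `g`. -/
def J₁ (r₁ r₂ : ℝ) (S : ℝ → ℝ → ℝ → E3 → ℝ) (M q b z g : ℝ) : ℝ :=
  1 / 2 * sqNormH r₁ r₂ (fun x => S g q b x - z) + M / 2 * sqNormH r₁ r₂ (fun _ => g)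

/-- Cost of the flux control `q` on `Γ₂`. -/
def J₂ (r₁ r₂ : ℝ) (S : ℝ → ℝ → ℝ → E3 → ℝ) (M g b z q : ℝ) : ℝ :=
  1 / 2 * sqNormH r₁ r₂ (fun x => S g q b x - z) + M / 2 * sqNormSphere r₂ (fun _ => q)

/-- Cost of the temperature control `b` on `Γ₁`. -/
def J₃ (r₁ r₂ : ℝ) (S : ℝ → ℝ → ℝ → E3 → ℝ) (M g q z b : ℝ) : ℝ :=
  1 / 2 * sqNormH r₁ r₂ (fun x => S g q b x - z) + M / 2 * sqNormSphere r₁ (fun _ => b)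

/-- Cost of the simultaneous control `(g, q)`. -/
def J₄ (r₁ r₂ : ℝ) (S : ℝ → ℝ → ℝ → E3 → ℝ) (M N b z : ℝ) (p : ℝ × ℝ) : ℝ :=
  1 / 2 * sqNormH r₁ r₂ (fun x => S p.1 p.2 b x - z) + M / 2 * sqNormH r₁ r₂ (fun _ => p.1) +
    N / 2 * sqNormSphere r₂ (fun _ => p.2)

/-- `x` is the one and only global minimizer of `J`. -/
def IsUniqueMin {X : Type} (J : X → ℝ) (x : X) : Prop :=
  ∀ y : X, IsMinOn J univ y ↔ y = x

/-! ### The constants `Gᵢ` and `Gᵢα` -/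

structure Coeffs where
  (G1 G2 G3 G4 G5 G6 : ℝ)

/-- The constants `G₁, …, G₆`. -/
def coeffs (r₁ r₂ : ℝ) : Coeffs :=
  let ρ := r₂ / r₁
  { G1 := -2 / 945 + 1 / 45 * ρ ^ 3 - 1 / 15 * ρ ^ 5 + 1 / 7 * ρ ^ 7 - 2 / 15 * ρ ^ 8
      + 1 / 27 * ρ ^ 9
    G2 := -1 / 3 + ρ - ρ ^ 2 + 1 / 3 * ρ ^ 3
    G3 := 1 / 3 * (-1 + ρ ^ 3)
    G4 := -7 / 180 + 1 / 6 * ρ ^ 2 + 1 / 9 * ρ ^ 3 - 3 / 4 * ρ ^ 4 + 11 / 15 * ρ ^ 5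
      - 2 / 9 * ρ ^ 6
    G5 := -2 / 45 + 2 / 9 * ρ ^ 3 - 2 / 5 * ρ ^ 5 + 2 / 9 * ρ ^ 6
    G6 := -1 / 3 + ρ ^ 2 - 2 / 3 * ρ ^ 3 }

/-- The constants `G₁α, …, G₆α`; here `s = 1 / (α r₁)`. -/
def coeffsR (r₁ r₂ α : ℝ) : Coeffs :=
  let ρ := r₂ / r₁
  let s := 1 / (α * r₁)
  { G1 := -2 / 945 + 2 / 135 * s - 1 / 27 * s ^ 2
      + ρ ^ 3 * (1 / 45 - 4 / 45 * s + 1 / 9 * s ^ 2)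
      - 1 / 15 * ρ ^ 5 * (1 - 2 * s) - 1 / 9 * s ^ 2 * ρ ^ 6 + 1 / 7 * ρ ^ 7
      - 2 / 15 * ρ ^ 8 * (1 + s) + 1 / 27 * ρ ^ 9 * (1 + 2 * s + s ^ 2)
    G2 := -1 / 3 * (1 - s + s ^ 2) + ρ - ρ ^ 2 * (1 + s) + 1 / 3 * ρ ^ 3 * (1 + 2 * s + s ^ 2)
    G3 := 1 / 3 * (-1 + ρ ^ 3)
    G4 := -7 / 180 + 7 / 45 * s - 2 / 9 * s ^ 2 + 1 / 6 * ρ ^ 2 * (1 - 2 * s)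
      + 1 / 9 * ρ ^ 3 * (1 - s + 4 * s ^ 2) - 3 / 4 * ρ ^ 4 + 11 / 15 * ρ ^ 5 * (1 + s)
      - 2 / 9 * ρ ^ 6 * (1 + 2 * s + s ^ 2)
    G5 := -2 / 45 + 2 / 9 * s + 2 / 9 * ρ ^ 3 * (1 - 2 * s) - 2 / 5 * ρ ^ 5
      + 2 / 9 * ρ ^ 6 * (1 + s)
    G6 := -1 / 3 * (1 - 2 * s) + ρ ^ 2 - 2 / 3 * ρ ^ 3 * (1 + s) }

/-! ### Closed forms of the optimal controls and values -/

def gOpt (r₁ r₂ : ℝ) (G : Coeffs) (M q b z : ℝ) : ℝ :=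
  -((G.G4 * q * (r₂ ^ 2 / r₁) + G.G5 * (b - z)) / (2 * r₁ ^ 2 * (G.G1 + G.G3 * (M / r₁ ^ 4))))

def J₁Opt (r₁ r₂ : ℝ) (G : Coeffs) (M q b z : ℝ) : ℝ :=
  (4 * (G.G1 + G.G3 * (M / r₁ ^ 4)) *
      (G.G2 * q ^ 2 * (r₂ ^ 4 / r₁ ^ 2) + G.G3 * (b - z) ^ 2 + G.G6 * q * (r₂ ^ 2 / r₁) * (b - z))
    - (G.G4 * q * (r₂ ^ 2 / r₁) + G.G5 * (b - z)) ^ 2)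
  * (π * r₁ ^ 3 / (2 * (G.G1 + G.G3 * (M / r₁ ^ 4))))

def qOpt (r₁ r₂ : ℝ) (G : Coeffs) (M g b z : ℝ) : ℝ :=
  -(r₁ / (2 * r₂ ^ 2) * ((G.G4 * g * r₁ ^ 2 + G.G6 * (b - z)) / (G.G2 + M / (r₁ * r₂ ^ 2))))

def J₂Opt (r₁ r₂ : ℝ) (G : Coeffs) (M g b z : ℝ) : ℝ :=
  (4 * (G.G2 + M / (r₁ * r₂ ^ 2)) *
      (G.G1 * g ^ 2 * r₁ ^ 4 + G.G3 * (b - z) ^ 2 + G.G5 * g * r₁ ^ 2 * (b - z))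
    - (G.G4 * g * r₁ ^ 2 + G.G6 * (b - z)) ^ 2)
  * (π * r₁ ^ 3 / (2 * (G.G2 + M / (r₁ * r₂ ^ 2))))

def bOpt (r₁ r₂ : ℝ) (G : Coeffs) (M g q z : ℝ) : ℝ :=
  -((G.G5 * g * r₁ ^ 2 + G.G6 * q * (r₂ ^ 2 / r₁) - 2 * G.G3 * z) / (2 * (G.G3 + M / r₁)))

def J₃Opt (r₁ r₂ : ℝ) (G : Coeffs) (M g q z : ℝ) : ℝ :=
  (4 * (G.G3 + M / r₁) *
      (G.G1 * g ^ 2 * r₁ ^ 4 + G.G2 * q ^ 2 * (r₂ ^ 4 / r₁ ^ 2) + G.G3 * z ^ 2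
        + G.G4 * g * q * r₁ * r₂ ^ 2 - G.G5 * g * r₁ ^ 2 * z - G.G6 * q * (r₂ ^ 2 / r₁) * z)
    - (-2 * G.G3 * z + G.G5 * g * r₁ ^ 2 + G.G6 * q * (r₂ ^ 2 / r₁)) ^ 2)
  * (π * r₁ ^ 3 / (2 * (G.G3 + M / r₁)))

/-- The common denominator of the simultaneous optimal controls. -/
def den₄ (r₁ r₂ : ℝ) (G : Coeffs) (M N : ℝ) : ℝ :=
  4 * (G.G1 + G.G3 * (M / r₁ ^ 4)) * (G.G2 + N / (r₁ * r₂ ^ 2)) - G.G4 ^ 2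

/-- The constants `Δ₃`, `Δ₃α`. -/
def Delta (r₁ r₂ : ℝ) (G : Coeffs) (M N : ℝ) : ℝ :=
  (G.G4 * G.G6 - 2 * G.G5 * (G.G2 + N / (r₁ * r₂ ^ 2))) / den₄ r₁ r₂ G M N

/-- The constants `Π₃`, `Π₃α`. -/
def Pi₃ (r₁ r₂ : ℝ) (G : Coeffs) (M N : ℝ) : ℝ :=
  (G.G4 * G.G5 - 2 * G.G6 * (G.G1 + G.G3 * (M / r₁ ^ 4))) / den₄ r₁ r₂ G M N

def gqOpt (r₁ r₂ : ℝ) (G : Coeffs) (M N b z : ℝ) : ℝ × ℝ :=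
  ((b - z) / r₁ ^ 2 * Delta r₁ r₂ G M N, (b - z) * r₁ / r₂ ^ 2 * Pi₃ r₁ r₂ G M N)

def J₄Opt (r₁ r₂ : ℝ) (G : Coeffs) (M N b z : ℝ) : ℝ :=
  (G.G4 * G.G5 * G.G6
    + 4 * (G.G1 + G.G3 * (M / r₁ ^ 4)) * (G.G2 + N / (r₁ * r₂ ^ 2)) * G.G3
    - (G.G1 + G.G3 * (M / r₁ ^ 4)) * G.G6 ^ 2
    - (G.G2 + N / (r₁ * r₂ ^ 2)) * G.G5 ^ 2 - G.G3 * G.G4 ^ 2)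
  * (2 * π * (b - z) ^ 2 * r₁ ^ 3 / den₄ r₁ r₂ G M N)

/-! ### The limit constants of the `1/α` rates -/

/-- The constant with `‖u_α - u‖ = uRate / α` in `H¹(Ω)`. -/
def uRate (r₁ r₂ g q : ℝ) : ℝ :=
  √(4 * π * (r₂ ^ 3 - r₁ ^ 3) * (3 * q * r₂ ^ 2 + g * (r₁ ^ 3 - r₂ ^ 3)) ^ 2 / (27 * r₁ ^ 4))

/-- The limit of `α ‖p_α - p‖` in `L²(Ω)`. -/
def pRate (r₁ r₂ g q b z : ℝ) : ℝ :=
  √(π * (r₂ - r₁) ^ 3 / (42525 * r₁ ^ 6) *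
    (6300 * b ^ 2 * r₁ ^ 2 * (r₁ ^ 2 + r₁ * r₂ + r₂ ^ 2) ^ 3
    + 420 * b * r₁ * (r₁ ^ 2 + r₁ * r₂ + r₂ ^ 2) *
      (4 * g * (r₁ ^ 5 + 4 * r₁ ^ 4 * r₂ + 10 * r₁ ^ 3 * r₂ ^ 2 + 14 * r₁ ^ 2 * r₂ ^ 3
          + 11 * r₁ * r₂ ^ 4 + 5 * r₂ ^ 5) * (r₁ - r₂) ^ 2
      + 3 * (q * r₂ ^ 2 * (7 * r₁ ^ 4 + 14 * r₁ ^ 3 * r₂ + 6 * r₁ ^ 2 * r₂ ^ 2 - 7 * r₁ * r₂ ^ 3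
          - 20 * r₂ ^ 4) - 10 * r₁ * z * (r₁ ^ 2 + r₁ * r₂ + r₂ ^ 2) ^ 2))
    + 4 * g ^ 2 * (31 * r₁ ^ 8 + 217 * r₁ ^ 7 * r₂ + 868 * r₁ ^ 6 * r₂ ^ 2
        + 2248 * r₁ ^ 5 * r₂ ^ 3 + 4018 * r₁ ^ 4 * r₂ ^ 4 + 5047 * r₁ ^ 3 * r₂ ^ 5
        + 4336 * r₁ ^ 2 * r₂ ^ 6 + 2380 * r₁ * r₂ ^ 7 + 700 * r₂ ^ 8) * (r₁ - r₂) ^ 4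
    - 24 * g * (r₁ - r₂) ^ 2 *
      (q * r₂ ^ 2 * (-52 * r₁ ^ 7 - 260 * r₁ ^ 6 * r₂ - 675 * r₁ ^ 5 * r₂ ^ 2
          - 970 * r₁ ^ 4 * r₂ ^ 3 - 440 * r₁ ^ 3 * r₂ ^ 4 + 612 * r₁ ^ 2 * r₂ ^ 5
          + 1085 * r₁ * r₂ ^ 6 + 700 * r₂ ^ 7)
      + 70 * r₁ * z * (r₁ ^ 2 + r₁ * r₂ + r₂ ^ 2) ^ 2 *
          (r₁ ^ 3 + 3 * r₁ ^ 2 * r₂ + 6 * r₁ * r₂ ^ 2 + 5 * r₂ ^ 3))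
    + 45 * (q ^ 2 * r₂ ^ 4 * (r₁ - r₂) ^ 2 * (71 * r₁ ^ 4 + 355 * r₁ ^ 3 * r₂
          + 771 * r₁ ^ 2 * r₂ ^ 2 + 952 * r₁ * r₂ ^ 3 + 560 * r₂ ^ 4)
      - 28 * q * r₁ * r₂ ^ 2 * z * (7 * r₁ ^ 6 + 21 * r₁ ^ 5 * r₂ + 27 * r₁ ^ 4 * r₂ ^ 2
          + 13 * r₁ ^ 3 * r₂ ^ 3 - 21 * r₁ ^ 2 * r₂ ^ 4 - 27 * r₁ * r₂ ^ 5 - 20 * r₂ ^ 6)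
      + 140 * r₁ ^ 2 * z ^ 2 * (r₁ ^ 2 + r₁ * r₂ + r₂ ^ 2) ^ 3)))

/-- A factor of the denominators of the constants for `g_op` and `J₁`. -/
def denG (r₁ r₂ M : ℝ) : ℝ :=
  (315 * M * r₁ ^ 2 * (r₁ ^ 2 + r₁ * r₂ + r₂ ^ 2)
    + (2 * r₁ ^ 4 + 10 * r₁ ^ 3 * r₂ + 30 * r₁ ^ 2 * r₂ ^ 2 + 49 * r₁ * r₂ ^ 3 + 35 * r₂ ^ 4)
      * (r₁ - r₂) ^ 4) ^ 2

def gRate (r₁ r₂ M q b z : ℝ) : ℝ :=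
  21 * (r₂ - r₁) / (4 * denG r₁ r₂ M) *
  |4 * (b - z) * (r₁ ^ 2 + r₁ * r₂ + r₂ ^ 2) *
      (1575 * M * r₁ ^ 2 * (r₁ ^ 2 + r₁ * r₂ + r₂ ^ 2) ^ 2
        - (r₁ - r₂) ^ 4 * (4 * r₁ ^ 6 + 24 * r₁ ^ 5 * r₂ + 84 * r₁ ^ 4 * r₂ ^ 2
          + 199 * r₁ ^ 3 * r₂ ^ 3 + 354 * r₁ ^ 2 * r₂ ^ 4 + 420 * r₁ * r₂ ^ 5 + 175 * r₂ ^ 6))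
    - 630 * M * q * r₂ ^ 2 * r₁ * (r₁ ^ 2 + r₁ * r₂ + r₂ ^ 2) *
      (-7 * r₁ ^ 4 - 14 * r₁ ^ 3 * r₂ - 6 * r₁ ^ 2 * r₂ ^ 2 + 7 * r₁ * r₂ ^ 3 + 20 * r₂ ^ 4)
    - 3 * q * r₂ ^ 2 * (r₁ - r₂) ^ 4 *
      (7 * r₁ ^ 7 + 49 * r₁ ^ 6 * r₂ + 146 * r₁ ^ 5 * r₂ ^ 2 + 198 * r₁ ^ 4 * r₂ ^ 3
        + 105 * r₁ ^ 3 * r₂ ^ 4 - 170 * r₁ ^ 2 * r₂ ^ 5 - 265 * r₁ * r₂ ^ 6 - 70 * r₂ ^ 7)|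

/-- A factor of the denominators of the constants for `q_op` and `J₂`. -/
def denQ (r₁ r₂ M : ℝ) : ℝ := (r₂ ^ 2 * (r₁ - r₂) ^ 3 - 3 * M * r₁ ^ 2) ^ 2

def qRate (r₁ r₂ M g b z : ℝ) : ℝ :=
  (r₂ - r₁) / (40 * denQ r₁ r₂ M) *
  |20 * (b - z) * (6 * M * r₁ ^ 2 * (r₁ ^ 2 + r₁ * r₂ + r₂ ^ 2)
      - r₂ ^ 2 * (r₁ - r₂) ^ 3 * (r₁ ^ 2 - 2 * r₁ * r₂ - 2 * r₂ ^ 2))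
    + g * (r₁ - r₂) ^ 2 *
      (4 * M * r₁ * (7 * r₁ ^ 3 + 21 * r₁ ^ 2 * r₂ + 27 * r₁ * r₂ ^ 2 + 20 * r₂ ^ 3)
        - r₂ ^ 2 * (r₁ - r₂) ^ 3 * (7 * r₁ ^ 2 + 14 * r₁ * r₂ + 4 * r₂ ^ 2))|

def bRate (r₁ r₂ M g q : ℝ) : ℝ :=
  |(r₁ ^ 3 - r₂ ^ 3) * (g * (r₁ ^ 3 - r₂ ^ 3) + 3 * q * r₂ ^ 2)
    / (3 * r₁ ^ 2 * (-3 * M * r₁ ^ 2 + r₁ ^ 3 - r₂ ^ 3))|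

/-- The denominator of the constants for the simultaneous problem. -/
def denGQ (r₁ r₂ M N : ℝ) : ℝ :=
  (33600 * M * (r₁ ^ 2 + r₁ * r₂ + r₂ ^ 2) * (3 * N * r₁ ^ 2 - r₂ ^ 2 * (r₁ - r₂) ^ 3)
    + (r₁ - r₂) ^ 4 *
      (320 * N * (2 * r₁ ^ 4 + 10 * r₁ ^ 3 * r₂ + 30 * r₁ ^ 2 * r₂ ^ 2 + 49 * r₁ * r₂ ^ 3
          + 35 * r₂ ^ 4)
        - r₂ ^ 2 * (r₁ - r₂) ^ 3 * (99 * r₁ ^ 2 + 152 * r₁ * r₂ + 64 * r₂ ^ 2))) ^ 2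

def gRate₄ (r₁ r₂ M N b z : ℝ) : ℝ :=
  840 * (r₂ - r₁) * |b - z| / denGQ r₁ r₂ M N *
  |16800 * M * (r₁ ^ 2 + r₁ * r₂ + r₂ ^ 2) *
      (240 * N ^ 2 * r₁ ^ 2 * (r₁ ^ 2 + r₁ * r₂ + r₂ ^ 2) ^ 2
        - 2 * N * r₂ ^ 2 * (59 * r₁ ^ 4 + 55 * r₁ ^ 3 * r₂ + 27 * r₁ ^ 2 * r₂ ^ 2
          - 56 * r₁ * r₂ ^ 3 - 40 * r₂ ^ 4) * (r₁ - r₂) ^ 3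
        + r₂ ^ 4 * (15 * r₁ ^ 2 + 2 * r₁ * r₂ - 2 * r₂ ^ 2) * (r₁ - r₂) ^ 6)
    - (r₁ - r₂) ^ 4 *
      (2560 * N ^ 2 * (4 * r₁ ^ 8 + 28 * r₁ ^ 7 * r₂ + 112 * r₁ ^ 6 * r₂ ^ 2
          + 307 * r₁ ^ 5 * r₂ ^ 3 + 637 * r₁ ^ 4 * r₂ ^ 4 + 973 * r₁ ^ 3 * r₂ ^ 5
          + 949 * r₁ ^ 2 * r₂ ^ 6 + 595 * r₁ * r₂ ^ 7 + 175 * r₂ ^ 8)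
        - 8 * N * r₂ ^ 2 * (417 * r₁ ^ 6 + 1610 * r₁ ^ 5 * r₂ + 2915 * r₁ ^ 4 * r₂ ^ 2
          + 1490 * r₁ ^ 3 * r₂ ^ 3 - 575 * r₁ ^ 2 * r₂ ^ 4 + 3448 * r₁ * r₂ ^ 5
          + 1720 * r₂ ^ 6) * (r₁ - r₂) ^ 3
        + r₂ ^ 4 * (297 * r₁ ^ 4 + 525 * r₁ ^ 3 * r₂ + 433 * r₁ ^ 2 * r₂ ^ 2
          + 256 * r₁ * r₂ ^ 3 + 64 * r₂ ^ 4) * (r₁ - r₂) ^ 6)|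

def qRate₄ (r₁ r₂ M N b z : ℝ) : ℝ :=
  24 * (r₂ - r₁) * |b - z| / denGQ r₁ r₂ M N *
  |23520000 * M ^ 2 * (r₁ ^ 2 + r₁ * r₂ + r₂ ^ 2) ^ 2 *
      (6 * N * r₁ ^ 2 * (r₁ ^ 2 + r₁ * r₂ + r₂ ^ 2)
        - r₂ ^ 2 * (r₁ - r₂) ^ 3 * (r₁ ^ 2 - 2 * r₁ * r₂ - 2 * r₂ ^ 2))
    - 1400 * M * (r₁ ^ 2 + r₁ * r₂ + r₂ ^ 2) * (r₁ - r₂) ^ 4 *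
      (8 * N * (281 * r₁ ^ 6 + 1686 * r₁ ^ 5 * r₂ + 4431 * r₁ ^ 4 * r₂ ^ 2
          + 6446 * r₁ ^ 3 * r₂ ^ 3 + 6441 * r₁ ^ 2 * r₂ ^ 4 + 4200 * r₁ * r₂ ^ 5 + 1400 * r₂ ^ 6)
        - r₂ ^ 2 * (r₁ - r₂) ^ 3 * (489 * r₁ ^ 4 + 2153 * r₁ ^ 3 * r₂ + 3105 * r₁ ^ 2 * r₂ ^ 2
          + 600 * r₁ * r₂ ^ 3 - 152 * r₂ ^ 4))
    - (r₁ - r₂) ^ 8 *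
      (320 * N * (4 * r₁ ^ 8 + 44 * r₁ ^ 7 * r₂ + 264 * r₁ ^ 6 * r₂ ^ 2 + 1049 * r₁ ^ 5 * r₂ ^ 3
          + 2539 * r₁ ^ 4 * r₂ ^ 4 + 3495 * r₁ ^ 3 * r₂ ^ 5 + 2055 * r₁ ^ 2 * r₂ ^ 6
          - 315 * r₁ * r₂ ^ 7 - 315 * r₂ ^ 8)
        - r₂ ^ 2 * (r₁ - r₂) ^ 3 * (99 * r₁ ^ 6 + 106 * r₁ ^ 5 * r₂ - 1675 * r₁ ^ 4 * r₂ ^ 2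
          - 3270 * r₁ ^ 3 * r₂ ^ 3 - 3405 * r₁ ^ 2 * r₂ ^ 4 - 2304 * r₁ * r₂ ^ 5
          - 576 * r₂ ^ 6))|

def J₁Rate (r₁ r₂ M q b z : ℝ) : ℝ :=
  π * (r₂ - r₁) / (80 * denG r₁ r₂ M) *
  |(q * (-2520 * M * r₁ ^ 3 * r₂ ^ 2 + 33 * r₁ ^ 7 * r₂ ^ 2 - 2520 * M * r₁ ^ 2 * r₂ ^ 3
        + 33 * r₁ ^ 6 * r₂ ^ 3 - 2520 * M * r₁ * r₂ ^ 4 - 177 * r₁ ^ 5 * r₂ ^ 4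
        - 198 * r₁ ^ 4 * r₂ ^ 5 + 747 * r₁ ^ 3 * r₂ ^ 6 - 471 * r₁ ^ 2 * r₂ ^ 7
        - 51 * r₁ * r₂ ^ 8 + 84 * r₂ ^ 9)
      + (b - z) * (56 * r₁ ^ 8 + 56 * r₁ ^ 7 * r₂ + 56 * r₁ ^ 6 * r₂ ^ 2
        - 280 * r₁ ^ 5 * r₂ ^ 3 - 280 * r₁ ^ 4 * r₂ ^ 4 + 224 * r₁ ^ 3 * r₂ ^ 5
        + 224 * r₁ ^ 2 * r₂ ^ 6 + 224 * r₁ * r₂ ^ 7 - 280 * r₂ ^ 8)) *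
    (q * (2100 * M * r₁ ^ 4 * r₂ ^ 2 - 3 * r₁ ^ 8 * r₂ ^ 2 + 4200 * M * r₁ ^ 3 * r₂ ^ 3
        - 6 * r₁ ^ 7 * r₂ ^ 3 + 21 * r₁ ^ 6 * r₂ ^ 4 - 2100 * M * r₁ * r₂ ^ 5
        + 63 * r₁ ^ 5 * r₂ ^ 5 - 4200 * M * r₂ ^ 6 - 210 * r₁ ^ 4 * r₂ ^ 6
        + 168 * r₁ ^ 3 * r₂ ^ 7 + 21 * r₁ ^ 2 * r₂ ^ 8 - 81 * r₁ * r₂ ^ 9 + 27 * r₂ ^ 10)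
      + (b - z) * (4200 * M * r₁ ^ 5 + 8 * r₁ ^ 9 + 8400 * M * r₁ ^ 4 * r₂ + 16 * r₁ ^ 8 * r₂
        + 12600 * M * r₁ ^ 3 * r₂ ^ 2 + 24 * r₁ ^ 7 * r₂ ^ 2 + 8400 * M * r₁ ^ 2 * r₂ ^ 3
        - 88 * r₁ ^ 6 * r₂ ^ 3 + 4200 * M * r₁ * r₂ ^ 4 - 200 * r₁ ^ 5 * r₂ ^ 4
        + 192 * r₁ ^ 4 * r₂ ^ 5 + 584 * r₁ ^ 3 * r₂ ^ 6 - 824 * r₁ ^ 2 * r₂ ^ 7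
        + 288 * r₁ * r₂ ^ 8))|

def J₂Rate (r₁ r₂ M g b z : ℝ) : ℝ :=
  π / (2400 * denQ r₁ r₂ M) * (r₂ - r₁) ^ 2 *
  |(g * (-40 * M * r₁ ^ 3 - 40 * M * r₁ ^ 2 * r₂ - 40 * M * r₁ * r₂ ^ 2 + 11 * r₁ ^ 4 * r₂ ^ 2
        - 29 * r₁ ^ 3 * r₂ ^ 3 + 21 * r₁ ^ 2 * r₂ ^ 4 + r₁ * r₂ ^ 5 - 4 * r₂ ^ 6)
      + (b - z) * (-20 * r₁ ^ 2 * r₂ ^ 2 - 20 * r₁ * r₂ ^ 3 + 40 * r₂ ^ 4)) *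
    (g * (-16 * M * r₁ ^ 5 - 16 * M * r₁ ^ 4 * r₂ - 16 * M * r₁ ^ 3 * r₂ ^ 2
        + 3 * r₁ ^ 6 * r₂ ^ 2 + 64 * M * r₁ ^ 2 * r₂ ^ 3 - 13 * r₁ ^ 5 * r₂ ^ 3
        + 64 * M * r₁ * r₂ ^ 4 + 20 * r₁ ^ 4 * r₂ ^ 4 - 80 * M * r₂ ^ 5
        - 10 * r₁ ^ 3 * r₂ ^ 5 - 5 * r₁ ^ 2 * r₂ ^ 6 + 7 * r₁ * r₂ ^ 7 - 2 * r₂ ^ 8)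
      + (b - z) * (-240 * M * r₁ ^ 3 - 240 * M * r₁ ^ 2 * r₂ - 240 * M * r₁ * r₂ ^ 2
        + 60 * r₁ ^ 4 * r₂ ^ 2 - 180 * r₁ ^ 3 * r₂ ^ 3 + 180 * r₁ ^ 2 * r₂ ^ 4
        - 60 * r₁ * r₂ ^ 5))|

def J₃Rate (r₁ r₂ M g q z : ℝ) : ℝ :=
  2 * π / (45 * r₁ ^ 2 * |-3 * M * r₁ ^ 2 + r₁ ^ 3 - r₂ ^ 3|) *
  |2 * g ^ 2 * M * r₁ * (r₁ ^ 9 - 6 * r₁ ^ 6 * r₂ ^ 3 + 9 * r₁ ^ 4 * r₂ ^ 5 - 9 * r₁ * r₂ ^ 8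
      + 5 * r₂ ^ 9)
    - 3 * g * M * r₁ * (10 * r₁ * z * (r₁ ^ 3 - r₂ ^ 3) ^ 2
      - q * r₂ ^ 2 * (r₁ - r₂) ^ 3 *
        (7 * r₁ ^ 3 + 21 * r₁ ^ 2 * r₂ + 27 * r₁ * r₂ ^ 2 + 20 * r₂ ^ 3))
    + 45 * q * r₂ ^ 2 * M * r₁ *
      (q * r₂ ^ 2 * (r₁ - r₂) ^ 2 * (r₁ + 2 * r₂) - 2 * r₁ * z * (r₁ ^ 3 - r₂ ^ 3))|

def J₄Rate (r₁ r₂ M N b z : ℝ) : ℝ :=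
  16 * π * r₁ * (r₂ - r₁) ^ 3 * (b - z) ^ 2 / denGQ r₁ r₂ M N *
  |35280000 * M ^ 2 * r₂ ^ 2 * (r₁ + 2 * r₂) * (r₁ ^ 2 + r₁ * r₂ + r₂ ^ 2) ^ 2 *
      (4 * N * (r₁ ^ 2 + r₁ * r₂ + r₂ ^ 2) - r₂ ^ 2 * (r₁ - r₂) ^ 3)
    - 4200 * M * (r₁ ^ 3 - r₂ ^ 3) *
      (4480 * N ^ 2 * (r₁ ^ 2 + r₁ * r₂ + r₂ ^ 2) ^ 2 *
          (r₁ ^ 3 + 3 * r₁ ^ 2 * r₂ + 6 * r₁ * r₂ ^ 2 + 5 * r₂ ^ 3)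
        - 8 * N * r₂ ^ 2 * (247 * r₁ ^ 5 + 856 * r₁ ^ 4 * r₂ + 1963 * r₁ ^ 3 * r₂ ^ 2
          + 2840 * r₁ ^ 2 * r₂ ^ 3 + 2567 * r₁ * r₂ ^ 4 + 1292 * r₂ ^ 5) * (r₁ - r₂) ^ 3
        + r₂ ^ 4 * (207 * r₁ ^ 3 + 301 * r₁ ^ 2 * r₂ + 177 * r₁ * r₂ ^ 2 + 50 * r₂ ^ 3)
          * (r₁ - r₂) ^ 6)
    + (r₁ - r₂) ^ 5 *
      (-(35840 * N ^ 2 * (r₁ ^ 9 + 10 * r₁ ^ 8 * r₂ + 55 * r₁ ^ 7 * r₂ ^ 2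
            + 199 * r₁ ^ 6 * r₂ ^ 3 + 505 * r₁ ^ 5 * r₂ ^ 4 + 919 * r₁ ^ 4 * r₂ ^ 5
            + 1195 * r₁ ^ 3 * r₂ ^ 6 + 1060 * r₁ ^ 2 * r₂ ^ 7 + 601 * r₁ * r₂ ^ 8
            + 180 * r₂ ^ 9)
          - 16 * N * r₂ ^ 2 * (711 * r₁ ^ 7 + 4763 * r₁ ^ 6 * r₂ + 17621 * r₁ ^ 5 * r₂ ^ 2
            + 40700 * r₁ ^ 4 * r₂ ^ 3 + 57025 * r₁ ^ 3 * r₂ ^ 4 + 44014 * r₁ ^ 2 * r₂ ^ 5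
            + 18712 * r₁ * r₂ ^ 6 + 3879 * r₂ ^ 7) * (r₁ - r₂) ^ 3
          + r₂ ^ 4 * (891 * r₁ ^ 5 + 2880 * r₁ ^ 4 * r₂ + 3755 * r₁ ^ 3 * r₂ ^ 2
            + 2480 * r₁ ^ 2 * r₂ ^ 3 + 875 * r₁ * r₂ ^ 4 + 144 * r₂ ^ 5) * (r₁ - r₂) ^ 6))|

end ShellControl

end

open ShellControl

/-! Everything is radial, so the whole problem can be solved in closed form. In dimension three the
functions `1` and `1/r` are harmonic away from the origin, while `r ^ 2`, `r` and `r ^ 4` have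
Laplacians `6`, `2/r` and `20 r ^ 2`. Hence a constant source gives a state in the span of `r ^ 2,
1, 1/r`, and a source of that form gives an adjoint state in the span of `r ^ 4, r ^ 2, r, 1, 1/r`.
The two boundary conditions fix the coefficients of `1` and `1/r`. Uniqueness among all classical
solutions, radial or not, comes from a comparison principle (`nonpos_of_laplacian_eq_zero`) proved
with a strictly subharmonic barrier; it identifies the states chosen by `Classical.epsilon` with
these explicit profiles.

The state is linear in the data `(g, q, b)`, and subtracting `z` merely replaces `b` by `b - z`. So
the tracking term is a quadratic form in three scaled data, and its coefficients are the `Gᵢ`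
(`sqNormH_stateProfile_sub`). `HasCostForm` records just this, so that both boundary conditions are
treated at once. The form is a squared norm, hence nonnegative, and adding the penalty terms makes
it strictly convex in the controls; completing the square gives the optimal controls and values.

For the rates, the Dirichlet and Robin problems belong to one family with parameter `s = 1 / (α
r₁)`, with `s = 0` for Dirichlet. Every optimal quantity is a function of `s` differentiable at `0`,
and `rate_of_hasDerivAt` turns its derivative `D` into convergence, order `1/α` and the limit
constant `|D| / r₁`. The derivatives of controls come in the shape given by implicit differentiation
of the stationarity equations, those of values in the shape of the envelope theorem: only the
derivatives of the `Gᵢ` enter, the control being frozen at its optimum. What remains is polynomial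
algebra in `r₁, r₂`.

The states need no limit: `u_α - u` is constant on the shell. The difference `p_α - p` is `1/α`
times a profile whose coefficients depend continuously on `1/α`. -/

noncomputable section

namespace ShellControl

/-! ### Second derivatives along lines, local maxima, and the Laplacian of radial functions -/

theorem iteratedFDeriv_two_eq_of_hasDerivAt_line {F : E3 → ℝ} {x v : E3} {f' : ℝ → ℝ} {f'' : ℝ}
    (hF : ContDiffAt ℝ 2 F x)
    (h₁ : ∀ᶠ t in 𝓝 (0 : ℝ), HasDerivAt (fun t : ℝ => F (x + t • v)) (f' t) t)
    (h₂ : HasDerivAt f' f'' 0) : iteratedFDeriv ℝ 2 F x ![v, v] = f'' := by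
  have hline : ∀ t : ℝ, HasDerivAt (fun t : ℝ => x + t • v) v t := fun t => by
    simpa using ((hasDerivAt_id t).smul_const v).const_add x
  have hcont : Tendsto (fun t : ℝ => x + t • v) (𝓝 0) (𝓝 x) := by
    have := (hline 0).continuousAt.tendsto
    simpa using this
  have hev : ∀ᶠ t in 𝓝 (0 : ℝ), DifferentiableAt ℝ F (x + t • v) := by
    have h := hF.eventually (by simp)
    filter_upwards [hcont.eventually h] with t ht using ht.differentiableAt (by norm_num)
  have hff : f' =ᶠ[𝓝 0] fun t => fderiv ℝ F (x + t • v) v := by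
    filter_upwards [h₁, hev] with t ht hd
    exact ht.unique (hd.hasFDerivAt.comp_hasDerivAt t (hline t))
  have hd2 : DifferentiableAt ℝ (fderiv ℝ F) x :=
    (hF.fderiv_right (m := 1) (by norm_num)).differentiableAt (by norm_num)
  have h3 : HasDerivAt (fun t : ℝ => fderiv ℝ F (x + t • v)) (fderiv ℝ (fderiv ℝ F) x v) 0 := by
    have : HasFDerivAt (fderiv ℝ F) (fderiv ℝ (fderiv ℝ F) x) (x + (0 : ℝ) • v) := by
      simpa using hd2.hasFDerivAt
    exact this.comp_hasDerivAt 0 (hline 0)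
  have h4 : HasDerivAt (fun t : ℝ => fderiv ℝ F (x + t • v) v) (fderiv ℝ (fderiv ℝ F) x v v) 0 := by
    simpa using h3.clm_apply (hasDerivAt_const (0 : ℝ) v)
  rw [iteratedFDeriv_two_apply]
  simpa using (h4.congr_of_eventuallyEq hff).unique h₂

theorem iteratedFDeriv_two_nonpos_of_isLocalMax {F : E3 → ℝ} {x v : E3}
    (hF : ContDiffAt ℝ 2 F x) (hmax : IsLocalMax F x) : iteratedFDeriv ℝ 2 F x ![v, v] ≤ 0 := by
  have hline : ∀ t : ℝ, HasDerivAt (fun t : ℝ => x + t • v) v t := fun t => by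
    simpa using ((hasDerivAt_id t).smul_const v).const_add x
  have hcont : Tendsto (fun t : ℝ => x + t • v) (𝓝 0) (𝓝 x) := by
    have := (hline 0).continuousAt.tendsto
    simpa using this
  set f : ℝ → ℝ := fun t => F (x + t • v) with hf
  have hfC : ContDiffAt ℝ 2 f 0 := by
    have : ContDiffAt ℝ 2 F (x + (0 : ℝ) • v) := by simpa using hF
    exact this.comp (0 : ℝ) (by fun_prop)
  have hfmax : IsLocalMax f 0 := by
    have : ∀ᶠ t in 𝓝 (0 : ℝ), F (x + t • v) ≤ F x := hcont.eventually hmax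
    simpa [IsLocalMax, IsMaxFilter, hf] using this
  have h1 : ∀ᶠ t in 𝓝 (0 : ℝ), HasDerivAt f (deriv f t) t := by
    filter_upwards [hfC.eventually (by simp)] with t ht
    exact (ht.differentiableAt (by norm_num)).hasDerivAt
  have h2 : HasDerivAt (deriv f) (deriv (deriv f) 0) 0 := by
    have : ContDiffAt ℝ 1 (deriv f) 0 := by
      have := (hfC.fderiv_right (m := 1) (by norm_num)).clm_apply
        (contDiffAt_const (c := (1 : ℝ)))
      simpa using this
    exact (this.differentiableAt (by norm_num)).hasDerivAt
  rw [iteratedFDeriv_two_eq_of_hasDerivAt_line hF h1 h2]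
  -- A positive second derivative would make `0` a local minimum as well, so `f` would be constant
  -- near `0` and its second derivative would vanish.
  by_contra! hpos
  have hmin := isLocalMin_of_deriv_deriv_pos hpos hfmax.deriv_eq_zero hfC.continuousAt
  have hc : f =ᶠ[𝓝 0] fun _ => f 0 := by
    filter_upwards [hmin, hfmax] with t ha hb using le_antisymm hb ha
  have hd : deriv f =ᶠ[𝓝 0] fun _ => 0 := by
    simpa using hc.deriv
  have := hd.deriv_eq
  simp at this
  linarith

theorem laplacian_nonpos_of_isLocalMax {F : E3 → ℝ} {x : E3}
    (hF : ContDiffAt ℝ 2 F x) (hmax : IsLocalMax F x) : Laplacian.laplacian F x ≤ 0 := by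
  rw [InnerProductSpace.laplacian_eq_iteratedFDeriv_orthonormalBasis F (EuclideanSpace.basisFun (Fin 3) ℝ)]
  exact Finset.sum_nonpos fun i _ => iteratedFDeriv_two_nonpos_of_isLocalMax hF hmax

theorem contDiffAt_comp_norm {φ : ℝ → ℝ} {x : E3} (hx : x ≠ 0) (hφ : ContDiffAt ℝ 2 φ ‖x‖) :
    ContDiffAt ℝ 2 (fun y : E3 => φ ‖y‖) x :=
  hφ.comp x (contDiffAt_norm ℝ hx)

/-- Along a coordinate direction the squared norm is a quadratic polynomial in `t`, so each pure
second derivative is a one-variable chain rule. Summing over the basis with `∑ xᵢ² = ‖x‖²` leaves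
the factor `(3 - 1) / ‖x‖` in front of the first derivative. -/
theorem laplacian_comp_norm {φ φ' : ℝ → ℝ} {φ'' : ℝ} {x : E3} (hx : x ≠ 0)
    (hφ : ContDiffAt ℝ 2 φ ‖x‖) (h₁ : ∀ r, 0 < r → HasDerivAt φ (φ' r) r)
    (h₂ : HasDerivAt φ' φ'' ‖x‖) :
    Laplacian.laplacian (fun y : E3 => φ ‖y‖) x = φ'' + 2 / ‖x‖ * φ' ‖x‖ := by
  have hr : 0 < ‖x‖ := norm_pos_iff.2 hx
  have key : ∀ i : Fin 3, iteratedFDeriv ℝ 2 (fun y : E3 => φ ‖y‖) x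
      ![EuclideanSpace.basisFun (Fin 3) ℝ i, EuclideanSpace.basisFun (Fin 3) ℝ i] =
      φ'' * (x i / ‖x‖) ^ 2 + φ' ‖x‖ * ((‖x‖ ^ 2 - x i ^ 2) / ‖x‖ ^ 3) := by
    intro i
    set e := EuclideanSpace.basisFun (Fin 3) ℝ i
    have hsq : ∀ t : ℝ, ‖x + t • e‖ ^ 2 = ‖x‖ ^ 2 + 2 * t * x i + t ^ 2 := by
      intro t
      rw [norm_add_sq_real, real_inner_smul_right, norm_smul]
      simp [e, EuclideanSpace.inner_single_right]
      ring
    have hnorm : ∀ t : ℝ, ‖x + t • e‖ = √(‖x‖ ^ 2 + 2 * t * x i + t ^ 2) := fun t => by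
      rw [← hsq, Real.sqrt_sq (norm_nonneg _)]
    have hne : ∀ᶠ t in 𝓝 (0 : ℝ), 0 < ‖x‖ ^ 2 + 2 * t * x i + t ^ 2 := by
      have : ContinuousAt (fun t : ℝ => ‖x‖ ^ 2 + 2 * t * x i + t ^ 2) 0 := by fun_prop
      refine this.eventually (lt_mem_nhds ?_)
      simp; positivity
    have hN : ∀ t : ℝ, 0 < ‖x‖ ^ 2 + 2 * t * x i + t ^ 2 →
        HasDerivAt (fun t : ℝ => ‖x + t • e‖) ((x i + t) / ‖x + t • e‖) t := by
      intro t ht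
      have h := (((((hasDerivAt_id t).const_mul 2).mul_const (x i)).const_add (‖x‖ ^ 2)).add
        ((hasDerivAt_id t).pow 2)).sqrt (by simpa using ht.ne')
      have h0 : √(‖x‖ ^ 2 + 2 * t * x i + t ^ 2) ≠ 0 := (Real.sqrt_pos.2 ht).ne'
      simp_rw [hnorm]
      refine HasDerivAt.congr_deriv h ?_
      simp only [id, Pi.add_apply, Pi.pow_apply]
      rw [div_eq_div_iff (by positivity) h0]
      norm_num
      ring
    have hpos0 : 0 < ‖x‖ ^ 2 + 2 * 0 * x i + 0 ^ 2 := by simp; positivity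
    refine iteratedFDeriv_two_eq_of_hasDerivAt_line
      (f' := fun t => φ' ‖x + t • e‖ * ((x i + t) / ‖x + t • e‖))
      (contDiffAt_comp_norm hx hφ) ?_ ?_
    · filter_upwards [hne] with t ht
      have hp : 0 < ‖x + t • e‖ := by rw [hnorm]; exact Real.sqrt_pos.2 ht
      exact (h₁ _ hp).comp t (hN t ht)
    · have hN0 := hN 0 hpos0
      have h₂' : HasDerivAt φ' φ'' ‖x + (0 : ℝ) • e‖ := by simpa using h₂
      have := (h₂'.comp 0 hN0).mul (((hasDerivAt_id (0 : ℝ)).const_add (x i)).div hN0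
        (by simpa using hx))
      refine HasDerivAt.congr_deriv this ?_
      simp
      field_simp
  have hsum : x 0 ^ 2 + x 1 ^ 2 + x 2 ^ 2 = ‖x‖ ^ 2 := by
    rw [EuclideanSpace.real_norm_sq_eq, Fin.sum_univ_three]
  rw [InnerProductSpace.laplacian_eq_iteratedFDeriv_orthonormalBasis _ (EuclideanSpace.basisFun (Fin 3) ℝ)]
  simp only [key, Fin.sum_univ_three]
  have : φ'' * (x 0 / ‖x‖) ^ 2 + φ' ‖x‖ * ((‖x‖ ^ 2 - x 0 ^ 2) / ‖x‖ ^ 3) +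
      (φ'' * (x 1 / ‖x‖) ^ 2 + φ' ‖x‖ * ((‖x‖ ^ 2 - x 1 ^ 2) / ‖x‖ ^ 3)) +
      (φ'' * (x 2 / ‖x‖) ^ 2 + φ' ‖x‖ * ((‖x‖ ^ 2 - x 2 ^ 2) / ‖x‖ ^ 3)) =
      φ'' * ((x 0 ^ 2 + x 1 ^ 2 + x 2 ^ 2) / ‖x‖ ^ 2) +
      φ' ‖x‖ * ((3 * ‖x‖ ^ 2 - (x 0 ^ 2 + x 1 ^ 2 + x 2 ^ 2)) / ‖x‖ ^ 3) := by ring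
  rw [this, hsum]
  field_simp
  ring

/-! ### Radial profiles -/

/-- The radial profiles that occur as states and adjoint states. -/
def profile (c₄ c₂ c₁ c₀ c : ℝ) (r : ℝ) : ℝ := c₄ * r ^ 4 + c₂ * r ^ 2 + c₁ * r + c₀ + c * r⁻¹

theorem hasDerivAt_profile (c₄ c₂ c₁ c₀ c : ℝ) {r : ℝ} (hr : 0 < r) :
    HasDerivAt (profile c₄ c₂ c₁ c₀ c)
      (c₄ * (4 * r ^ 3) + c₂ * (2 * r) + c₁ - c * (r ^ 2)⁻¹) r := by
  have := ((((((hasDerivAt_id r).pow 4).const_mul c₄).add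
    (((hasDerivAt_id r).pow 2).const_mul c₂)).add ((hasDerivAt_id r).const_mul c₁)).add_const
    c₀).add ((hasDerivAt_inv hr.ne').const_mul c)
  refine HasDerivAt.congr_deriv this ?_
  simp
  ring


theorem hasDerivAt_deriv_profile (c₄ c₂ c₁ c : ℝ) {r : ℝ} (hr : 0 < r) :
    HasDerivAt (fun r => c₄ * (4 * r ^ 3) + c₂ * (2 * r) + c₁ - c * (r ^ 2)⁻¹)
      (c₄ * (12 * r ^ 2) + c₂ * 2 + 2 * c * (r ^ 3)⁻¹) r := by
  have := ((((((hasDerivAt_id r).pow 3).const_mul 4).const_mul c₄).add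
    (((hasDerivAt_id r).const_mul 2).const_mul c₂)).add_const c₁).sub
    ((((hasDerivAt_id r).pow 2).inv (by simpa using hr.ne')).const_mul c)
  refine HasDerivAt.congr_deriv this ?_
  simp
  field_simp
  ring


theorem contDiffAt_profile (c₄ c₂ c₁ c₀ c : ℝ) {r : ℝ} (hr : 0 < r) :
    ContDiffAt ℝ 2 (profile c₄ c₂ c₁ c₀ c) r := by
  unfold profile
  have : ContDiffAt ℝ 2 (fun r : ℝ => r⁻¹) r := contDiffAt_inv ℝ hr.ne'
  fun_prop

/-- The harmonic terms `c₀` and `c / r` drop out and remain free for the boundary conditions. The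
term `c₁ r` is there to produce the `1/r` part of the source in the adjoint equation. -/
theorem laplacian_profile (c₄ c₂ c₁ c₀ c : ℝ) {x : E3} (hx : x ≠ 0) :
    Laplacian.laplacian (fun y : E3 => profile c₄ c₂ c₁ c₀ c ‖y‖) x =
      20 * c₄ * ‖x‖ ^ 2 + 6 * c₂ + 2 * c₁ * ‖x‖⁻¹ := by
  have hr : 0 < ‖x‖ := norm_pos_iff.2 hx
  rw [laplacian_comp_norm hx (contDiffAt_profile _ _ _ _ _ hr)
    (fun r h => hasDerivAt_profile c₄ c₂ c₁ c₀ c h) (hasDerivAt_deriv_profile c₄ c₂ c₁ c hr)]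
  field_simp
  ring

/-! ### Normal derivatives of radial functions -/

theorem hasNormalDeriv_outer {φ : ℝ → ℝ} {m : ℝ} {x : E3} (hx : x ≠ 0)
    (h : HasDerivAt φ m ‖x‖) : HasNormalDeriv (fun y => φ ‖y‖) (outerNormal x) x m := by
  have hr : 0 < ‖x‖ := norm_pos_iff.2 hx
  -- Moving along the normal changes the radius by exactly `t`, as long as the point does not cross
  -- the origin; hence the restriction to `t > -‖x‖`.
  have hn : ∀ᶠ t in 𝓝 (0 : ℝ), ‖x + t • outerNormal x‖ = ‖x‖ + t := by
    filter_upwards [lt_mem_nhds (neg_lt_zero.2 hr)] with t ht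
    have : x + t • outerNormal x = (1 + t * ‖x‖⁻¹) • x := by
      simp [outerNormal, add_smul, smul_smul]
    have h0 : 0 < ‖x‖ + t := by linarith
    have h1 : (1 + t * ‖x‖⁻¹) * ‖x‖ = ‖x‖ + t := by field_simp
    rw [this, norm_smul, Real.norm_eq_abs]
    nth_rw 2 [← abs_of_pos hr]
    rw [← abs_mul, h1, abs_of_pos h0]
  have h' : HasDerivAt φ m (‖x‖ + 0) := by simpa using h
  have h2 : HasDerivAt (fun t : ℝ => φ (‖x‖ + t)) m 0 := by
    simpa using h'.comp_const_add ‖x‖ 0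
  exact (h2.congr_of_eventuallyEq (hn.mono fun t ht => by simp only [ht])).hasDerivWithinAt

theorem hasNormalDeriv_inner {φ : ℝ → ℝ} {m : ℝ} {x : E3} (hx : x ≠ 0)
    (h : HasDerivAt φ m ‖x‖) : HasNormalDeriv (fun y => φ ‖y‖) (innerNormal x) x (-m) := by
  have hr : 0 < ‖x‖ := norm_pos_iff.2 hx
  have hn : ∀ᶠ t in 𝓝 (0 : ℝ), ‖x + t • innerNormal x‖ = ‖x‖ - t := by
    filter_upwards [gt_mem_nhds hr] with t ht
    have : x + t • innerNormal x = (1 - t * ‖x‖⁻¹) • x := by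
      rw [sub_smul, one_smul, innerNormal, smul_neg, smul_smul, sub_eq_add_neg]
    have h0 : 0 < ‖x‖ - t := by linarith
    have h1 : (1 - t * ‖x‖⁻¹) * ‖x‖ = ‖x‖ - t := by field_simp
    rw [this, norm_smul, Real.norm_eq_abs]
    nth_rw 2 [← abs_of_pos hr]
    rw [← abs_mul, h1, abs_of_pos h0]
  have h' : HasDerivAt φ m (‖x‖ - 0) := by simpa using h
  have h2 : HasDerivAt (fun t : ℝ => φ (‖x‖ - t)) (-m) 0 := by
    simpa using h'.comp_const_sub ‖x‖ 0
  exact (h2.congr_of_eventuallyEq (hn.mono fun t ht => by simp only [ht])).hasDerivWithinAt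

/-! ### Topology of the shell, one-sided maxima and the comparison principle -/

theorem isOpen_shell (r₁ r₂ : ℝ) : IsOpen (shell r₁ r₂) :=
  (isOpen_lt continuous_const continuous_norm).inter (isOpen_lt continuous_norm continuous_const)

theorem isCompact_closedShell (r₁ r₂ : ℝ) : IsCompact (closedShell r₁ r₂) := by
  refine (isCompact_closedBall (0 : E3) r₂).of_isClosed_subset
    ((isClosed_le continuous_const continuous_norm).inter
      (isClosed_le continuous_norm continuous_const)) fun x hx => ?_
  simpa using hx.2

theorem shell_subset_closedShell (r₁ r₂ : ℝ) : shell r₁ r₂ ⊆ closedShell r₁ r₂ :=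
  fun _ hx => ⟨hx.1.le, hx.2.le⟩

theorem ne_zero_of_lt_norm {r : ℝ} {x : E3} (h : 0 < r) (hx : r ≤ ‖x‖) : x ≠ 0 :=
  norm_pos_iff.1 (h.trans_le hx)

/-- For `t ≤ 0` the outward normal points back into the shell, and `t > r₁ - r₂` keeps the point
from leaving through the other sphere. Thus a maximum over the closed shell is a one-sided maximum
along the normal. -/
theorem eventually_mem_closedShell_outer {r₁ r₂ : ℝ} (hr₁ : 0 < r₁) (hr : r₁ < r₂) {x : E3}
    (hx : ‖x‖ = r₂) : ∀ᶠ t in 𝓝[≤] (0 : ℝ), x + t • outerNormal x ∈ closedShell r₁ r₂ := by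
  have hp : 0 < ‖x‖ := by rw [hx]; linarith
  have h : ∀ᶠ t in 𝓝[≤] (0 : ℝ), r₁ - r₂ < t :=
    nhdsWithin_le_nhds (lt_mem_nhds (by linarith))
  filter_upwards [h, self_mem_nhdsWithin] with t ht ht0
  have ht0 : t ≤ 0 := ht0
  have : x + t • outerNormal x = ((r₂ + t) * r₂⁻¹) • x := by
    rw [outerNormal, smul_smul, add_mul, mul_inv_cancel₀ (by linarith), add_smul, one_smul, hx]
  rw [this]
  have hn : ‖((r₂ + t) * r₂⁻¹) • x‖ = r₂ + t := by
    have : 0 < r₂ := by linarith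
    have h2 : 0 < r₂ + t := by linarith
    rw [norm_smul, hx, Real.norm_eq_abs, abs_of_pos (by positivity)]
    field_simp
  constructor <;> rw [hn] <;> linarith

theorem eventually_mem_closedShell_inner {r₁ r₂ : ℝ} (hr₁ : 0 < r₁) (hr : r₁ < r₂) {x : E3}
    (hx : ‖x‖ = r₁) : ∀ᶠ t in 𝓝[≤] (0 : ℝ), x + t • innerNormal x ∈ closedShell r₁ r₂ := by
  have h : ∀ᶠ t in 𝓝[≤] (0 : ℝ), r₁ - r₂ < t :=
    nhdsWithin_le_nhds (lt_mem_nhds (by linarith))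
  filter_upwards [h, self_mem_nhdsWithin] with t ht ht0
  have ht0 : t ≤ 0 := ht0
  have : x + t • innerNormal x = ((r₁ - t) * r₁⁻¹) • x := by
    rw [innerNormal, smul_neg, smul_smul, sub_mul, mul_inv_cancel₀ (by linarith), sub_smul,
      one_smul, hx, sub_eq_add_neg]
  rw [this]
  have hn : ‖((r₁ - t) * r₁⁻¹) • x‖ = r₁ - t := by
    have h2 : 0 < r₁ - t := by linarith
    rw [norm_smul, hx, Real.norm_eq_abs, abs_of_pos (by positivity)]
    field_simp
  constructor <;> rw [hn] <;> linarith

/-- A one-sided derivative from the left at a one-sided maximum is nonnegative. -/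
theorem nonneg_of_hasDerivWithinAt_Iic {f : ℝ → ℝ} {m : ℝ} (h : HasDerivWithinAt f m (Iic 0) 0)
    (hmax : ∀ᶠ t in 𝓝[≤] (0 : ℝ), f t ≤ f 0) : 0 ≤ m := by
  have h1 := (hasDerivWithinAt_iff_tendsto_slope' (s := Iio 0) (by simp)).1
    (h.mono Iio_subset_Iic_self)
  refine ge_of_tendsto h1 ?_
  filter_upwards [nhdsWithin_mono _ Iio_subset_Iic_self hmax, self_mem_nhdsWithin] with t ht ht0
  have ht0 : t < 0 := ht0
  rw [slope_def_field]
  exact div_nonneg_of_nonpos (by linarith) (by linarith)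

theorem HasNormalDeriv.add {u v : E3 → ℝ} {ν x : E3} {m n : ℝ} (hu : HasNormalDeriv u ν x m)
    (hv : HasNormalDeriv v ν x n) : HasNormalDeriv (fun y => u y + v y) ν x (m + n) :=
  HasDerivWithinAt.add hu hv

theorem HasNormalDeriv.const_mul {u : E3 → ℝ} {ν x : E3} {m : ℝ} (c : ℝ)
    (hu : HasNormalDeriv u ν x m) : HasNormalDeriv (fun y => c * u y) ν x (c * m) :=
  HasDerivWithinAt.const_mul c hu

theorem HasNormalDeriv.sub {u v : E3 → ℝ} {ν x : E3} {m n : ℝ} (hu : HasNormalDeriv u ν x m)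
    (hv : HasNormalDeriv v ν x n) : HasNormalDeriv (fun y => u y - v y) ν x (m - n) :=
  HasDerivWithinAt.sub hu hv

theorem continuousOn_profile {r₁ r₂ : ℝ} (hr₁ : 0 < r₁) (c₄ c₂ c₁ c₀ c : ℝ) :
    ContinuousOn (fun x : E3 => profile c₄ c₂ c₁ c₀ c ‖x‖) (closedShell r₁ r₂) := fun _ hx =>
  (contDiffAt_comp_norm (ne_zero_of_lt_norm hr₁ hx.1) (contDiffAt_profile c₄ c₂ c₁ c₀ c
    (hr₁.trans_le hx.1))).continuousAt.continuousWithinAt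

theorem contDiffOn_profile {r₁ r₂ : ℝ} (hr₁ : 0 < r₁) (c₄ c₂ c₁ c₀ c : ℝ) :
    ContDiffOn ℝ 2 (fun x : E3 => profile c₄ c₂ c₁ c₀ c ‖x‖) (shell r₁ r₂) := fun _ hx =>
  (contDiffAt_comp_norm (ne_zero_of_lt_norm hr₁ hx.1.le) (contDiffAt_profile c₄ c₂ c₁ c₀ c
    (hr₁.trans hx.1))).contDiffWithinAt

/-- Comparison principle for the homogeneous mixed problem, for either condition on `Γ₁`. -/
theorem nonpos_of_laplacian_eq_zero {r₁ r₂ α : ℝ} (hr₁ : 0 < r₁) (hr : r₁ < r₂) (hα : 0 < α)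
    {w : E3 → ℝ} (hC : ContDiffOn ℝ 2 w (shell r₁ r₂)) (hc : ContinuousOn w (closedShell r₁ r₂))
    (hΔ : ∀ x ∈ shell r₁ r₂, Laplacian.laplacian w x = 0)
    (hin : ∀ x : E3, ‖x‖ = r₁ → w x ≤ 0 ∨ HasNormalDeriv w (innerNormal x) x (-(α * w x)))
    (hout : ∀ x : E3, ‖x‖ = r₂ → HasNormalDeriv w (outerNormal x) x 0) :
    ∀ x ∈ closedShell r₁ r₂, w x ≤ 0 := by
  have hr₂ : 0 < r₂ := hr₁.trans hr
  -- The barrier is `φ r = r ^ 2 + C / r`, with Laplacian `6 > 0`. The choice of `C` gives `φ' r₂ =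
  -- 2 r₂ - C / r₂² = -1 / r₂² < 0`, so `φ` excludes maxima both in the interior and on the outer
  -- sphere.
  set C : ℝ := 2 * r₂ ^ 3 + 1 with hCdef
  have hC0 : 0 < C := by positivity
  set φ : ℝ → ℝ := profile 0 1 0 0 C with hφ
  have hφpos : ∀ r, 0 < r → 0 < φ r := fun r h => by simp only [hφ, profile]; positivity
  -- Bounds the perturbed function on the inner sphere under either alternative: `φ r₁` suffices
  -- where `w ≤ 0`, and the second summand accounts for the Robin condition.
  set K : ℝ := φ r₁ + C * (r₁ ^ 2)⁻¹ / α with hK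
  have hφK : φ r₁ ≤ K := by
    have : 0 < C * (r₁ ^ 2)⁻¹ / α := by positivity
    rw [hK]; linarith
  have main : ∀ ε : ℝ, 0 < ε → ∀ x ∈ closedShell r₁ r₂, w x ≤ ε * K := by
    intro ε hε
    set v : E3 → ℝ := fun x => w x + ε * φ ‖x‖ with hv
    have hne : (closedShell r₁ r₂).Nonempty := by
      refine ⟨EuclideanSpace.single 0 r₁, ?_⟩
      simp [closedShell, abs_of_pos hr₁, hr.le]
    obtain ⟨m, hm, hmax⟩ := (isCompact_closedShell r₁ r₂).exists_isMaxOn hne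
      (hc.add ((continuousOn_profile hr₁ 0 1 0 0 C).const_smul ε))
    have hmax : ∀ y ∈ closedShell r₁ r₂, v y ≤ v m := hmax
    have hm0 : m ≠ 0 := ne_zero_of_lt_norm hr₁ hm.1
    have hmp : 0 < ‖m‖ := norm_pos_iff.2 hm0
    have hd := hasDerivAt_profile 0 1 0 0 C hmp
    -- The perturbation makes both exclusions strict, so no boundary point lemma of Hopf type is
    -- needed. A maximum on the outer sphere would need `ε φ' r₂ ≥ 0`, one in the interior `6 ε ≤
    -- 0`. On the inner sphere with the Robin condition, a nonnegative normal derivative gives `α w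
    -- ≤ -ε φ' r₁ ≤ ε C / r₁²`.
    have hvm : v m ≤ ε * K := by
      rcases eq_or_lt_of_le hm.1 with h1 | h1
      · rcases hin m h1.symm with h | h
        · have : ε * φ ‖m‖ ≤ ε * K := by rw [← h1]; gcongr
          simp only [hv]; linarith
        · have hn := h.add ((hasNormalDeriv_inner hm0 hd).const_mul ε)
          have h0 := nonneg_of_hasDerivWithinAt_Iic hn
            ((eventually_mem_closedShell_inner hr₁ hr h1.symm).mono fun t ht => by
              simpa using hmax _ ht)
          rw [← h1] at h0
          have h2 : α * w m ≤ ε * (C * (r₁ ^ 2)⁻¹) := by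
            have : 0 < ε * r₁ := by positivity
            linarith
          have h3 : w m ≤ ε * (C * (r₁ ^ 2)⁻¹ / α) := by
            rw [mul_div_assoc', le_div_iff₀ hα]; linarith
          simp only [hv, hK, ← h1]; linarith
      · exfalso
        rcases eq_or_lt_of_le hm.2 with h2 | h2
        · have hn := (hout m h2).add ((hasNormalDeriv_outer hm0 hd).const_mul ε)
          have h0 := nonneg_of_hasDerivWithinAt_Iic hn
            ((eventually_mem_closedShell_outer hr₁ hr h2).mono fun t ht => by
              simpa using hmax _ ht)
          rw [h2, zero_add] at h0
          have h3 := nonneg_of_mul_nonneg_right h0 hε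
          have : C * (r₂ ^ 2)⁻¹ ≤ 2 * r₂ := by linarith
          rw [← div_eq_mul_inv, div_le_iff₀ (by positivity), hCdef] at this
          linarith
        · have hms : m ∈ shell r₁ r₂ := ⟨h1, h2⟩
          have hnhds : shell r₁ r₂ ∈ 𝓝 m := (isOpen_shell r₁ r₂).mem_nhds hms
          have hw : ContDiffAt ℝ 2 w m := hC.contDiffAt hnhds
          have hp : ContDiffAt ℝ 2 (fun x : E3 => φ ‖x‖) m :=
            contDiffAt_comp_norm hm0 (contDiffAt_profile 0 1 0 0 C hmp)
          have hloc : IsLocalMax v m := by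
            filter_upwards [hnhds] with y hy using hmax y (shell_subset_closedShell _ _ hy)
          have hL := laplacian_nonpos_of_isLocalMax (hw.add (hp.const_smul ε)) hloc
          have e1 := hw.laplacian_add (hp.const_smul ε)
          have e2 := InnerProductSpace.laplacian_smul ε hp
          have e3 := laplacian_profile 0 1 0 0 C hm0
          have e4 : Laplacian.laplacian (w + ε • fun x : E3 => φ ‖x‖) m = ε * 6 := by
            refine e1.trans ?_
            rw [show Laplacian.laplacian (fun y : E3 => ε • φ ‖y‖) m = _ from e2, e3, hΔ m hms]
            simp
          have : Laplacian.laplacian (w + ε • fun x : E3 => φ ‖x‖) m ≤ 0 := hL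
          rw [e4] at this
          linarith
    intro x hx
    have := hmax x hx
    have h2 : 0 < ε * φ ‖x‖ := mul_pos hε (hφpos _ (hr₁.trans_le hx.1))
    simp only [hv] at this hvm
    linarith
  intro x hx
  -- `K` does not depend on `ε`, so the perturbation can be sent to zero.
  have : Tendsto (fun ε : ℝ => ε * K) (𝓝[>] 0) (𝓝 0) := by
    have : Tendsto (fun ε : ℝ => ε * K) (𝓝 0) (𝓝 (0 * K)) := (continuous_mul_const K).tendsto 0
    simpa using this.mono_left nhdsWithin_le_nhds
  exact ge_of_tendsto this (by filter_upwards [self_mem_nhdsWithin] with ε hε using main ε hε x hx)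

/-! ### Uniqueness, and the boundary value problems for radial profiles -/

theorem laplacian_sub_eq_zero {r₁ r₂ : ℝ} {f u v : E3 → ℝ} (hu : ContDiffOn ℝ 2 u (shell r₁ r₂))
    (hv : ContDiffOn ℝ 2 v (shell r₁ r₂))
    (eu : ∀ x ∈ shell r₁ r₂, -(Laplacian.laplacian u x) = f x)
    (ev : ∀ x ∈ shell r₁ r₂, -(Laplacian.laplacian v x) = f x) :
    ∀ x ∈ shell r₁ r₂, Laplacian.laplacian (fun y => u y - v y) x = 0 := by
  intro x hx
  have hn := (isOpen_shell r₁ r₂).mem_nhds hx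
  have := (hu.contDiffAt hn).laplacian_sub (hv.contDiffAt hn)
  have h : Laplacian.laplacian (fun y => u y - v y) x = Laplacian.laplacian (u - v) x := rfl
  rw [h, this]
  linarith [eu x hx, ev x hx]

theorem IsDirichletSol.le {r₁ r₂ q b : ℝ} {f u v : E3 → ℝ} (hr₁ : 0 < r₁) (hr : r₁ < r₂)
    (hu : IsDirichletSol r₁ r₂ f q b u) (hv : IsDirichletSol r₁ r₂ f q b v) :
    ∀ x ∈ closedShell r₁ r₂, u x ≤ v x := by
  intro x hx
  -- The value `1` for `α` is arbitrary: on the inner sphere the difference vanishes, so the first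
  -- alternative always applies.
  have := nonpos_of_laplacian_eq_zero hr₁ hr one_pos (hu.contDiffOn.sub hv.contDiffOn)
    (hu.continuousOn.sub hv.continuousOn)
    (laplacian_sub_eq_zero hu.contDiffOn hv.contDiffOn hu.equation hv.equation)
    (fun y hy => Or.inl (by simp [hu.inner_bc y hy, hv.inner_bc y hy]))
    (fun y hy => by simpa using (hu.outer_bc y hy).sub (hv.outer_bc y hy)) x hx
  linarith

theorem IsRobinSol.le {r₁ r₂ α q b : ℝ} {f u v : E3 → ℝ} (hr₁ : 0 < r₁) (hr : r₁ < r₂)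
    (hα : 0 < α) (hu : IsRobinSol r₁ r₂ α f q b u) (hv : IsRobinSol r₁ r₂ α f q b v) :
    ∀ x ∈ closedShell r₁ r₂, u x ≤ v x := by
  intro x hx
  have := nonpos_of_laplacian_eq_zero hr₁ hr hα (hu.contDiffOn.sub hv.contDiffOn)
    (hu.continuousOn.sub hv.continuousOn)
    (laplacian_sub_eq_zero hu.contDiffOn hv.contDiffOn hu.equation hv.equation)
    (fun y hy => Or.inr (by
      have := (hu.inner_bc y hy).sub (hv.inner_bc y hy)
      have e : -(α * (u y - b)) - -(α * (v y - b)) = -(α * (u y - v y)) := by ring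
      rwa [e] at this))
    (fun y hy => by simpa using (hu.outer_bc y hy).sub (hv.outer_bc y hy)) x hx
  linarith

theorem IsDirichletSol.isUniqueSol {r₁ r₂ q b : ℝ} {f u : E3 → ℝ} (hr₁ : 0 < r₁) (hr : r₁ < r₂)
    (hu : IsDirichletSol r₁ r₂ f q b u) :
    IsUniqueSol r₁ r₂ (IsDirichletSol r₁ r₂ f q b) u :=
  ⟨hu, fun _ hv x hx => le_antisymm (hv.le hr₁ hr hu x hx) (hu.le hr₁ hr hv x hx)⟩

theorem IsRobinSol.isUniqueSol {r₁ r₂ α q b : ℝ} {f u : E3 → ℝ} (hr₁ : 0 < r₁) (hr : r₁ < r₂)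
    (hα : 0 < α) (hu : IsRobinSol r₁ r₂ α f q b u) :
    IsUniqueSol r₁ r₂ (IsRobinSol r₁ r₂ α f q b) u :=
  ⟨hu, fun _ hv x hx => le_antisymm (hv.le hr₁ hr hα hu x hx) (hu.le hr₁ hr hα hv x hx)⟩

theorem isDirichletSol_profile {r₁ r₂ q b c₄ c₂ c₁ c₀ c : ℝ} {f : E3 → ℝ} (hr₁ : 0 < r₁)
    (hr : r₁ < r₂)
    (hf : ∀ x ∈ shell r₁ r₂, f x = -(20 * c₄ * ‖x‖ ^ 2 + 6 * c₂ + 2 * c₁ * ‖x‖⁻¹))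
    (hin : profile c₄ c₂ c₁ c₀ c r₁ = b)
    (hout : c₄ * (4 * r₂ ^ 3) + c₂ * (2 * r₂) + c₁ - c * (r₂ ^ 2)⁻¹ = -q) :
    IsDirichletSol r₁ r₂ f q b (fun x => profile c₄ c₂ c₁ c₀ c ‖x‖) where
  contDiffOn := contDiffOn_profile hr₁ _ _ _ _ _
  continuousOn := continuousOn_profile hr₁ _ _ _ _ _
  equation x hx := by
    rw [laplacian_profile _ _ _ _ _ (ne_zero_of_lt_norm hr₁ hx.1.le), hf x hx]
  inner_bc x hx := by rw [hx, hin]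
  outer_bc x hx := by
    have hp : 0 < ‖x‖ := by linarith
    rw [← hout, ← hx]
    exact hasNormalDeriv_outer (norm_pos_iff.1 hp) (hasDerivAt_profile _ _ _ _ _ hp)

/-- The problem becomes algebra in the coefficients. On the inner sphere the outward normal points
towards the origin, so `-∂u/∂n` is the radial derivative; this explains the sign in `hin`. -/
theorem isRobinSol_profile {r₁ r₂ α q b c₄ c₂ c₁ c₀ c : ℝ} {f : E3 → ℝ} (hr₁ : 0 < r₁)
    (hr : r₁ < r₂)
    (hf : ∀ x ∈ shell r₁ r₂, f x = -(20 * c₄ * ‖x‖ ^ 2 + 6 * c₂ + 2 * c₁ * ‖x‖⁻¹))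
    (hin : c₄ * (4 * r₁ ^ 3) + c₂ * (2 * r₁) + c₁ - c * (r₁ ^ 2)⁻¹ =
      α * (profile c₄ c₂ c₁ c₀ c r₁ - b))
    (hout : c₄ * (4 * r₂ ^ 3) + c₂ * (2 * r₂) + c₁ - c * (r₂ ^ 2)⁻¹ = -q) :
    IsRobinSol r₁ r₂ α f q b (fun x => profile c₄ c₂ c₁ c₀ c ‖x‖) where
  contDiffOn := contDiffOn_profile hr₁ _ _ _ _ _
  continuousOn := continuousOn_profile hr₁ _ _ _ _ _
  equation x hx := by
    rw [laplacian_profile _ _ _ _ _ (ne_zero_of_lt_norm hr₁ hx.1.le), hf x hx]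
  inner_bc x hx := by
    have hp : 0 < ‖x‖ := by linarith
    rw [hx, ← hin, ← hx]
    exact hasNormalDeriv_inner (norm_pos_iff.1 hp) (hasDerivAt_profile _ _ _ _ _ hp)
  outer_bc x hx := by
    have hp : 0 < ‖x‖ := by linarith
    rw [← hout, ← hx]
    exact hasNormalDeriv_outer (norm_pos_iff.1 hp) (hasDerivAt_profile _ _ _ _ _ hp)

/-! ### Coefficients of the explicit states; `k` is `0` (Dirichlet) or `1 / α` (Robin) -/

/-- The coefficient of `1 / r` in the state. -/
def stateInv (r₂ g q : ℝ) : ℝ := r₂ ^ 2 * q - g * r₂ ^ 3 / 3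

/-- The constant coefficient of the state. -/
def stateConst (r₁ r₂ k g q b : ℝ) : ℝ :=
  b + g * r₁ ^ 2 / 6 - stateInv r₂ g q / r₁ - k * (g * r₁ / 3 + stateInv r₂ g q / r₁ ^ 2)

/-- The state as a function of `r`. -/
def stateProfile (r₁ r₂ k g q b : ℝ) : ℝ → ℝ :=
  profile 0 (-g / 6) 0 (stateConst r₁ r₂ k g q b) (stateInv r₂ g q)

/-- The coefficient of `1 / r` in the adjoint state. -/
def adjointInv (r₁ r₂ k g q b z : ℝ) : ℝ :=
  r₂ ^ 2 * (g * r₂ ^ 3 / 30 - (stateConst r₁ r₂ k g q b - z) * r₂ / 3 - stateInv r₂ g q / 2)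

/-- The constant coefficient of the adjoint state. -/
def adjointConst (r₁ r₂ k g q b z : ℝ) : ℝ :=
  -(g * r₁ ^ 4 / 120 - (stateConst r₁ r₂ k g q b - z) * r₁ ^ 2 / 6 - stateInv r₂ g q * r₁ / 2
      + adjointInv r₁ r₂ k g q b z / r₁)
    + k * (g * r₁ ^ 3 / 30 - (stateConst r₁ r₂ k g q b - z) * r₁ / 3 - stateInv r₂ g q / 2
      - adjointInv r₁ r₂ k g q b z / r₁ ^ 2)

/-- The adjoint state as a function of `r`. -/
def adjointProfile (r₁ r₂ k g q b z : ℝ) : ℝ → ℝ :=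
  profile (g / 120) (-(stateConst r₁ r₂ k g q b - z) / 6) (-stateInv r₂ g q / 2)
    (adjointConst r₁ r₂ k g q b z) (adjointInv r₁ r₂ k g q b z)

/-! ### The explicit states and adjoint states -/

theorem isDirichletSol_stateProfile {r₁ r₂ : ℝ} (hr₁ : 0 < r₁) (hr : r₁ < r₂) (g q b : ℝ) :
    IsDirichletSol r₁ r₂ (fun _ => g) q b (fun x => stateProfile r₁ r₂ 0 g q b ‖x‖) := by
  have hr₂ : r₂ ≠ 0 := by linarith
  refine isDirichletSol_profile hr₁ hr (fun x _ => by ring) ?_ ?_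
  · simp only [profile, stateConst]; ring
  · simp only [stateInv]; field_simp; ring

theorem isRobinSol_stateProfile {r₁ r₂ α : ℝ} (hr₁ : 0 < r₁) (hr : r₁ < r₂) (hα : 0 < α)
    (g q b : ℝ) :
    IsRobinSol r₁ r₂ α (fun _ => g) q b (fun x => stateProfile r₁ r₂ (1 / α) g q b ‖x‖) := by
  have hr₂ : r₂ ≠ 0 := by linarith
  refine isRobinSol_profile hr₁ hr (fun x _ => by ring) ?_ ?_
  · simp only [profile, stateConst]; field_simp; ring
  · simp only [stateInv]; field_simp; ring

theorem isUniqueSol_state {r₁ r₂ : ℝ} (hr₁ : 0 < r₁) (hr : r₁ < r₂) (g q b : ℝ) :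
    IsUniqueSol r₁ r₂ (IsDirichletSol r₁ r₂ (fun _ => g) q b) (state r₁ r₂ g q b) :=
  (Classical.epsilon_spec (p := IsDirichletSol r₁ r₂ (fun _ => g) q b)
    ⟨_, isDirichletSol_stateProfile hr₁ hr g q b⟩).isUniqueSol hr₁ hr

theorem isUniqueSol_stateR {r₁ r₂ α : ℝ} (hr₁ : 0 < r₁) (hr : r₁ < r₂) (hα : 0 < α)
    (g q b : ℝ) :
    IsUniqueSol r₁ r₂ (IsRobinSol r₁ r₂ α (fun _ => g) q b) (stateR r₁ r₂ α g q b) :=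
  (Classical.epsilon_spec (p := IsRobinSol r₁ r₂ α (fun _ => g) q b)
    ⟨_, isRobinSol_stateProfile hr₁ hr hα g q b⟩).isUniqueSol hr₁ hr hα

/-- Uniqueness identifies the unspecified solution selected by `Classical.epsilon` with the explicit
one. Agreement on the open shell is enough both for the norms and for the source term of the adjoint
problem. -/
theorem state_eq {r₁ r₂ : ℝ} (hr₁ : 0 < r₁) (hr : r₁ < r₂) (g q b : ℝ) :
    ∀ x ∈ shell r₁ r₂, state r₁ r₂ g q b x = stateProfile r₁ r₂ 0 g q b ‖x‖ := fun _ hx =>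
  ((isUniqueSol_state hr₁ hr g q b).2 _ (isDirichletSol_stateProfile hr₁ hr g q b)
    (shell_subset_closedShell _ _ hx)).symm

theorem stateR_eq {r₁ r₂ α : ℝ} (hr₁ : 0 < r₁) (hr : r₁ < r₂) (hα : 0 < α) (g q b : ℝ) :
    ∀ x ∈ shell r₁ r₂, stateR r₁ r₂ α g q b x = stateProfile r₁ r₂ (1 / α) g q b ‖x‖ :=
  fun _ hx => ((isUniqueSol_stateR hr₁ hr hα g q b).2 _ (isRobinSol_stateProfile hr₁ hr hα g q b)
    (shell_subset_closedShell _ _ hx)).symm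

theorem isDirichletSol_adjointProfile {r₁ r₂ : ℝ} (hr₁ : 0 < r₁) (hr : r₁ < r₂)
    (g q b z : ℝ) : IsDirichletSol r₁ r₂ (fun x => state r₁ r₂ g q b x - z) 0 0
      (fun x => adjointProfile r₁ r₂ 0 g q b z ‖x‖) := by
  have hr₂ : r₂ ≠ 0 := by linarith
  refine isDirichletSol_profile hr₁ hr (fun x hx => ?_) ?_ ?_
  · rw [state_eq hr₁ hr g q b x hx, stateProfile, profile]; ring
  · simp only [profile, adjointConst]; ring
  · simp only [adjointInv]; field_simp; ring

theorem isRobinSol_adjointProfile {r₁ r₂ α : ℝ} (hr₁ : 0 < r₁) (hr : r₁ < r₂) (hα : 0 < α)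
    (g q b z : ℝ) : IsRobinSol r₁ r₂ α (fun x => stateR r₁ r₂ α g q b x - z) 0 0
      (fun x => adjointProfile r₁ r₂ (1 / α) g q b z ‖x‖) := by
  have hr₂ : r₂ ≠ 0 := by linarith
  refine isRobinSol_profile hr₁ hr (fun x hx => ?_) ?_ ?_
  · rw [stateR_eq hr₁ hr hα g q b x hx, stateProfile, profile]; ring
  · simp only [profile, adjointConst]; field_simp; ring
  · simp only [adjointInv]; field_simp; ring

theorem isUniqueSol_adjoint {r₁ r₂ : ℝ} (hr₁ : 0 < r₁) (hr : r₁ < r₂) (g q b z : ℝ) :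
    IsUniqueSol r₁ r₂ (IsDirichletSol r₁ r₂ (fun x => state r₁ r₂ g q b x - z) 0 0)
      (adjoint r₁ r₂ g q b z) :=
  (Classical.epsilon_spec (p := IsDirichletSol r₁ r₂ (fun x => state r₁ r₂ g q b x - z) 0 0)
    ⟨_, isDirichletSol_adjointProfile hr₁ hr g q b z⟩).isUniqueSol hr₁ hr

theorem isUniqueSol_adjointR {r₁ r₂ α : ℝ} (hr₁ : 0 < r₁) (hr : r₁ < r₂) (hα : 0 < α)
    (g q b z : ℝ) :
    IsUniqueSol r₁ r₂ (IsRobinSol r₁ r₂ α (fun x => stateR r₁ r₂ α g q b x - z) 0 0)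
      (adjointR r₁ r₂ α g q b z) :=
  (Classical.epsilon_spec (p := IsRobinSol r₁ r₂ α (fun x => stateR r₁ r₂ α g q b x - z) 0 0)
    ⟨_, isRobinSol_adjointProfile hr₁ hr hα g q b z⟩).isUniqueSol hr₁ hr hα

theorem adjoint_eq {r₁ r₂ : ℝ} (hr₁ : 0 < r₁) (hr : r₁ < r₂) (g q b z : ℝ) :
    ∀ x ∈ shell r₁ r₂, adjoint r₁ r₂ g q b z x = adjointProfile r₁ r₂ 0 g q b z ‖x‖ :=
  fun _ hx => ((isUniqueSol_adjoint hr₁ hr g q b z).2 _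
    (isDirichletSol_adjointProfile hr₁ hr g q b z) (shell_subset_closedShell _ _ hx)).symm

theorem adjointR_eq {r₁ r₂ α : ℝ} (hr₁ : 0 < r₁) (hr : r₁ < r₂) (hα : 0 < α) (g q b z : ℝ) :
    ∀ x ∈ shell r₁ r₂,
      adjointR r₁ r₂ α g q b z x = adjointProfile r₁ r₂ (1 / α) g q b z ‖x‖ :=
  fun _ hx => ((isUniqueSol_adjointR hr₁ hr hα g q b z).2 _
    (isRobinSol_adjointProfile hr₁ hr hα g q b z) (shell_subset_closedShell _ _ hx)).symm

/-! ### Integrals over the shell and the spheres -/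

theorem measurableSet_shell (r₁ r₂ : ℝ) : MeasurableSet (shell r₁ r₂) :=
  (isOpen_shell r₁ r₂).measurableSet

theorem volume_real_unit_ball : (volume : Measure E3).real (Metric.ball 0 1) = 4 * π / 3 := by
  rw [measureReal_def, EuclideanSpace.volume_ball_fin_three]
  rw [ENNReal.toReal_mul, ENNReal.toReal_pow]
  simp
  rw [ENNReal.toReal_ofReal (by positivity)]
  ring

theorem integral_shell_radial {r₁ r₂ : ℝ} (hr₁ : 0 < r₁) (hr : r₁ < r₂) (f : ℝ → ℝ) :
    ∫ x in shell r₁ r₂, f ‖x‖ = 4 * π * ∫ r in r₁..r₂, r ^ 2 * f r := by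
  have h1 : ∫ x in shell r₁ r₂, f ‖x‖ = ∫ x : E3, (Ioo r₁ r₂).indicator f ‖x‖ := by
    rw [← integral_indicator (measurableSet_shell r₁ r₂)]
    rfl
  have h2 : ∫ y in Ioi (0 : ℝ), y ^ 2 • (Ioo r₁ r₂).indicator f y =
      ∫ r in r₁..r₂, r ^ 2 * f r := by
    have : ∀ y : ℝ, y ^ 2 • (Ioo r₁ r₂).indicator f y =
        (Ioo r₁ r₂).indicator (fun r => r ^ 2 * f r) y := fun y => by
      by_cases hy : y ∈ Ioo r₁ r₂ <;> simp [hy]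
    simp_rw [this]
    rw [setIntegral_indicator measurableSet_Ioo, intervalIntegral.integral_of_le hr.le,
      integral_Ioc_eq_integral_Ioo, inter_eq_right.2]
    exact fun y hy => hr₁.trans hy.1
  -- Polar coordinates: the constant appears as dimension times volume of the unit ball, `3 · 4π/3 =
  -- 4π`.
  rw [h1, integral_fun_norm_addHaar]
  simp only [finrank_euclideanSpace, Fintype.card_fin, Nat.add_one_sub_one, nsmul_eq_mul,
    smul_eq_mul, volume_real_unit_ball]
  simp only [smul_eq_mul] at h2
  rw [h2]
  push_cast
  ring

theorem sqNormH_const {r₁ r₂ : ℝ} (hr₁ : 0 < r₁) (hr : r₁ < r₂) (c : ℝ) :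
    sqNormH r₁ r₂ (fun _ => c) = 4 * π / 3 * (r₂ ^ 3 - r₁ ^ 3) * c ^ 2 := by
  rw [sqNormH, integral_shell_radial hr₁ hr (fun _ => c ^ 2)]
  simp
  ring

theorem sqNormSphere_const (r c : ℝ) : sqNormSphere r (fun _ => c) = 4 * π * r ^ 2 * c ^ 2 := by
  have : (volume : Measure E3).toSphere.real univ = 4 * π := by
    rw [measureReal_def, Measure.toSphere_apply_univ, ENNReal.toReal_mul, ← measureReal_def,
      volume_real_unit_ball]
    simp
    ring
  rw [sqNormSphere, integral_const, this, smul_eq_mul]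
  ring

theorem sqNormH_congr {r₁ r₂ : ℝ} {f h : E3 → ℝ} (hf : ∀ x ∈ shell r₁ r₂, f x = h x) :
    sqNormH r₁ r₂ f = sqNormH r₁ r₂ h :=
  setIntegral_congr_fun (measurableSet_shell r₁ r₂) fun x hx => by simp only [hf x hx]

theorem sqNormH_profile {r₁ r₂ : ℝ} (hr₁ : 0 < r₁) (hr : r₁ < r₂) (c₂ c₀ c : ℝ) :
    sqNormH r₁ r₂ (fun x => profile 0 c₂ 0 c₀ c ‖x‖) = 4 * π *
      (c₂ ^ 2 * (r₂ ^ 7 - r₁ ^ 7) / 7 + c₀ ^ 2 * (r₂ ^ 3 - r₁ ^ 3) / 3 + c ^ 2 * (r₂ - r₁)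
        + 2 * c₂ * c₀ * (r₂ ^ 5 - r₁ ^ 5) / 5 + c₂ * c * (r₂ ^ 4 - r₁ ^ 4) / 2
        + c₀ * c * (r₂ ^ 2 - r₁ ^ 2)) := by
  rw [sqNormH, integral_shell_radial hr₁ hr (fun r => profile 0 c₂ 0 c₀ c r ^ 2)]
  congr 1
  set F : ℝ → ℝ := fun r => c₂ ^ 2 * r ^ 7 / 7 + c₀ ^ 2 * r ^ 3 / 3 + c ^ 2 * r
    + 2 * c₂ * c₀ * r ^ 5 / 5 + c₂ * c * r ^ 4 / 2 + c₀ * c * r ^ 2 with hF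
  have hd : ∀ r : ℝ, HasDerivAt F ((c₂ * r ^ 3 + c₀ * r + c) ^ 2) r := fun r => by
    have h := ((((((hasDerivAt_pow 7 r).const_mul (c₂ ^ 2)).div_const 7).add
      (((hasDerivAt_pow 3 r).const_mul (c₀ ^ 2)).div_const 3)).add
      ((hasDerivAt_id r).const_mul (c ^ 2))).add
      (((hasDerivAt_pow 5 r).const_mul (2 * c₂ * c₀)).div_const 5)).add
      (((hasDerivAt_pow 4 r).const_mul (c₂ * c)).div_const 2) |>.add
      ((hasDerivAt_pow 2 r).const_mul (c₀ * c))
    refine HasDerivAt.congr_deriv h ?_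
    norm_num
    ring
  -- The Jacobian `r ^ 2` absorbs the pole: `r` times the profile is a polynomial, so the integrand
  -- is the square of a polynomial.
  have hcongr : ∫ r in r₁..r₂, r ^ 2 * profile 0 c₂ 0 c₀ c r ^ 2 =
      ∫ r in r₁..r₂, (c₂ * r ^ 3 + c₀ * r + c) ^ 2 := by
    refine intervalIntegral.integral_congr fun r hr' => ?_
    rw [uIcc_of_le hr.le] at hr'
    have : r ≠ 0 := (hr₁.trans_le hr'.1).ne'
    simp only [profile]
    field_simp
    ring
  rw [hcongr, intervalIntegral.integral_eq_sub_of_hasDerivAt (fun r _ => hd r)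
    (Continuous.intervalIntegrable (by fun_prop) _ _)]
  simp only [hF]
  ring

/-! ### The tracking cost as a nonnegative quadratic form -/

/-- The constants `Gᵢα` as functions of `s = 1 / (α r₁)`. -/
def coeffsOf (r₁ r₂ s : ℝ) : Coeffs :=
  let ρ := r₂ / r₁
  { G1 := -2 / 945 + 2 / 135 * s - 1 / 27 * s ^ 2
      + ρ ^ 3 * (1 / 45 - 4 / 45 * s + 1 / 9 * s ^ 2)
      - 1 / 15 * ρ ^ 5 * (1 - 2 * s) - 1 / 9 * s ^ 2 * ρ ^ 6 + 1 / 7 * ρ ^ 7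
      - 2 / 15 * ρ ^ 8 * (1 + s) + 1 / 27 * ρ ^ 9 * (1 + 2 * s + s ^ 2)
    G2 := -1 / 3 * (1 - s + s ^ 2) + ρ - ρ ^ 2 * (1 + s) + 1 / 3 * ρ ^ 3 * (1 + 2 * s + s ^ 2)
    G3 := 1 / 3 * (-1 + ρ ^ 3)
    G4 := -7 / 180 + 7 / 45 * s - 2 / 9 * s ^ 2 + 1 / 6 * ρ ^ 2 * (1 - 2 * s)
      + 1 / 9 * ρ ^ 3 * (1 - s + 4 * s ^ 2) - 3 / 4 * ρ ^ 4 + 11 / 15 * ρ ^ 5 * (1 + s)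
      - 2 / 9 * ρ ^ 6 * (1 + 2 * s + s ^ 2)
    G5 := -2 / 45 + 2 / 9 * s + 2 / 9 * ρ ^ 3 * (1 - 2 * s) - 2 / 5 * ρ ^ 5
      + 2 / 9 * ρ ^ 6 * (1 + s)
    G6 := -1 / 3 * (1 - 2 * s) + ρ ^ 2 - 2 / 3 * ρ ^ 3 * (1 + s) }

theorem coeffsR_eq (r₁ r₂ α : ℝ) : coeffsR r₁ r₂ α = coeffsOf r₁ r₂ (1 / (α * r₁)) := rfl

theorem coeffs_eq (r₁ r₂ : ℝ) : coeffs r₁ r₂ = coeffsOf r₁ r₂ 0 := by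
  simp only [coeffs, coeffsOf, Coeffs.mk.injEq]
  refine ⟨?_, ?_, trivial, ?_, ?_, ?_⟩ <;> ring

/-- The quadratic form with coefficients `Gᵢ`. -/
def Coeffs.form (G : Coeffs) (x y d : ℝ) : ℝ :=
  G.G1 * x ^ 2 + G.G2 * y ^ 2 + G.G3 * d ^ 2 + G.G4 * x * y + G.G5 * x * d + G.G6 * y * d

/-- The source of the constants `Gᵢ`. Subtracting `z` is absorbed into the datum `b`, after which
the profile is linear in `(g, q, b - z)`. With the scalings `g r₁²` and `q r₂² / r₁` the
coefficients depend only on `r₂ / r₁` and `k / r₁`. -/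
theorem sqNormH_stateProfile_sub {r₁ r₂ : ℝ} (hr₁ : 0 < r₁) (hr : r₁ < r₂) (k g q b z : ℝ) :
    sqNormH r₁ r₂ (fun x => stateProfile r₁ r₂ k g q b ‖x‖ - z) =
      4 * π * r₁ ^ 3 * (coeffsOf r₁ r₂ (k / r₁)).form (g * r₁ ^ 2) (q * (r₂ ^ 2 / r₁)) (b - z) := by
  have h : ∀ x ∈ shell r₁ r₂, stateProfile r₁ r₂ k g q b ‖x‖ - z =
      profile 0 (-g / 6) 0 (stateConst r₁ r₂ k g q (b - z)) (stateInv r₂ g q) ‖x‖ := fun x _ => by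
    simp only [stateProfile, profile, stateConst]; ring
  rw [sqNormH_congr h, sqNormH_profile hr₁ hr, mul_assoc (4 * π)]
  congr 1
  simp only [stateConst, stateInv, Coeffs.form, coeffsOf]
  field_simp
  ring

/-- `S` is a solution operator whose tracking cost is the quadratic form of `G`. -/
structure HasCostForm (r₁ r₂ : ℝ) (S : ℝ → ℝ → ℝ → E3 → ℝ) (G : Coeffs) : Prop where
  cost : ∀ g q b z : ℝ, sqNormH r₁ r₂ (fun x => S g q b x - z) =
    4 * π * r₁ ^ 3 * G.form (g * r₁ ^ 2) (q * (r₂ ^ 2 / r₁)) (b - z)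
  G3_eq : G.G3 = 1 / 3 * (-1 + (r₂ / r₁) ^ 3)

theorem hasCostForm_state {r₁ r₂ : ℝ} (hr₁ : 0 < r₁) (hr : r₁ < r₂) :
    HasCostForm r₁ r₂ (state r₁ r₂) (coeffs r₁ r₂) where
  cost g q b z := by
    rw [coeffs_eq, sqNormH_congr (h := fun x => stateProfile r₁ r₂ 0 g q b ‖x‖ - z)
      (fun x hx => by rw [state_eq hr₁ hr g q b x hx]), sqNormH_stateProfile_sub hr₁ hr, zero_div]
  G3_eq := rfl

theorem hasCostForm_stateR {r₁ r₂ α : ℝ} (hr₁ : 0 < r₁) (hr : r₁ < r₂) (hα : 0 < α) :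
    HasCostForm r₁ r₂ (stateR r₁ r₂ α) (coeffsR r₁ r₂ α) where
  cost g q b z := by
    rw [coeffsR_eq, sqNormH_congr (h := fun x => stateProfile r₁ r₂ (1 / α) g q b ‖x‖ - z)
      (fun x hx => by rw [stateR_eq hr₁ hr hα g q b x hx]), sqNormH_stateProfile_sub hr₁ hr,
      div_div]
  G3_eq := rfl

namespace HasCostForm

variable {r₁ r₂ : ℝ} {S : ℝ → ℝ → ℝ → E3 → ℝ} {G : Coeffs}

theorem G3_pos (hr₁ : 0 < r₁) (hr : r₁ < r₂) (h : HasCostForm r₁ r₂ S G) : 0 < G.G3 := by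
  have h1 : 1 < r₂ / r₁ := (one_lt_div hr₁).2 hr
  have h2 : 1 < (r₂ / r₁) ^ 3 := one_lt_pow₀ h1 (by norm_num)
  rw [h.G3_eq]
  linarith

/-- The scalings are invertible, so every triple arises from actual data, and the form is then a
positive multiple of a squared norm. All sign information on `G1`, `G2` and the discriminant is
drawn from this, without inspecting the polynomials. -/
theorem form_nonneg (hr₁ : 0 < r₁) (hr : r₁ < r₂) (h : HasCostForm r₁ r₂ S G) (x y d : ℝ) :
    0 ≤ G.form x y d := by
  have hr₂ : 0 < r₂ := hr₁.trans hr
  have h1 := h.cost (x / r₁ ^ 2) (y * (r₁ / r₂ ^ 2)) d 0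
  have h2 : 0 ≤ sqNormH r₁ r₂
      (fun p => S (x / r₁ ^ 2) (y * (r₁ / r₂ ^ 2)) d p - 0) := integral_nonneg fun _ => sq_nonneg _
  have h3 : x / r₁ ^ 2 * r₁ ^ 2 = x := by field_simp
  have h4 : y * (r₁ / r₂ ^ 2) * (r₂ ^ 2 / r₁) = y := by field_simp
  rw [h3, h4, sub_zero] at h1
  rw [h1] at h2
  exact nonneg_of_mul_nonneg_right h2 (by positivity)

theorem G1_nonneg (hr₁ : 0 < r₁) (hr : r₁ < r₂) (h : HasCostForm r₁ r₂ S G) : 0 ≤ G.G1 := by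
  simpa [Coeffs.form] using h.form_nonneg hr₁ hr 1 0 0

theorem G2_nonneg (hr₁ : 0 < r₁) (hr : r₁ < r₂) (h : HasCostForm r₁ r₂ S G) : 0 ≤ G.G2 := by
  simpa [Coeffs.form] using h.form_nonneg hr₁ hr 0 1 0

theorem sq_G4_le (hr₁ : 0 < r₁) (hr : r₁ < r₂) (h : HasCostForm r₁ r₂ S G) :
    G.G4 ^ 2 ≤ 4 * G.G1 * G.G2 := by
  have := discrim_le_zero (a := G.G1) (b := G.G4) (c := G.G2) fun x : ℝ => by
    have := h.form_nonneg hr₁ hr x 1 0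
    simp only [Coeffs.form] at this
    linarith
  rw [discrim] at this
  linarith

theorem coeff_g_pos (hr₁ : 0 < r₁) (hr : r₁ < r₂) (h : HasCostForm r₁ r₂ S G) {M : ℝ}
    (hM : 0 < M) : 0 < G.G1 + G.G3 * (M / r₁ ^ 4) := by
  have := h.G1_nonneg hr₁ hr
  have := h.G3_pos hr₁ hr
  positivity

theorem coeff_q_pos (hr₁ : 0 < r₁) (hr : r₁ < r₂) (h : HasCostForm r₁ r₂ S G) {M : ℝ}
    (hM : 0 < M) : 0 < G.G2 + M / (r₁ * r₂ ^ 2) := by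
  have := h.G2_nonneg hr₁ hr
  have : 0 < r₂ := hr₁.trans hr
  positivity

theorem coeff_b_pos (hr₁ : 0 < r₁) (hr : r₁ < r₂) (h : HasCostForm r₁ r₂ S G) {M : ℝ}
    (hM : 0 < M) : 0 < G.G3 + M / r₁ := by
  have := h.G3_pos hr₁ hr
  positivity

theorem den₄_pos (hr₁ : 0 < r₁) (hr : r₁ < r₂) (h : HasCostForm r₁ r₂ S G) {M N : ℝ}
    (hM : 0 < M) (hN : 0 < N) : 0 < den₄ r₁ r₂ G M N := by
  have h1 := h.G1_nonneg hr₁ hr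
  have h2 := h.G2_nonneg hr₁ hr
  have h3 := h.G3_pos hr₁ hr
  have h4 := h.sq_G4_le hr₁ hr
  have hr₂ : 0 < r₂ := hr₁.trans hr
  have hm : 0 < G.G3 * (M / r₁ ^ 4) := by positivity
  have hn : 0 < N / (r₁ * r₂ ^ 2) := by positivity
  rw [den₄]
  -- With `m`, `n` the two penalty terms, the quantity is `(4 G1 G2 - G4²) + 4 G1 n + 4 G2 m + 4 m
  -- n`, where only the last summand is needed to be strictly positive.
  nlinarith [mul_pos hm hn, mul_nonneg h1 hn.le, mul_nonneg h2 hm.le]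

end HasCostForm

/-! ### Minimization of quadratic polynomials -/

theorem isUniqueMin_of_lt {X : Type} {J : X → ℝ} {x₀ : X} (h : ∀ x, x ≠ x₀ → J x₀ < J x) :
    IsUniqueMin J x₀ := by
  intro y
  constructor
  · intro hy
    by_contra hne
    have h1 := h y hne
    have h2 : J y ≤ J x₀ := hy (mem_univ x₀)
    linarith
  · rintro rfl x -
    rcases eq_or_ne x y with rfl | hx
    · exact le_refl (J x)
    · exact (h x hx).le

theorem isUniqueMin_quadratic {J : ℝ → ℝ} {a v x₀ : ℝ} (ha : 0 < a)
    (h : ∀ x, J x = a * (x - x₀) ^ 2 + v) : IsUniqueMin J x₀ ∧ J x₀ = v := by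
  have h0 : J x₀ = v := by rw [h]; ring
  refine ⟨isUniqueMin_of_lt fun x hx => ?_, h0⟩
  have : 0 < (x - x₀) ^ 2 := by have := sub_ne_zero.2 hx; positivity
  rw [h0, h x]
  have := mul_pos ha this
  linarith

theorem isUniqueMin_quadratic₂ {J : ℝ × ℝ → ℝ} {a e c v : ℝ} {p₀ : ℝ × ℝ} (ha : 0 < a)
    (hd : 0 < 4 * a * c - e ^ 2)
    (h : ∀ p, J p = a * (p.1 - p₀.1) ^ 2 + e * (p.1 - p₀.1) * (p.2 - p₀.2)
      + c * (p.2 - p₀.2) ^ 2 + v) : IsUniqueMin J p₀ ∧ J p₀ = v := by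
  have h0 : J p₀ = v := by rw [h]; ring
  refine ⟨isUniqueMin_of_lt fun p hp => ?_, h0⟩
  rw [h0, h p]
  set x := p.1 - p₀.1 with hx
  set y := p.2 - p₀.2 with hy
  have hxy : x ≠ 0 ∨ y ≠ 0 := by
    by_contra! hc
    exact hp (Prod.ext (by linarith [hc.1]) (by linarith [hc.2]))
  -- Multiplying by `4 a > 0` completes the square without division; positivity of the discriminant
  -- term then handles `y ≠ 0`, and `a` handles `y = 0`.
  have key : 4 * a * (a * x ^ 2 + e * x * y + c * y ^ 2) =
      (2 * a * x + e * y) ^ 2 + (4 * a * c - e ^ 2) * y ^ 2 := by ring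
  have hpos : 0 < (2 * a * x + e * y) ^ 2 + (4 * a * c - e ^ 2) * y ^ 2 := by
    rcases eq_or_ne y 0 with h1 | h1
    · have h2 : x ≠ 0 := hxy.resolve_right (by simp [h1])
      rw [h1]
      simp only [mul_zero, add_zero]
      positivity
    · have : 0 < (4 * a * c - e ^ 2) * y ^ 2 := by positivity
      positivity
  rw [← key] at hpos
  have := pos_of_mul_pos_right hpos (by positivity)
  linarith

/-! ### The four optimization problems -/

namespace HasCostForm

variable {r₁ r₂ : ℝ} {S : ℝ → ℝ → ℝ → E3 → ℝ} {G : Coeffs}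

theorem min_J₁ (hr₁ : 0 < r₁) (hr : r₁ < r₂) (h : HasCostForm r₁ r₂ S G) {M : ℝ} (hM : 0 < M)
    (q b z : ℝ) : IsUniqueMin (J₁ r₁ r₂ S M q b z) (gOpt r₁ r₂ G M q b z) ∧
      J₁ r₁ r₂ S M q b z (gOpt r₁ r₂ G M q b z) = J₁Opt r₁ r₂ G M q b z := by
  have hA := h.coeff_g_pos hr₁ hr hM
  refine isUniqueMin_quadratic (a := 2 * π * r₁ ^ 7 * (G.G1 + G.G3 * (M / r₁ ^ 4)))
    (by positivity) fun g => ?_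
  -- The volume of the shell is `4π r₁³ G3`, which is why `G3` multiplies the penalty in the
  -- formulas for a distributed control.
  have e : M / 2 * (4 * π / 3 * (r₂ ^ 3 - r₁ ^ 3) * g ^ 2) =
      2 * π * r₁ ^ 3 * (G.G3 * (M / r₁ ^ 4)) * (g * r₁ ^ 2) ^ 2 := by
    rw [h.G3_eq]; field_simp; ring
  rw [J₁, h.cost, sqNormH_const hr₁ hr, e, gOpt, J₁Opt, Coeffs.form]
  have e2 : G.G2 * q ^ 2 * (r₂ ^ 4 / r₁ ^ 2) = G.G2 * (q * (r₂ ^ 2 / r₁)) ^ 2 := by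
    field_simp
  simp only [e2, mul_assoc _ q (r₂ ^ 2 / r₁)]
  generalize q * (r₂ ^ 2 / r₁) = y at *
  -- `G1` is eliminated in favour of the leading coefficient `A`, so that the denominator is a
  -- single positive atom for `field_simp`.
  have e3 : G.G1 = (G.G1 + G.G3 * (M / r₁ ^ 4)) - G.G3 * (M / r₁ ^ 4) := by ring
  generalize G.G1 + G.G3 * (M / r₁ ^ 4) = A at *
  rw [e3]
  field_simp
  ring

theorem min_J₂ (hr₁ : 0 < r₁) (hr : r₁ < r₂) (h : HasCostForm r₁ r₂ S G) {M : ℝ} (hM : 0 < M)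
    (g b z : ℝ) : IsUniqueMin (J₂ r₁ r₂ S M g b z) (qOpt r₁ r₂ G M g b z) ∧
      J₂ r₁ r₂ S M g b z (qOpt r₁ r₂ G M g b z) = J₂Opt r₁ r₂ G M g b z := by
  have hC := h.coeff_q_pos hr₁ hr hM
  have hr₂ : 0 < r₂ := hr₁.trans hr
  refine isUniqueMin_quadratic (a := 2 * π * r₁ * r₂ ^ 4 * (G.G2 + M / (r₁ * r₂ ^ 2)))
    (by positivity) fun q => ?_
  have e : M / 2 * (4 * π * r₂ ^ 2 * q ^ 2) =
      2 * π * r₁ ^ 3 * (M / (r₁ * r₂ ^ 2)) * (q * (r₂ ^ 2 / r₁)) ^ 2 := by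
    field_simp; ring
  rw [J₂, h.cost, sqNormSphere_const, e, qOpt, J₂Opt, Coeffs.form]
  have e3 : G.G2 = (G.G2 + M / (r₁ * r₂ ^ 2)) - M / (r₁ * r₂ ^ 2) := by ring
  generalize G.G2 + M / (r₁ * r₂ ^ 2) = C at *
  rw [e3]
  field_simp
  ring

theorem min_J₃ (hr₁ : 0 < r₁) (hr : r₁ < r₂) (h : HasCostForm r₁ r₂ S G) {M : ℝ} (hM : 0 < M)
    (g q z : ℝ) : IsUniqueMin (J₃ r₁ r₂ S M g q z) (bOpt r₁ r₂ G M g q z) ∧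
      J₃ r₁ r₂ S M g q z (bOpt r₁ r₂ G M g q z) = J₃Opt r₁ r₂ G M g q z := by
  have hC := h.coeff_b_pos hr₁ hr hM
  have hr₂ : 0 < r₂ := hr₁.trans hr
  refine isUniqueMin_quadratic (a := 2 * π * r₁ ^ 3 * (G.G3 + M / r₁))
    (by positivity) fun b => ?_
  have e : M / 2 * (4 * π * r₁ ^ 2 * b ^ 2) = 2 * π * r₁ ^ 3 * (M / r₁) * b ^ 2 := by
    field_simp; ring
  rw [J₃, h.cost, sqNormSphere_const, e, bOpt, J₃Opt, Coeffs.form]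
  have e3 : M / r₁ = (G.G3 + M / r₁) - G.G3 := by ring
  generalize G.G3 + M / r₁ = C at *
  rw [e3]
  field_simp
  ring

theorem min_J₄ (hr₁ : 0 < r₁) (hr : r₁ < r₂) (h : HasCostForm r₁ r₂ S G) {M N : ℝ} (hM : 0 < M)
    (hN : 0 < N) (b z : ℝ) : IsUniqueMin (J₄ r₁ r₂ S M N b z) (gqOpt r₁ r₂ G M N b z) ∧
      J₄ r₁ r₂ S M N b z (gqOpt r₁ r₂ G M N b z) = J₄Opt r₁ r₂ G M N b z := by
  have hA := h.coeff_g_pos hr₁ hr hM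
  have hC := h.coeff_q_pos hr₁ hr hN
  have hD := h.den₄_pos hr₁ hr hM hN
  have hr₂ : 0 < r₂ := hr₁.trans hr
  have hdef : den₄ r₁ r₂ G M N =
    4 * (G.G1 + G.G3 * (M / r₁ ^ 4)) * (G.G2 + N / (r₁ * r₂ ^ 2)) - G.G4 ^ 2 := rfl
  refine isUniqueMin_quadratic₂ (a := 2 * π * r₁ ^ 7 * (G.G1 + G.G3 * (M / r₁ ^ 4)))
    (e := 2 * π * r₁ ^ 4 * r₂ ^ 2 * G.G4)
    (c := 2 * π * r₁ * r₂ ^ 4 * (G.G2 + N / (r₁ * r₂ ^ 2))) (by positivity) ?_ fun p => ?_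
  · have : 0 < (2 * π * r₁ ^ 4 * r₂ ^ 2) ^ 2 * den₄ r₁ r₂ G M N := by positivity
    rw [hdef] at this
    linarith
  have e1 : M / 2 * (4 * π / 3 * (r₂ ^ 3 - r₁ ^ 3) * p.1 ^ 2) =
      2 * π * r₁ ^ 3 * (G.G3 * (M / r₁ ^ 4)) * (p.1 * r₁ ^ 2) ^ 2 := by
    rw [h.G3_eq]; field_simp; ring
  have e2 : N / 2 * (4 * π * r₂ ^ 2 * p.2 ^ 2) =
      2 * π * r₁ ^ 3 * (N / (r₁ * r₂ ^ 2)) * (p.2 * (r₂ ^ 2 / r₁)) ^ 2 := by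
    field_simp; ring
  rw [J₄, h.cost, sqNormH_const hr₁ hr, sqNormSphere_const, e1, e2, gqOpt, J₄Opt, Coeffs.form,
    Delta, Pi₃]
  have e3 : G.G1 = (G.G1 + G.G3 * (M / r₁ ^ 4)) - G.G3 * (M / r₁ ^ 4) := by ring
  have e4 : G.G2 = (G.G2 + N / (r₁ * r₂ ^ 2)) - N / (r₁ * r₂ ^ 2) := by ring
  generalize G.G1 + G.G3 * (M / r₁ ^ 4) = A at *
  generalize G.G2 + N / (r₁ * r₂ ^ 2) = C at *
  rw [e3, e4]
  set D := den₄ r₁ r₂ G M N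
  set δ := (G.G4 * G.G6 - 2 * G.G5 * C) / D with hδ
  set ϖ := (G.G4 * G.G5 - 2 * G.G6 * A) / D with hϖ
  have hD0 : D ≠ 0 := hD.ne'
  -- `h1` and `h2` are the stationarity equations of the form in its first two variables, per unit
  -- of `b - z`; `δ` and `ϖ` are their solution by Cramer's rule.
  have h1 : 2 * A * δ + G.G4 * ϖ = -G.G5 := by
    rw [hδ, hϖ]; field_simp; rw [hdef]; ring
  have h2 : 2 * C * ϖ + G.G4 * δ = -G.G6 := by
    rw [hδ, hϖ]; field_simp; rw [hdef]; ring
  -- At a stationary point the quadratic part is minus half the linear part, so the minimum per unit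
  -- of `(b - z)²` is `G3 + (G5 δ + G6 ϖ) / 2`.
  have h3 : (G.G4 * G.G5 * G.G6 + 4 * A * C * G.G3 - A * G.G6 ^ 2 - C * G.G5 ^ 2
      - G.G3 * G.G4 ^ 2) * (2 * π * (b - z) ^ 2 * r₁ ^ 3 / D) =
      2 * π * r₁ ^ 3 * ((b - z) ^ 2 * (G.G3 + (G.G5 * δ + G.G6 * ϖ) / 2)) := by
    rw [hδ, hϖ]; field_simp; rw [hdef]; ring
  rw [h3]
  obtain ⟨g, q⟩ := p
  have hg : g - (b - z) / r₁ ^ 2 * δ = (g * r₁ ^ 2 - (b - z) * δ) / r₁ ^ 2 := by field_simp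
  have hq : q - (b - z) * r₁ / r₂ ^ 2 * ϖ =
      (q * (r₂ ^ 2 / r₁) - (b - z) * ϖ) * (r₁ / r₂ ^ 2) := by field_simp
  simp only [hg, hq]
  generalize g * r₁ ^ 2 = x
  generalize q * (r₂ ^ 2 / r₁) = y
  -- Expansion about the stationary point: the linear terms cancel exactly by `h1` and `h2`.
  have key : A * x ^ 2 + C * y ^ 2 + G.G4 * x * y + G.G5 * x * (b - z) + G.G6 * y * (b - z)
      + G.G3 * (b - z) ^ 2 = A * (x - (b - z) * δ) ^ 2
      + G.G4 * (x - (b - z) * δ) * (y - (b - z) * ϖ) + C * (y - (b - z) * ϖ) ^ 2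
      + (b - z) ^ 2 * (G.G3 + (G.G5 * δ + G.G6 * ϖ) / 2) := by
    linear_combination (x * (b - z) - (b - z) ^ 2 * δ / 2) * h1
      + (y * (b - z) - (b - z) ^ 2 * ϖ / 2) * h2
  have e5 : 2 * π * r₁ ^ 7 * A * ((x - (b - z) * δ) / r₁ ^ 2) ^ 2 =
      2 * π * r₁ ^ 3 * (A * (x - (b - z) * δ) ^ 2) := by field_simp
  have e6 : 2 * π * r₁ ^ 4 * r₂ ^ 2 * G.G4 * ((x - (b - z) * δ) / r₁ ^ 2) *
      ((y - (b - z) * ϖ) * (r₁ / r₂ ^ 2)) =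
      2 * π * r₁ ^ 3 * (G.G4 * (x - (b - z) * δ) * (y - (b - z) * ϖ)) := by field_simp
  have e7 : 2 * π * r₁ * r₂ ^ 4 * C * ((y - (b - z) * ϖ) * (r₁ / r₂ ^ 2)) ^ 2 =
      2 * π * r₁ ^ 3 * (C * (y - (b - z) * ϖ) ^ 2) := by field_simp
  rw [e5, e6, e7]
  linear_combination 2 * π * r₁ ^ 3 * key

end HasCostForm

/-! ### Rates of convergence -/

theorem tendsto_one_div_mul_atTop {r : ℝ} (hr : 0 < r) :
    Tendsto (fun α : ℝ => 1 / (α * r)) atTop (𝓝 0) := by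
  simp only [one_div]
  exact (tendsto_id.atTop_mul_const hr).inv_tendsto_atTop

/-- A function with derivative `D` at `0`, evaluated at `1 / (α r)`, converges to its value at `0`
of order `1 / α`, with limit constant `|D| / r`. -/
theorem rate_of_hasDerivAt {F v : ℝ → ℝ} {D r R : ℝ} (hr : 0 < r) (hF : HasDerivAt F D 0)
    (hv : ∀ α : ℝ, 0 < α → v α = F (1 / (α * r))) (hR : |D| / r = R) :
    Tendsto v atTop (𝓝 (F 0)) ∧
      (fun α => |v α - F 0|) =O[atTop] (fun α : ℝ => 1 / α) ∧
      Tendsto (fun α => α * |v α - F 0|) atTop (𝓝 R) := by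
  have hev : (fun α : ℝ => F (1 / (α * r))) =ᶠ[atTop] v := by
    filter_upwards [eventually_gt_atTop 0] with α hα using (hv α hα).symm
  have hs := tendsto_one_div_mul_atTop hr
  have hs' : Tendsto (fun α : ℝ => 1 / (α * r)) atTop (𝓝[≠] 0) := by
    refine tendsto_nhdsWithin_iff.2 ⟨hs, ?_⟩
    filter_upwards [eventually_gt_atTop 0] with α hα
    have : 1 / (α * r) ≠ 0 := by positivity
    exact this
  have h3 : Tendsto (fun α => α * |v α - F 0|) atTop (𝓝 R) := by
    -- The slope of `F` between `0` and `1 / (α r)` is `α r (v α - F 0)`; dividing by `r` leaves the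
    -- wanted expression.
    have h := ((hasDerivAt_iff_tendsto_slope.1 hF).comp hs').abs.div_const r
    rw [hR] at h
    refine h.congr' ?_
    filter_upwards [eventually_gt_atTop 0] with α hα
    rw [Function.comp_apply, slope_def_field, abs_div, hv α hα, sub_zero,
      abs_of_pos (show 0 < 1 / (α * r) by positivity)]
    field_simp
  refine ⟨(hF.continuousAt.tendsto.comp hs).congr' hev, ?_, h3⟩
  have h4 : (fun α => 1 / α * (α * |v α - F 0|)) =O[atTop] (fun α : ℝ => 1 / α * 1) :=
    (isBigO_refl _ _).mul (h3.isBigO_one ℝ)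
  simp only [mul_one] at h4
  refine h4.congr' ?_ EventuallyEq.rfl
  filter_upwards [eventually_gt_atTop 0] with α hα
  field_simp

/-! ### The constants `Gᵢα` near `s = 0` -/

theorem hasDerivAt_quadratic_zero (c₀ c₁ c₂ : ℝ) :
    HasDerivAt (fun s : ℝ => c₀ + c₁ * s + c₂ * s ^ 2) c₁ 0 := by
  have h := (((hasDerivAt_id (0 : ℝ)).const_mul c₁).const_add c₀).add
    ((hasDerivAt_pow 2 (0 : ℝ)).const_mul c₂)
  refine HasDerivAt.congr_deriv h ?_
  simp

/-- The factored forms expose the powers of `r₂ - r₁` that must cancel against the denominators in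
the limit constants. -/
theorem coeffsOf_zero_G1 {r₁ r₂ : ℝ} (hr₁ : 0 < r₁) :
    (coeffsOf r₁ r₂ 0).G1 = (r₂ - r₁) ^ 5 *
    (2 * r₁ ^ 4 + 10 * r₁ ^ 3 * r₂ + 30 * r₁ ^ 2 * r₂ ^ 2 + 49 * r₁ * r₂ ^ 3 + 35 * r₂ ^ 4)
      / (945 * r₁ ^ 9) := by
  simp only [coeffsOf]; field_simp; ring

theorem coeffsOf_zero_G2 {r₁ r₂ : ℝ} (hr₁ : 0 < r₁) :
    (coeffsOf r₁ r₂ 0).G2 = (r₂ - r₁) ^ 3 / (3 * r₁ ^ 3) := by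
  simp only [coeffsOf]; field_simp; ring

theorem coeffsOf_G3 {r₁ r₂ : ℝ} (hr₁ : 0 < r₁) (s : ℝ) :
    (coeffsOf r₁ r₂ s).G3 =
    (r₂ - r₁) * (r₁ ^ 2 + r₁ * r₂ + r₂ ^ 2) / (3 * r₁ ^ 3) := by
  simp only [coeffsOf]; field_simp; ring

theorem coeffsOf_zero_G4 {r₁ r₂ : ℝ} (hr₁ : 0 < r₁) :
    (coeffsOf r₁ r₂ 0).G4 =
    -((r₂ - r₁) ^ 4 * (7 * r₁ ^ 2 + 28 * r₁ * r₂ + 40 * r₂ ^ 2)) / (180 * r₁ ^ 6) := by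
  simp only [coeffsOf]; field_simp; ring

theorem coeffsOf_zero_G5 {r₁ r₂ : ℝ} (hr₁ : 0 < r₁) :
    (coeffsOf r₁ r₂ 0).G5 = 2 * (r₂ - r₁) ^ 3 *
    (r₁ ^ 3 + 3 * r₁ ^ 2 * r₂ + 6 * r₁ * r₂ ^ 2 + 5 * r₂ ^ 3) / (45 * r₁ ^ 6) := by
  simp only [coeffsOf]; field_simp; ring

theorem coeffsOf_zero_G6 {r₁ r₂ : ℝ} (hr₁ : 0 < r₁) :
    (coeffsOf r₁ r₂ 0).G6 =
    -((r₂ - r₁) ^ 2 * (r₁ + 2 * r₂)) / (3 * r₁ ^ 3) := by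
  simp only [coeffsOf]; field_simp; ring

/-- Each `Gᵢα` has degree at most two in `s`, so its derivative at `0` is the linear coefficient,
given here in factored form. -/
theorem hasDerivAt_coeffsOf_G1 {r₁ r₂ : ℝ} (hr₁ : 0 < r₁) :
    HasDerivAt (fun s => (coeffsOf r₁ r₂ s).G1)
      (2 * (r₂ - r₁) ^ 4 * (r₁ ^ 5 + 4 * r₁ ^ 4 * r₂ + 10 * r₁ ^ 3 * r₂ ^ 2
        + 14 * r₁ ^ 2 * r₂ ^ 3 + 11 * r₁ * r₂ ^ 4 + 5 * r₂ ^ 5) / (135 * r₁ ^ 9)) 0 := by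
  have h := hasDerivAt_quadratic_zero
    (-2 / 945 + 1 / 45 * (r₂ / r₁) ^ 3 - 1 / 15 * (r₂ / r₁) ^ 5 + 1 / 7 * (r₂ / r₁) ^ 7
      - 2 / 15 * (r₂ / r₁) ^ 8 + 1 / 27 * (r₂ / r₁) ^ 9)
    (2 / 135 - 4 / 45 * (r₂ / r₁) ^ 3 + 2 / 15 * (r₂ / r₁) ^ 5 - 2 / 15 * (r₂ / r₁) ^ 8
      + 2 / 27 * (r₂ / r₁) ^ 9)
    (-1 / 27 + 1 / 9 * (r₂ / r₁) ^ 3 - 1 / 9 * (r₂ / r₁) ^ 6 + 1 / 27 * (r₂ / r₁) ^ 9)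
  convert h using 1
  · funext s; simp only [coeffsOf]; ring
  · field_simp; ring

theorem hasDerivAt_coeffsOf_G2 {r₁ r₂ : ℝ} (hr₁ : 0 < r₁) :
    HasDerivAt (fun s => (coeffsOf r₁ r₂ s).G2)
      ((r₂ - r₁) ^ 2 * (r₁ + 2 * r₂) / (3 * r₁ ^ 3)) 0 := by
  have h := hasDerivAt_quadratic_zero
    (-1 / 3 + (r₂ / r₁) ^ 1 - (r₂ / r₁) ^ 2 + 1 / 3 * (r₂ / r₁) ^ 3)
    (1 / 3 - (r₂ / r₁) ^ 2 + 2 / 3 * (r₂ / r₁) ^ 3)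
    (-1 / 3 + 1 / 3 * (r₂ / r₁) ^ 3)
  convert h using 1
  · funext s; simp only [coeffsOf]; ring
  · field_simp; ring

theorem hasDerivAt_coeffsOf_G4 {r₁ r₂ : ℝ} (hr₁ : 0 < r₁) :
    HasDerivAt (fun s => (coeffsOf r₁ r₂ s).G4)
      (-((r₂ - r₁) ^ 3 * (7 * r₁ ^ 3 + 21 * r₁ ^ 2 * r₂ + 27 * r₁ * r₂ ^ 2 + 20 * r₂ ^ 3))
        / (45 * r₁ ^ 6)) 0 := by
  have h := hasDerivAt_quadratic_zero
    (-7 / 180 + 1 / 6 * (r₂ / r₁) ^ 2 + 1 / 9 * (r₂ / r₁) ^ 3 - 3 / 4 * (r₂ / r₁) ^ 4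
      + 11 / 15 * (r₂ / r₁) ^ 5 - 2 / 9 * (r₂ / r₁) ^ 6)
    (7 / 45 - 1 / 3 * (r₂ / r₁) ^ 2 - 1 / 9 * (r₂ / r₁) ^ 3 + 11 / 15 * (r₂ / r₁) ^ 5 - 4 / 9 * (r₂ / r₁) ^ 6)
    (-2 / 9 + 4 / 9 * (r₂ / r₁) ^ 3 - 2 / 9 * (r₂ / r₁) ^ 6)
  convert h using 1
  · funext s; simp only [coeffsOf]; ring
  · field_simp; ring

theorem hasDerivAt_coeffsOf_G5 {r₁ r₂ : ℝ} (hr₁ : 0 < r₁) :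
    HasDerivAt (fun s => (coeffsOf r₁ r₂ s).G5)
      (2 * (r₂ ^ 3 - r₁ ^ 3) ^ 2 / (9 * r₁ ^ 6)) 0 := by
  have h := hasDerivAt_quadratic_zero
    (-2 / 45 + 2 / 9 * (r₂ / r₁) ^ 3 - 2 / 5 * (r₂ / r₁) ^ 5 + 2 / 9 * (r₂ / r₁) ^ 6)
    (2 / 9 - 4 / 9 * (r₂ / r₁) ^ 3 + 2 / 9 * (r₂ / r₁) ^ 6)
    (0)
  convert h using 1
  · funext s; simp only [coeffsOf]; ring
  · field_simp; ring

theorem hasDerivAt_coeffsOf_G6 {r₁ r₂ : ℝ} (hr₁ : 0 < r₁) :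
    HasDerivAt (fun s => (coeffsOf r₁ r₂ s).G6)
      (-(2 * (r₂ ^ 3 - r₁ ^ 3)) / (3 * r₁ ^ 3)) 0 := by
  have h := hasDerivAt_quadratic_zero
    (-1 / 3 + (r₂ / r₁) ^ 2 - 2 / 3 * (r₂ / r₁) ^ 3)
    (2 / 3 - 2 / 3 * (r₂ / r₁) ^ 3)
    (0)
  convert h using 1
  · funext s; simp only [coeffsOf]; ring
  · field_simp; ring

/-- The derivatives of the constants `Gᵢα` in `s` at `s = 0`. -/
def coeffsDeriv (r₁ r₂ : ℝ) : Coeffs where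
  G1 := 2 * (r₂ - r₁) ^ 4 * (r₁ ^ 5 + 4 * r₁ ^ 4 * r₂ + 10 * r₁ ^ 3 * r₂ ^ 2
        + 14 * r₁ ^ 2 * r₂ ^ 3 + 11 * r₁ * r₂ ^ 4 + 5 * r₂ ^ 5) / (135 * r₁ ^ 9)
  G2 := (r₂ - r₁) ^ 2 * (r₁ + 2 * r₂) / (3 * r₁ ^ 3)
  G3 := 0
  G4 := -((r₂ - r₁) ^ 3 * (7 * r₁ ^ 3 + 21 * r₁ ^ 2 * r₂ + 27 * r₁ * r₂ ^ 2 + 20 * r₂ ^ 3))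
        / (45 * r₁ ^ 6)
  G5 := 2 * (r₂ ^ 3 - r₁ ^ 3) ^ 2 / (9 * r₁ ^ 6)
  G6 := -(2 * (r₂ ^ 3 - r₁ ^ 3)) / (3 * r₁ ^ 3)

/-- The `Gᵢ` component functions have the derivatives `G'` at `0`. -/
structure HasCoeffsDeriv (G : ℝ → Coeffs) (G' : Coeffs) : Prop where
  G1 : HasDerivAt (fun s => (G s).G1) G'.G1 0
  G2 : HasDerivAt (fun s => (G s).G2) G'.G2 0
  G3 : ∀ s, (G s).G3 = (G 0).G3
  G4 : HasDerivAt (fun s => (G s).G4) G'.G4 0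
  G5 : HasDerivAt (fun s => (G s).G5) G'.G5 0
  G6 : HasDerivAt (fun s => (G s).G6) G'.G6 0

theorem hasCoeffsDeriv_coeffsOf {r₁ r₂ : ℝ} (hr₁ : 0 < r₁) :
    HasCoeffsDeriv (coeffsOf r₁ r₂) (coeffsDeriv r₁ r₂) :=
  ⟨hasDerivAt_coeffsOf_G1 hr₁, hasDerivAt_coeffsOf_G2 hr₁, fun _ => rfl,
    hasDerivAt_coeffsOf_G4 hr₁, hasDerivAt_coeffsOf_G5 hr₁, hasDerivAt_coeffsOf_G6 hr₁⟩

/-! ### Derivatives of the optimal controls and values at `s = 0` -/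

namespace HasCoeffsDeriv

variable {G : ℝ → Coeffs} {G' : Coeffs} {r₁ r₂ : ℝ}

/-- Implicit differentiation of the stationarity equation `2 r₁² A g = -(G4 y + G5 d)`, with `y = q
r₂² / r₁` and `d = b - z`. Keeping the optimal control in the answer, instead of expanding it, keeps
the later algebra manageable. -/
theorem gOpt (h : HasCoeffsDeriv G G') {M : ℝ} (q b z : ℝ) (hr₁ : 0 < r₁)
    (hA : 0 < (G 0).G1 + (G 0).G3 * (M / r₁ ^ 4)) :
    HasDerivAt (fun s => ShellControl.gOpt r₁ r₂ (G s) M q b z)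
      (-(G'.G4 * q * (r₂ ^ 2 / r₁) + G'.G5 * (b - z)
        + 2 * r₁ ^ 2 * G'.G1 * ShellControl.gOpt r₁ r₂ (G 0) M q b z) /
        (2 * r₁ ^ 2 * ((G 0).G1 + (G 0).G3 * (M / r₁ ^ 4)))) 0 := by
  have h1 := (((h.G4.mul_const q).mul_const (r₂ ^ 2 / r₁)).add (h.G5.mul_const (b - z))).div
    ((h.G1.add_const ((G 0).G3 * (M / r₁ ^ 4))).const_mul (2 * r₁ ^ 2)) (by positivity)
  have e : (fun s => ShellControl.gOpt r₁ r₂ (G s) M q b z) = _ := funext fun s => by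
    rw [ShellControl.gOpt, h.G3 s]
  rw [e]
  refine HasDerivAt.congr_deriv h1.neg ?_
  simp only [Pi.add_apply, ShellControl.gOpt]
  generalize (G 0).G1 + (G 0).G3 * (M / r₁ ^ 4) = A at *
  field_simp
  ring

theorem qOpt (h : HasCoeffsDeriv G G') {M : ℝ} (g b z : ℝ) (hr₁ : 0 < r₁) (hr₂ : 0 < r₂)
    (hC : 0 < (G 0).G2 + M / (r₁ * r₂ ^ 2)) :
    HasDerivAt (fun s => ShellControl.qOpt r₁ r₂ (G s) M g b z)
      (-(r₁ / (2 * r₂ ^ 2) * (G'.G4 * g * r₁ ^ 2 + G'.G6 * (b - z))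
        + G'.G2 * ShellControl.qOpt r₁ r₂ (G 0) M g b z) / ((G 0).G2 + M / (r₁ * r₂ ^ 2))) 0 := by
  have h1 := (((((h.G4.mul_const g).mul_const (r₁ ^ 2)).add (h.G6.mul_const (b - z))).div
    (h.G2.add_const (M / (r₁ * r₂ ^ 2))) hC.ne')).const_mul (r₁ / (2 * r₂ ^ 2))
  refine HasDerivAt.congr_deriv h1.neg ?_
  simp only [Pi.add_apply, ShellControl.qOpt]
  generalize (G 0).G2 + M / (r₁ * r₂ ^ 2) = A at *
  field_simp
  ring

theorem bOpt (h : HasCoeffsDeriv G G') {M : ℝ} (g q z : ℝ) :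
    HasDerivAt (fun s => ShellControl.bOpt r₁ r₂ (G s) M g q z)
      (-(G'.G5 * g * r₁ ^ 2 + G'.G6 * q * (r₂ ^ 2 / r₁)) / (2 * ((G 0).G3 + M / r₁))) 0 := by
  have h1 := ((((h.G5.mul_const g).mul_const (r₁ ^ 2)).add
    ((h.G6.mul_const q).mul_const (r₂ ^ 2 / r₁))).sub_const (2 * (G 0).G3 * z)).div_const
    (2 * ((G 0).G3 + M / r₁))
  have e : (fun s => ShellControl.bOpt r₁ r₂ (G s) M g q z) = _ := funext fun s => by
    rw [ShellControl.bOpt, h.G3 s]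
  rw [e]
  refine HasDerivAt.congr_deriv h1.neg ?_
  ring

/-- The envelope theorem: since the control is stationary, its own variation does not contribute,
and the derivative is the form with coefficients `G'` at the optimal control. No `G3` term appears
because `G3` and the penalties do not depend on `s`. The same shape recurs for the other three
optimal values. -/
theorem J₁Opt (h : HasCoeffsDeriv G G') {M : ℝ} (q b z : ℝ) (hr₁ : 0 < r₁)
    (hA : 0 < (G 0).G1 + (G 0).G3 * (M / r₁ ^ 4)) :
    HasDerivAt (fun s => ShellControl.J₁Opt r₁ r₂ (G s) M q b z)
      (2 * π * r₁ ^ 3 * (G'.G1 * (r₁ ^ 2 * ShellControl.gOpt r₁ r₂ (G 0) M q b z) ^ 2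
        + G'.G2 * (q * (r₂ ^ 2 / r₁)) ^ 2
        + G'.G4 * (r₁ ^ 2 * ShellControl.gOpt r₁ r₂ (G 0) M q b z) * (q * (r₂ ^ 2 / r₁))
        + G'.G5 * (r₁ ^ 2 * ShellControl.gOpt r₁ r₂ (G 0) M q b z) * (b - z)
        + G'.G6 * (q * (r₂ ^ 2 / r₁)) * (b - z))) 0 := by
  have hx : r₁ ^ 2 * ShellControl.gOpt r₁ r₂ (G 0) M q b z = -((G 0).G4 * q * (r₂ ^ 2 / r₁)
      + (G 0).G5 * (b - z)) / (2 * ((G 0).G1 + (G 0).G3 * (M / r₁ ^ 4))) := by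
    rw [ShellControl.gOpt]
    field_simp
  have hA' := h.G1.add_const ((G 0).G3 * (M / r₁ ^ 4))
  have hn1 := ((h.G4.mul_const q).mul_const (r₂ ^ 2 / r₁)).add (h.G5.mul_const (b - z))
  have hn0 := ((((h.G2.mul_const (q ^ 2)).mul_const (r₂ ^ 4 / r₁ ^ 2)).add_const
    ((G 0).G3 * (b - z) ^ 2)).add (((h.G6.mul_const q).mul_const (r₂ ^ 2 / r₁)).mul_const (b - z)))
  have h1 := (((hA'.const_mul 4).mul hn0).sub (hn1.pow 2)).mul
    ((hasDerivAt_const (0 : ℝ) (π * r₁ ^ 3)).div (hA'.const_mul 2) (by positivity))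
  have e : (fun s => ShellControl.J₁Opt r₁ r₂ (G s) M q b z) = _ := funext fun s => by
    rw [ShellControl.J₁Opt, h.G3 s]
  rw [e]
  refine HasDerivAt.congr_deriv h1 ?_
  rw [hx]
  simp only [Pi.add_apply, Pi.mul_apply, Pi.sub_apply, Nat.cast_ofNat, Nat.reduceSub, pow_one, Pi.pow_apply, Pi.div_apply]
  generalize (G 0).G1 + (G 0).G3 * (M / r₁ ^ 4) = A at *
  field_simp
  ring

theorem J₂Opt (h : HasCoeffsDeriv G G') {M : ℝ} (g b z : ℝ) (hr₁ : 0 < r₁) (hr₂ : 0 < r₂)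
    (hC : 0 < (G 0).G2 + M / (r₁ * r₂ ^ 2)) :
    HasDerivAt (fun s => ShellControl.J₂Opt r₁ r₂ (G s) M g b z)
      (2 * π * r₁ ^ 3 * (G'.G1 * (g * r₁ ^ 2) ^ 2
        + G'.G2 * (r₂ ^ 2 / r₁ * ShellControl.qOpt r₁ r₂ (G 0) M g b z) ^ 2
        + G'.G4 * (g * r₁ ^ 2) * (r₂ ^ 2 / r₁ * ShellControl.qOpt r₁ r₂ (G 0) M g b z)
        + G'.G5 * (g * r₁ ^ 2) * (b - z)
        + G'.G6 * (r₂ ^ 2 / r₁ * ShellControl.qOpt r₁ r₂ (G 0) M g b z) * (b - z))) 0 := by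
  have hx : r₂ ^ 2 / r₁ * ShellControl.qOpt r₁ r₂ (G 0) M g b z = -((G 0).G4 * g * r₁ ^ 2
      + (G 0).G6 * (b - z)) / (2 * ((G 0).G2 + M / (r₁ * r₂ ^ 2))) := by
    rw [ShellControl.qOpt]
    field_simp
  have hA' := h.G2.add_const (M / (r₁ * r₂ ^ 2))
  have hn1 := ((h.G4.mul_const g).mul_const (r₁ ^ 2)).add (h.G6.mul_const (b - z))
  have hn0 := ((((h.G1.mul_const (g ^ 2)).mul_const (r₁ ^ 4)).add_const
    ((G 0).G3 * (b - z) ^ 2)).add (((h.G5.mul_const g).mul_const (r₁ ^ 2)).mul_const (b - z)))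
  have h1 := (((hA'.const_mul 4).mul hn0).sub (hn1.pow 2)).mul
    ((hasDerivAt_const (0 : ℝ) (π * r₁ ^ 3)).div (hA'.const_mul 2) (by positivity))
  have e : (fun s => ShellControl.J₂Opt r₁ r₂ (G s) M g b z) = _ := funext fun s => by
    rw [ShellControl.J₂Opt, h.G3 s]
  rw [e]
  refine HasDerivAt.congr_deriv h1 ?_
  rw [hx]
  simp only [Pi.add_apply, Pi.mul_apply, Pi.sub_apply, Nat.cast_ofNat, Nat.reduceSub, pow_one, Pi.pow_apply, Pi.div_apply]
  generalize (G 0).G2 + M / (r₁ * r₂ ^ 2) = A at *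
  field_simp
  ring

theorem J₃Opt (h : HasCoeffsDeriv G G') {M : ℝ} (g q z : ℝ) (hr₁ : 0 < r₁)
    (hC : 0 < (G 0).G3 + M / r₁) :
    HasDerivAt (fun s => ShellControl.J₃Opt r₁ r₂ (G s) M g q z)
      (2 * π * r₁ ^ 3 * (G'.G1 * (g * r₁ ^ 2) ^ 2 + G'.G2 * (q ^ 2 * (r₂ ^ 4 / r₁ ^ 2))
        + G'.G4 * g * q * r₁ * r₂ ^ 2
        + (G'.G5 * g * r₁ ^ 2 + G'.G6 * q * (r₂ ^ 2 / r₁)) *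
          (ShellControl.bOpt r₁ r₂ (G 0) M g q z - z))) 0 := by
  have hn1 := (((h.G5.mul_const g).mul_const (r₁ ^ 2)).const_add (-2 * (G 0).G3 * z)).add
    ((h.G6.mul_const q).mul_const (r₂ ^ 2 / r₁))
  have hn0 := (((((((h.G1.mul_const (g ^ 2)).mul_const (r₁ ^ 4)).add
    ((h.G2.mul_const (q ^ 2)).mul_const (r₂ ^ 4 / r₁ ^ 2))).add_const ((G 0).G3 * z ^ 2)).add
    ((((h.G4.mul_const g).mul_const q).mul_const r₁).mul_const (r₂ ^ 2))).sub
    (((h.G5.mul_const g).mul_const (r₁ ^ 2)).mul_const z)).sub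
    (((h.G6.mul_const q).mul_const (r₂ ^ 2 / r₁)).mul_const z))
  have h1 := ((hn0.const_mul (4 * ((G 0).G3 + M / r₁))).sub (hn1.pow 2)).mul_const
    (π * r₁ ^ 3 / (2 * ((G 0).G3 + M / r₁)))
  have e : (fun s => ShellControl.J₃Opt r₁ r₂ (G s) M g q z) = _ := funext fun s => by
    rw [ShellControl.J₃Opt, h.G3 s]
  rw [e]
  refine HasDerivAt.congr_deriv h1 ?_
  simp only [Pi.add_apply, Nat.cast_ofNat, Nat.reduceSub, pow_one, ShellControl.bOpt]
  generalize (G 0).G3 + M / r₁ = A at *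
  field_simp
  ring

theorem den₄ (h : HasCoeffsDeriv G G') (M N : ℝ) :
    HasDerivAt (fun s => ShellControl.den₄ r₁ r₂ (G s) M N)
      (4 * (G'.G1 * ((G 0).G2 + N / (r₁ * r₂ ^ 2))
        + ((G 0).G1 + (G 0).G3 * (M / r₁ ^ 4)) * G'.G2) - 2 * (G 0).G4 * G'.G4) 0 := by
  have h1 := (((h.G1.add_const ((G 0).G3 * (M / r₁ ^ 4))).const_mul 4).mul
    (h.G2.add_const (N / (r₁ * r₂ ^ 2)))).sub (h.G4.pow 2)
  have e : (fun s => ShellControl.den₄ r₁ r₂ (G s) M N) = _ := funext fun s => by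
    rw [ShellControl.den₄, h.G3 s]
  rw [e]
  refine HasDerivAt.congr_deriv h1 ?_
  norm_num
  ring

/-- The pair of `Delta` and `Pi₃` solves a symmetric linear system with matrix `((2A, G4), (G4,
2C))` and right-hand side `(-G5, -G6)`. Differentiating it gives a system with the same matrix, and
Cramer's rule yields the stated form here and for `Pi₃`. -/
theorem Delta (h : HasCoeffsDeriv G G') {M N : ℝ} (hD : 0 < ShellControl.den₄ r₁ r₂ (G 0) M N) :
    HasDerivAt (fun s => ShellControl.Delta r₁ r₂ (G s) M N)
      (((G 0).G4 * (G'.G6 + 2 * G'.G2 * Pi₃ r₁ r₂ (G 0) M N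
          + G'.G4 * ShellControl.Delta r₁ r₂ (G 0) M N)
        - 2 * ((G 0).G2 + N / (r₁ * r₂ ^ 2)) * (G'.G5
          + 2 * G'.G1 * ShellControl.Delta r₁ r₂ (G 0) M N + G'.G4 * Pi₃ r₁ r₂ (G 0) M N))
        / ShellControl.den₄ r₁ r₂ (G 0) M N) 0 := by
  have h1 := ((h.G4.mul h.G6).sub ((h.G5.const_mul 2).mul (h.G2.add_const (N / (r₁ * r₂ ^ 2))))).div
    (h.den₄ (r₁ := r₁) (r₂ := r₂) M N) hD.ne'
  refine HasDerivAt.congr_deriv h1 ?_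
  have hdef : ShellControl.den₄ r₁ r₂ (G 0) M N =
    4 * ((G 0).G1 + (G 0).G3 * (M / r₁ ^ 4)) * ((G 0).G2 + N / (r₁ * r₂ ^ 2)) - (G 0).G4 ^ 2 := rfl
  simp only [Pi.mul_apply, Pi.sub_apply, Pi₃, ShellControl.Delta]
  generalize ShellControl.den₄ r₁ r₂ (G 0) M N = D at *
  generalize (G 0).G1 + (G 0).G3 * (M / r₁ ^ 4) = A at *
  generalize (G 0).G2 + N / (r₁ * r₂ ^ 2) = C at *
  have hD0 : D ≠ 0 := hD.ne'
  field_simp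
  rw [hdef]
  ring

theorem Pi₃ (h : HasCoeffsDeriv G G') {M N : ℝ} (hD : 0 < ShellControl.den₄ r₁ r₂ (G 0) M N) :
    HasDerivAt (fun s => ShellControl.Pi₃ r₁ r₂ (G s) M N)
      (((G 0).G4 * (G'.G5 + 2 * G'.G1 * ShellControl.Delta r₁ r₂ (G 0) M N
          + G'.G4 * ShellControl.Pi₃ r₁ r₂ (G 0) M N)
        - 2 * ((G 0).G1 + (G 0).G3 * (M / r₁ ^ 4)) * (G'.G6
          + 2 * G'.G2 * ShellControl.Pi₃ r₁ r₂ (G 0) M N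
          + G'.G4 * ShellControl.Delta r₁ r₂ (G 0) M N))
        / ShellControl.den₄ r₁ r₂ (G 0) M N) 0 := by
  have h1 := ((h.G4.mul h.G5).sub ((h.G6.const_mul 2).mul
    (h.G1.add_const ((G 0).G3 * (M / r₁ ^ 4))))).div (h.den₄ (r₁ := r₁) (r₂ := r₂) M N) hD.ne'
  have e : (fun s => ShellControl.Pi₃ r₁ r₂ (G s) M N) = _ := funext fun s => by
    rw [ShellControl.Pi₃, h.G3 s]
  rw [e]
  refine HasDerivAt.congr_deriv h1 ?_
  have hdef : ShellControl.den₄ r₁ r₂ (G 0) M N =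
    4 * ((G 0).G1 + (G 0).G3 * (M / r₁ ^ 4)) * ((G 0).G2 + N / (r₁ * r₂ ^ 2)) - (G 0).G4 ^ 2 := rfl
  simp only [Pi.mul_apply, Pi.sub_apply, ShellControl.Pi₃, ShellControl.Delta]
  generalize ShellControl.den₄ r₁ r₂ (G 0) M N = D at *
  generalize (G 0).G1 + (G 0).G3 * (M / r₁ ^ 4) = A at *
  generalize (G 0).G2 + N / (r₁ * r₂ ^ 2) = C at *
  have hD0 : D ≠ 0 := hD.ne'
  field_simp
  rw [hdef]
  ring

theorem J₄Opt (h : HasCoeffsDeriv G G') {M N : ℝ} (b z : ℝ)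
    (hD : 0 < ShellControl.den₄ r₁ r₂ (G 0) M N) :
    HasDerivAt (fun s => ShellControl.J₄Opt r₁ r₂ (G s) M N b z)
      (2 * π * (b - z) ^ 2 * r₁ ^ 3 * (G'.G1 * ShellControl.Delta r₁ r₂ (G 0) M N ^ 2
        + G'.G2 * ShellControl.Pi₃ r₁ r₂ (G 0) M N ^ 2
        + G'.G4 * ShellControl.Delta r₁ r₂ (G 0) M N * ShellControl.Pi₃ r₁ r₂ (G 0) M N
        + G'.G5 * ShellControl.Delta r₁ r₂ (G 0) M N
        + G'.G6 * ShellControl.Pi₃ r₁ r₂ (G 0) M N)) 0 := by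
  have hA := h.G1.add_const ((G 0).G3 * (M / r₁ ^ 4))
  have hC := h.G2.add_const (N / (r₁ * r₂ ^ 2))
  have h1 := (((((((h.G4.mul h.G5).mul h.G6).add (((hA.const_mul 4).mul hC).mul_const (G 0).G3)).sub
    (hA.mul (h.G6.pow 2))).sub (hC.mul (h.G5.pow 2))).sub ((h.G4.pow 2).const_mul (G 0).G3))).mul
    ((hasDerivAt_const (0 : ℝ) (2 * π * (b - z) ^ 2 * r₁ ^ 3)).div
      (h.den₄ (r₁ := r₁) (r₂ := r₂) M N) hD.ne')
  have e : (fun s => ShellControl.J₄Opt r₁ r₂ (G s) M N b z) = _ := funext fun s => by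
    rw [ShellControl.J₄Opt, h.G3 s]
  rw [e]
  refine HasDerivAt.congr_deriv h1 ?_
  have hdef : ShellControl.den₄ r₁ r₂ (G 0) M N =
    4 * ((G 0).G1 + (G 0).G3 * (M / r₁ ^ 4)) * ((G 0).G2 + N / (r₁ * r₂ ^ 2)) - (G 0).G4 ^ 2 := rfl
  simp only [Pi.mul_apply, Pi.sub_apply, Pi.add_apply, Nat.cast_ofNat, Nat.reduceSub, pow_one, Pi.pow_apply, Pi.div_apply,
    ShellControl.Pi₃, ShellControl.Delta]
  generalize ShellControl.den₄ r₁ r₂ (G 0) M N = D at *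
  generalize (G 0).G1 + (G 0).G3 * (M / r₁ ^ 4) = A at *
  generalize (G 0).G2 + N / (r₁ * r₂ ^ 2) = C at *
  have hD0 : D ≠ 0 := hD.ne'
  field_simp
  rw [hdef]
  ring

end HasCoeffsDeriv

/-! ### Factored denominators, optimal controls at `s = 0`, and the limit constants -/

theorem abs_div_eq_mul_abs {D r K X : ℝ} (hr : 0 < r) (hK : 0 ≤ K)
    (h : D = r * (K * X) ∨ D = -(r * (K * X))) : |D| / r = K * |X| := by
  have : |D| = |r * (K * X)| := by rcases h with h | h <;> simp [h]
  rw [this, abs_mul, abs_mul, abs_of_pos hr, abs_of_nonneg hK]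
  field_simp

/-- The base of the square `denG`. -/
def baseG (r₁ r₂ M : ℝ) : ℝ :=
  315 * M * r₁ ^ 2 * (r₁ ^ 2 + r₁ * r₂ + r₂ ^ 2)
    + (2 * r₁ ^ 4 + 10 * r₁ ^ 3 * r₂ + 30 * r₁ ^ 2 * r₂ ^ 2 + 49 * r₁ * r₂ ^ 3 + 35 * r₂ ^ 4)
      * (r₁ - r₂) ^ 4

/-- The base of the square `denQ`. -/
def baseQ (r₁ r₂ M : ℝ) : ℝ := r₂ ^ 2 * (r₁ - r₂) ^ 3 - 3 * M * r₁ ^ 2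

/-- The base of the square `denGQ`. -/
def baseGQ (r₁ r₂ M N : ℝ) : ℝ :=
  33600 * M * (r₁ ^ 2 + r₁ * r₂ + r₂ ^ 2) * (3 * N * r₁ ^ 2 - r₂ ^ 2 * (r₁ - r₂) ^ 3)
    + (r₁ - r₂) ^ 4 *
      (320 * N * (2 * r₁ ^ 4 + 10 * r₁ ^ 3 * r₂ + 30 * r₁ ^ 2 * r₂ ^ 2 + 49 * r₁ * r₂ ^ 3
          + 35 * r₂ ^ 4)
        - r₂ ^ 2 * (r₁ - r₂) ^ 3 * (99 * r₁ ^ 2 + 152 * r₁ * r₂ + 64 * r₂ ^ 2))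

theorem coeff_g_eq {r₁ : ℝ} (hr₁ : 0 < r₁) (r₂ M : ℝ) :
    (coeffsOf r₁ r₂ 0).G1 + (coeffsOf r₁ r₂ 0).G3 * (M / r₁ ^ 4) =
      (r₂ - r₁) * baseG r₁ r₂ M / (945 * r₁ ^ 9) := by
  rw [coeffsOf_zero_G1 hr₁, coeffsOf_G3 hr₁, baseG]; field_simp; ring

theorem coeff_q_eq {r₁ r₂ : ℝ} (hr₁ : 0 < r₁) (hr₂ : 0 < r₂) (M : ℝ) :
    (coeffsOf r₁ r₂ 0).G2 + M / (r₁ * r₂ ^ 2) = -baseQ r₁ r₂ M / (3 * r₁ ^ 3 * r₂ ^ 2) := by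
  rw [coeffsOf_zero_G2 hr₁, baseQ]; field_simp; ring

theorem coeff_b_eq {r₁ : ℝ} (hr₁ : 0 < r₁) (r₂ M : ℝ) :
    (coeffsOf r₁ r₂ 0).G3 + M / r₁ =
      -(-3 * M * r₁ ^ 2 + r₁ ^ 3 - r₂ ^ 3) / (3 * r₁ ^ 3) := by
  rw [coeffsOf_G3 hr₁]; field_simp; ring

/-- In `4 A C - G4²` the products of the unpenalized parts and `G4²` combine, so that one factor `r₂
- r₁` splits off and the square of what is left is the denominator `denGQ`. -/
theorem den₄_eq {r₁ r₂ : ℝ} (hr₁ : 0 < r₁) (hr₂ : 0 < r₂) (M N : ℝ) :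
    den₄ r₁ r₂ (coeffsOf r₁ r₂ 0) M N =
      (r₂ - r₁) * baseGQ r₁ r₂ M N / (75600 * r₁ ^ 10 * r₂ ^ 2) := by
  rw [den₄, coeff_g_eq hr₁, coeff_q_eq hr₁ hr₂, coeffsOf_zero_G4 hr₁, baseG, baseQ, baseGQ]
  field_simp
  ring

theorem baseG_pos {r₁ r₂ M : ℝ} (hr₁ : 0 < r₁) (hr : r₁ < r₂) (hM : 0 < M) :
    0 < baseG r₁ r₂ M := by
  have : 0 < r₂ := hr₁.trans hr
  have : (r₁ - r₂) ^ 4 = (r₂ - r₁) ^ 4 := by ring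
  have : 0 < r₂ - r₁ := sub_pos.2 hr
  rw [baseG]
  positivity

theorem baseQ_neg {r₁ r₂ M : ℝ} (hr₁ : 0 < r₁) (hr : r₁ < r₂) (hM : 0 < M) :
    baseQ r₁ r₂ M < 0 := by
  have h2 : 0 < r₂ := hr₁.trans hr
  have h3 : 0 < r₂ - r₁ := sub_pos.2 hr
  have : baseQ r₁ r₂ M = -(r₂ ^ 2 * (r₂ - r₁) ^ 3 + 3 * M * r₁ ^ 2) := by rw [baseQ]; ring
  rw [this, neg_lt_zero]
  positivity

theorem baseGQ_pos {r₁ r₂ M N : ℝ} (hr₁ : 0 < r₁) (hr : r₁ < r₂) (hM : 0 < M) (hN : 0 < N) :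
    0 < baseGQ r₁ r₂ M N := by
  have h2 : 0 < r₂ := hr₁.trans hr
  have h3 : 0 < r₂ - r₁ := sub_pos.2 hr
  have : baseGQ r₁ r₂ M N =
    33600 * M * (r₁ ^ 2 + r₁ * r₂ + r₂ ^ 2) * (3 * N * r₁ ^ 2 + r₂ ^ 2 * (r₂ - r₁) ^ 3)
    + (r₂ - r₁) ^ 4 *
      (320 * N * (2 * r₁ ^ 4 + 10 * r₁ ^ 3 * r₂ + 30 * r₁ ^ 2 * r₂ ^ 2 + 49 * r₁ * r₂ ^ 3
          + 35 * r₂ ^ 4)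
        + r₂ ^ 2 * (r₂ - r₁) ^ 3 * (99 * r₁ ^ 2 + 152 * r₁ * r₂ + 64 * r₂ ^ 2)) := by
    rw [baseGQ]; ring
  rw [this]
  positivity

theorem denG_eq (r₁ r₂ M : ℝ) : denG r₁ r₂ M = baseG r₁ r₂ M ^ 2 := rfl

theorem denQ_eq (r₁ r₂ M : ℝ) : denQ r₁ r₂ M = baseQ r₁ r₂ M ^ 2 := rfl

theorem denGQ_eq (r₁ r₂ M N : ℝ) : denGQ r₁ r₂ M N = baseGQ r₁ r₂ M N ^ 2 := rfl

theorem coeff_g_pos {r₁ r₂ M : ℝ} (hr₁ : 0 < r₁) (hr : r₁ < r₂) (hM : 0 < M) :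
    0 < (coeffsOf r₁ r₂ 0).G1 + (coeffsOf r₁ r₂ 0).G3 * (M / r₁ ^ 4) := by
  have := baseG_pos hr₁ hr hM
  have : 0 < r₂ - r₁ := sub_pos.2 hr
  rw [coeff_g_eq hr₁]
  positivity

theorem coeff_q_pos {r₁ r₂ M : ℝ} (hr₁ : 0 < r₁) (hr : r₁ < r₂) (hM : 0 < M) :
    0 < (coeffsOf r₁ r₂ 0).G2 + M / (r₁ * r₂ ^ 2) := by
  have h := neg_pos.2 (baseQ_neg hr₁ hr hM)
  have h2 : 0 < r₂ := hr₁.trans hr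
  rw [coeff_q_eq hr₁ h2]
  positivity

theorem coeff_b_pos {r₁ r₂ M : ℝ} (hr₁ : 0 < r₁) (hr : r₁ < r₂) (hM : 0 < M) :
    0 < (coeffsOf r₁ r₂ 0).G3 + M / r₁ := by
  have h2 : 0 < r₂ := hr₁.trans hr
  have : 0 < r₂ - r₁ := sub_pos.2 hr
  rw [coeffsOf_G3 hr₁]
  positivity

theorem den₄_pos {r₁ r₂ M N : ℝ} (hr₁ : 0 < r₁) (hr : r₁ < r₂) (hM : 0 < M) (hN : 0 < N) :
    0 < den₄ r₁ r₂ (coeffsOf r₁ r₂ 0) M N := by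
  have h := baseGQ_pos hr₁ hr hM hN
  have h2 : 0 < r₂ := hr₁.trans hr
  have : 0 < r₂ - r₁ := sub_pos.2 hr
  rw [den₄_eq hr₁ h2]
  positivity

/-- The control is taken in the scaled variable in which it enters the quadratic form, ready for
substitution into the envelope and implicit-derivative formulas. -/
theorem gOpt_zero {r₁ r₂ M : ℝ} (hr₁ : 0 < r₁) (hr : r₁ < r₂) (hM : 0 < M) (q b z : ℝ) :
    r₁ ^ 2 * gOpt r₁ r₂ (coeffsOf r₁ r₂ 0) M q b z = 21 * r₁ ^ 2 * (r₂ - r₁) ^ 2 *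
      ((r₂ - r₁) * (7 * r₁ ^ 2 + 28 * r₁ * r₂ + 40 * r₂ ^ 2) * q * r₂ ^ 2
        - 8 * r₁ * (r₁ ^ 3 + 3 * r₁ ^ 2 * r₂ + 6 * r₁ * r₂ ^ 2 + 5 * r₂ ^ 3) * (b - z)) /
      (8 * baseG r₁ r₂ M) := by
  have := baseG_pos hr₁ hr hM
  have : 0 < r₂ - r₁ := sub_pos.2 hr
  rw [gOpt, coeff_g_eq hr₁, coeffsOf_zero_G4 hr₁, coeffsOf_zero_G5 hr₁]
  field_simp
  ring

theorem qOpt_zero {r₁ r₂ M : ℝ} (hr₁ : 0 < r₁) (hr : r₁ < r₂) (hM : 0 < M) (g b z : ℝ) :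
    r₂ ^ 2 / r₁ * qOpt r₁ r₂ (coeffsOf r₁ r₂ 0) M g b z = -(r₂ ^ 2 * (r₂ - r₁) ^ 2 *
      ((r₂ - r₁) ^ 2 * (7 * r₁ ^ 2 + 28 * r₁ * r₂ + 40 * r₂ ^ 2) * g
        + 60 * r₁ * (r₁ + 2 * r₂) * (b - z))) / (120 * r₁ * baseQ r₁ r₂ M) := by
  have h := (baseQ_neg hr₁ hr hM).ne
  have h2 : 0 < r₂ := hr₁.trans hr
  rw [qOpt, coeff_q_eq hr₁ h2, coeffsOf_zero_G4 hr₁, coeffsOf_zero_G6 hr₁]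
  field_simp
  ring

theorem Delta_zero {r₁ r₂ M N : ℝ} (hr₁ : 0 < r₁) (hr : r₁ < r₂) (hM : 0 < M) (hN : 0 < N) :
    Delta r₁ r₂ (coeffsOf r₁ r₂ 0) M N = -(420 * r₁ ^ 3 * (r₂ - r₁) ^ 2 *
      (r₂ ^ 2 * (r₂ - r₁) ^ 3 * (3 * r₁ + 2 * r₂)
        + 16 * N * (r₁ ^ 3 + 3 * r₁ ^ 2 * r₂ + 6 * r₁ * r₂ ^ 2 + 5 * r₂ ^ 3)))
      / baseGQ r₁ r₂ M N := by
  have := baseGQ_pos hr₁ hr hM hN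
  have h2 : 0 < r₂ := hr₁.trans hr
  have : 0 < r₂ - r₁ := sub_pos.2 hr
  rw [Delta, den₄_eq hr₁ h2, coeff_q_eq hr₁ h2, coeffsOf_zero_G4 hr₁, coeffsOf_zero_G5 hr₁,
    coeffsOf_zero_G6 hr₁, baseQ]
  field_simp
  ring

theorem Pi₃_zero {r₁ r₂ M N : ℝ} (hr₁ : 0 < r₁) (hr : r₁ < r₂) (hM : 0 < M) (hN : 0 < N) :
    Pi₃ r₁ r₂ (coeffsOf r₁ r₂ 0) M N = 24 * r₂ ^ 2 * (r₂ - r₁) ^ 2 *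
      (700 * M * (r₁ ^ 2 + r₁ * r₂ + r₂ ^ 2) * (r₁ + 2 * r₂)
        - (r₂ - r₁) ^ 4 * (r₁ ^ 3 + 7 * r₁ ^ 2 * r₂ + 18 * r₁ * r₂ ^ 2 + 9 * r₂ ^ 3))
      / baseGQ r₁ r₂ M N := by
  have := baseGQ_pos hr₁ hr hM hN
  have h2 : 0 < r₂ := hr₁.trans hr
  have : 0 < r₂ - r₁ := sub_pos.2 hr
  rw [Pi₃, den₄_eq hr₁ h2, coeff_g_eq hr₁, coeffsOf_zero_G4 hr₁, coeffsOf_zero_G5 hr₁,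
    coeffsOf_zero_G6 hr₁, baseG]
  field_simp
  ring

theorem gRate_eq {r₁ r₂ M : ℝ} (hr₁ : 0 < r₁) (hr : r₁ < r₂) (hM : 0 < M) (q b z : ℝ) {D : ℝ}
    (hD : HasDerivAt (fun s => gOpt r₁ r₂ (coeffsOf r₁ r₂ s) M q b z) D 0) :
    |D| / r₁ = gRate r₁ r₂ M q b z := by
  have ha := baseG_pos hr₁ hr hM
  have hE : 0 < r₂ - r₁ := sub_pos.2 hr
  have h := (hasCoeffsDeriv_coeffsOf (r₂ := r₂) hr₁).gOpt (r₁ := r₁) (r₂ := r₂) (M := M) q b z hr₁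
    (coeff_g_pos hr₁ hr hM)
  rw [hD.unique h, gRate]
  refine abs_div_eq_mul_abs hr₁ (by rw [denG_eq]; positivity) ?_
  have e : 2 * r₁ ^ 2 * (coeffsDeriv r₁ r₂).G1 * gOpt r₁ r₂ (coeffsOf r₁ r₂ 0) M q b z =
    2 * (coeffsDeriv r₁ r₂).G1 * (r₁ ^ 2 * gOpt r₁ r₂ (coeffsOf r₁ r₂ 0) M q b z) := by ring
  rw [e, gOpt_zero hr₁ hr hM, coeff_g_eq hr₁, denG_eq]
  simp only [coeffsDeriv]
  -- The denominator stays an opaque nonzero symbol while fractions are cleared; its polynomial is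
  -- inserted only for the final identity. The other limit constants are treated in the same way,
  -- and the choice of `Or.inl` or `Or.inr` records the sign of the derivative relative to the
  -- expression inside the absolute value.
  have hdef := baseG.eq_1 r₁ r₂ M
  generalize baseG r₁ r₂ M = a at *
  refine Or.inr ?_
  field_simp
  rw [hdef]
  ring

theorem qRate_eq {r₁ r₂ M : ℝ} (hr₁ : 0 < r₁) (hr : r₁ < r₂) (hM : 0 < M) (g b z : ℝ) {D : ℝ}
    (hD : HasDerivAt (fun s => qOpt r₁ r₂ (coeffsOf r₁ r₂ s) M g b z) D 0) :
    |D| / r₁ = qRate r₁ r₂ M g b z := by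
  have ha := (baseQ_neg hr₁ hr hM).ne
  have hE : 0 < r₂ - r₁ := sub_pos.2 hr
  have hr₂ : 0 < r₂ := hr₁.trans hr
  have h := (hasCoeffsDeriv_coeffsOf (r₂ := r₂) hr₁).qOpt (M := M) g b z hr₁ hr₂
    (coeff_q_pos hr₁ hr hM)
  rw [hD.unique h, qRate]
  refine abs_div_eq_mul_abs hr₁ (by rw [denQ_eq]; positivity) ?_
  have e : qOpt r₁ r₂ (coeffsOf r₁ r₂ 0) M g b z =
    r₁ / r₂ ^ 2 * (r₂ ^ 2 / r₁ * qOpt r₁ r₂ (coeffsOf r₁ r₂ 0) M g b z) := by field_simp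
  rw [e, qOpt_zero hr₁ hr hM, coeff_q_eq hr₁ hr₂, denQ_eq]
  simp only [coeffsDeriv]
  have hdef := baseQ.eq_1 r₁ r₂ M
  generalize baseQ r₁ r₂ M = a at *
  refine Or.inl ?_
  field_simp
  rw [hdef]
  ring

/-- `G3` is constant and `G5`, `G6` are affine in `s`, so the optimal `b` is affine in `1/α` and the
rate is an identity for each `α`, not only a limit. -/
theorem abs_bOpt_sub {r₁ r₂ M : ℝ} (hr₁ : 0 < r₁) (hr : r₁ < r₂) (hM : 0 < M) (g q z : ℝ) {α : ℝ}
    (hα : 0 < α) :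
    |bOpt r₁ r₂ (coeffsR r₁ r₂ α) M g q z - bOpt r₁ r₂ (coeffs r₁ r₂) M g q z| =
      1 / α * bRate r₁ r₂ M g q := by
  have hb : 0 < -(-3 * M * r₁ ^ 2 + r₁ ^ 3 - r₂ ^ 3) := by
    have : r₁ ^ 3 < r₂ ^ 3 := by gcongr
    have : 0 < M * r₁ ^ 2 := by positivity
    linarith
  have hb' : -3 * M * r₁ ^ 2 + r₁ ^ 3 - r₂ ^ 3 ≠ 0 := by linarith
  have hk := coeff_b_eq hr₁ r₂ M
  nth_rw 1 [← abs_of_pos (one_div_pos.2 hα)]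
  rw [coeffsR_eq, coeffs_eq, bRate, ← abs_mul, bOpt, bOpt,
    show (coeffsOf r₁ r₂ (1 / (α * r₁))).G3 = (coeffsOf r₁ r₂ 0).G3 from rfl, hk]
  congr 1
  simp only [coeffsOf]
  generalize -3 * M * r₁ ^ 2 + r₁ ^ 3 - r₂ ^ 3 = c at *
  field_simp
  ring

/-- Variant for the simultaneous controls, which are proportional to `b - z`: the factor `|d|` is
pulled out of the absolute value. -/
theorem abs_div_eq_abs_mul_abs {D r K d B X : ℝ} (hr : 0 < r) (hK : 0 ≤ K) (hB : 0 ≤ B)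
    (h : D = r * (K * d / B * X) ∨ D = -(r * (K * d / B * X))) :
    |D| / r = K * |d| / B * |X| := by
  have : |D| = |r * (K * d / B * X)| := by rcases h with h | h <;> simp [h]
  rw [this, abs_mul, abs_mul, abs_div, abs_mul, abs_of_pos hr, abs_of_nonneg hK, abs_of_nonneg hB]
  field_simp

theorem gRate₄_eq {r₁ r₂ M N : ℝ} (hr₁ : 0 < r₁) (hr : r₁ < r₂) (hM : 0 < M) (hN : 0 < N)
    (b z : ℝ) {D : ℝ}
    (hD : HasDerivAt (fun s => (gqOpt r₁ r₂ (coeffsOf r₁ r₂ s) M N b z).1) D 0) :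
    |D| / r₁ = gRate₄ r₁ r₂ M N b z := by
  have ha := baseGQ_pos hr₁ hr hM hN
  have hE : 0 < r₂ - r₁ := sub_pos.2 hr
  have hr₂ : 0 < r₂ := hr₁.trans hr
  have h := ((hasCoeffsDeriv_coeffsOf (r₂ := r₂) hr₁).Delta
    (den₄_pos hr₁ hr hM hN)).const_mul ((b - z) / r₁ ^ 2)
  rw [hD.unique h, gRate₄]
  refine abs_div_eq_abs_mul_abs hr₁ (by positivity) (by rw [denGQ_eq]; positivity) ?_
  rw [Delta_zero hr₁ hr hM hN, Pi₃_zero hr₁ hr hM hN, den₄_eq hr₁ hr₂, coeff_q_eq hr₁ hr₂,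
    coeffsOf_zero_G4 hr₁, denGQ_eq, baseQ]
  simp only [coeffsDeriv]
  have hdef := baseGQ.eq_1 r₁ r₂ M N
  generalize baseGQ r₁ r₂ M N = a at *
  refine Or.inr ?_
  field_simp
  rw [hdef]
  ring

theorem qRate₄_eq {r₁ r₂ M N : ℝ} (hr₁ : 0 < r₁) (hr : r₁ < r₂) (hM : 0 < M) (hN : 0 < N)
    (b z : ℝ) {D : ℝ}
    (hD : HasDerivAt (fun s => (gqOpt r₁ r₂ (coeffsOf r₁ r₂ s) M N b z).2) D 0) :
    |D| / r₁ = qRate₄ r₁ r₂ M N b z := by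
  have ha := baseGQ_pos hr₁ hr hM hN
  have hE : 0 < r₂ - r₁ := sub_pos.2 hr
  have hr₂ : 0 < r₂ := hr₁.trans hr
  have h := ((hasCoeffsDeriv_coeffsOf (r₂ := r₂) hr₁).Pi₃
    (den₄_pos hr₁ hr hM hN)).const_mul ((b - z) * r₁ / r₂ ^ 2)
  rw [hD.unique h, qRate₄]
  refine abs_div_eq_abs_mul_abs hr₁ (by positivity) (by rw [denGQ_eq]; positivity) ?_
  rw [Delta_zero hr₁ hr hM hN, Pi₃_zero hr₁ hr hM hN, den₄_eq hr₁ hr₂, coeff_g_eq hr₁,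
    coeffsOf_zero_G4 hr₁, denGQ_eq, baseG]
  simp only [coeffsDeriv]
  have hdef := baseGQ.eq_1 r₁ r₂ M N
  generalize baseGQ r₁ r₂ M N = a at *
  refine Or.inl ?_
  field_simp
  rw [hdef]
  ring

theorem J₁Rate_eq {r₁ r₂ M : ℝ} (hr₁ : 0 < r₁) (hr : r₁ < r₂) (hM : 0 < M) (q b z : ℝ) {D : ℝ}
    (hD : HasDerivAt (fun s => J₁Opt r₁ r₂ (coeffsOf r₁ r₂ s) M q b z) D 0) :
    |D| / r₁ = J₁Rate r₁ r₂ M q b z := by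
  have ha := baseG_pos hr₁ hr hM
  have hE : 0 < r₂ - r₁ := sub_pos.2 hr
  have h := (hasCoeffsDeriv_coeffsOf (r₂ := r₂) hr₁).J₁Opt (r₁ := r₁) (r₂ := r₂) (M := M) q b z hr₁
    (coeff_g_pos hr₁ hr hM)
  rw [hD.unique h, J₁Rate]
  refine abs_div_eq_mul_abs hr₁ (by rw [denG_eq]; positivity) ?_
  rw [gOpt_zero hr₁ hr hM, denG_eq]
  simp only [coeffsDeriv]
  have hdef := baseG.eq_1 r₁ r₂ M
  generalize baseG r₁ r₂ M = a at *
  generalize b - z = d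
  refine Or.inl ?_
  field_simp
  rw [hdef]
  ring

theorem J₂Rate_eq {r₁ r₂ M : ℝ} (hr₁ : 0 < r₁) (hr : r₁ < r₂) (hM : 0 < M) (g b z : ℝ) {D : ℝ}
    (hD : HasDerivAt (fun s => J₂Opt r₁ r₂ (coeffsOf r₁ r₂ s) M g b z) D 0) :
    |D| / r₁ = J₂Rate r₁ r₂ M g b z := by
  have ha := (baseQ_neg hr₁ hr hM).ne
  have hE : 0 < r₂ - r₁ := sub_pos.2 hr
  have hr₂ : 0 < r₂ := hr₁.trans hr
  have h := (hasCoeffsDeriv_coeffsOf (r₂ := r₂) hr₁).J₂Opt (M := M) g b z hr₁ hr₂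
    (coeff_q_pos hr₁ hr hM)
  rw [hD.unique h, J₂Rate]
  refine abs_div_eq_mul_abs hr₁ (by rw [denQ_eq]; positivity) ?_
  rw [qOpt_zero hr₁ hr hM, denQ_eq]
  simp only [coeffsDeriv]
  have hdef := baseQ.eq_1 r₁ r₂ M
  generalize baseQ r₁ r₂ M = a at *
  generalize b - z = d
  refine Or.inl ?_
  field_simp
  rw [hdef]
  ring

theorem J₃Rate_eq {r₁ r₂ M : ℝ} (hr₁ : 0 < r₁) (hr : r₁ < r₂) (hM : 0 < M) (g q z : ℝ) {D : ℝ}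
    (hD : HasDerivAt (fun s => J₃Opt r₁ r₂ (coeffsOf r₁ r₂ s) M g q z) D 0) :
    |D| / r₁ = J₃Rate r₁ r₂ M g q z := by
  have hb : -3 * M * r₁ ^ 2 + r₁ ^ 3 - r₂ ^ 3 < 0 := by
    have : r₁ ^ 3 < r₂ ^ 3 := by gcongr
    have : 0 < M * r₁ ^ 2 := by positivity
    linarith
  have h := (hasCoeffsDeriv_coeffsOf (r₂ := r₂) hr₁).J₃Opt (r₁ := r₁) (r₂ := r₂) (M := M) g q z hr₁
    (coeff_b_pos hr₁ hr hM)
  rw [hD.unique h, J₃Rate]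
  refine abs_div_eq_mul_abs hr₁ (by positivity) ?_
  rw [bOpt, coeff_b_eq hr₁, coeffsOf_zero_G5 hr₁, coeffsOf_zero_G6 hr₁, coeffsOf_G3 hr₁,
    abs_of_neg hb]
  simp only [coeffsDeriv]
  generalize hc : -3 * M * r₁ ^ 2 + r₁ ^ 3 - r₂ ^ 3 = c at *
  have hc0 : c ≠ 0 := hb.ne
  refine Or.inl ?_
  field_simp
  rw [← hc]
  ring

theorem J₄Rate_eq {r₁ r₂ M N : ℝ} (hr₁ : 0 < r₁) (hr : r₁ < r₂) (hM : 0 < M) (hN : 0 < N)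
    (b z : ℝ) {D : ℝ}
    (hD : HasDerivAt (fun s => J₄Opt r₁ r₂ (coeffsOf r₁ r₂ s) M N b z) D 0) :
    |D| / r₁ = J₄Rate r₁ r₂ M N b z := by
  have ha := baseGQ_pos hr₁ hr hM hN
  have hE : 0 < r₂ - r₁ := sub_pos.2 hr
  have hr₂ : 0 < r₂ := hr₁.trans hr
  have h := (hasCoeffsDeriv_coeffsOf (r₂ := r₂) hr₁).J₄Opt b z (den₄_pos hr₁ hr hM hN)
  rw [hD.unique h, J₄Rate]
  refine abs_div_eq_mul_abs hr₁ (by rw [denGQ_eq]; positivity) ?_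
  rw [Delta_zero hr₁ hr hM hN, Pi₃_zero hr₁ hr hM hN, denGQ_eq]
  simp only [coeffsDeriv]
  have hdef := baseGQ.eq_1 r₁ r₂ M N
  generalize baseGQ r₁ r₂ M N = a at *
  generalize b - z = d
  refine Or.inr ?_
  field_simp
  rw [hdef]
  ring

/-! ### Differences of states and of adjoint states -/

/-- The (constant) flux with `u_α - u = -(stateShift / α)`. -/
def stateShift (r₁ r₂ g q : ℝ) : ℝ := g * r₁ / 3 + stateInv r₂ g q / r₁ ^ 2

/-- The source and the outer flux already determine the coefficients of `r ^ 2` and `1/r`; the inner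
condition affects the additive constant only. Hence the gradients of the two states coincide and the
`H¹` norm of the difference reduces to its `L²` norm. -/
theorem stateR_sub_state {r₁ r₂ α : ℝ} (hr₁ : 0 < r₁) (hr : r₁ < r₂) (hα : 0 < α) (g q b : ℝ) :
    ∀ x ∈ shell r₁ r₂,
      stateR r₁ r₂ α g q b x - state r₁ r₂ g q b x = -(1 / α * stateShift r₁ r₂ g q) := by
  intro x hx
  rw [stateR_eq hr₁ hr hα g q b x hx, state_eq hr₁ hr g q b x hx]
  simp only [stateProfile, profile, stateConst, stateShift]
  ring

theorem sqNormH1_eq_of_eqOn_const {r₁ r₂ c : ℝ} (hr₁ : 0 < r₁) (hr : r₁ < r₂) {f : E3 → ℝ}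
    (hf : ∀ x ∈ shell r₁ r₂, f x = c) :
    sqNormH1 r₁ r₂ f = 4 * π / 3 * (r₂ ^ 3 - r₁ ^ 3) * c ^ 2 := by
  rw [← sqNormH_const hr₁ hr, sqNormH1, sqNormH]
  refine setIntegral_congr_fun (measurableSet_shell r₁ r₂) fun x hx => ?_
  have h : f =ᶠ[𝓝 x] fun _ => c := by
    filter_upwards [(isOpen_shell r₁ r₂).mem_nhds hx] with y hy using hf y hy
  simp [hf x hx, h.fderiv_eq]

theorem norm_stateR_sub_state {r₁ r₂ α : ℝ} (hr₁ : 0 < r₁) (hr : r₁ < r₂) (hα : 0 < α)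
    (g q b : ℝ) :
    √(sqNormH1 r₁ r₂ (fun x => stateR r₁ r₂ α g q b x - state r₁ r₂ g q b x)) =
      uRate r₁ r₂ g q / α := by
  rw [sqNormH1_eq_of_eqOn_const hr₁ hr (stateR_sub_state hr₁ hr hα g q b), uRate]
  rw [eq_div_iff hα.ne']
  nth_rw 2 [← Real.sqrt_sq hα.le]
  rw [← Real.sqrt_mul' _ (sq_nonneg α)]
  congr 1
  simp only [stateShift, stateInv]
  field_simp
  ring

/-- The constant coefficient of `(p_α - p) / k`, `k = 1 / α`. -/
def adjointShiftConst (r₁ r₂ k g q b z : ℝ) : ℝ :=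
  -(stateShift r₁ r₂ g q * r₁ ^ 2 / 6 + stateShift r₁ r₂ g q * r₂ ^ 3 / (3 * r₁))
    + (g * r₁ ^ 3 / 30 - (stateConst r₁ r₂ k g q b - z) * r₁ / 3 - stateInv r₂ g q / 2
      - adjointInv r₁ r₂ k g q b z / r₁ ^ 2)

/-- The source of `p_α - p` is the constant `u_α - u`, so no `r ^ 4` or `r` term survives, and the
vanishing outer flux ties the `1/r` coefficient to that of `r ^ 2`. Only the additive constant,
after division by `1/α`, still depends on `α`, which is why the norm is given by a limit. -/
theorem adjointR_sub_adjoint {r₁ r₂ α : ℝ} (hr₁ : 0 < r₁) (hr : r₁ < r₂) (hα : 0 < α)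
    (g q b z : ℝ) : ∀ x ∈ shell r₁ r₂,
      adjointR r₁ r₂ α g q b z x - adjoint r₁ r₂ g q b z x =
        profile 0 (1 / α * (stateShift r₁ r₂ g q / 6)) 0
          (1 / α * adjointShiftConst r₁ r₂ (1 / α) g q b z)
          (1 / α * (stateShift r₁ r₂ g q * r₂ ^ 3 / 3)) ‖x‖ := by
  intro x hx
  rw [adjointR_eq hr₁ hr hα g q b z x hx, adjoint_eq hr₁ hr g q b z x hx]
  simp only [adjointProfile, profile, adjointConst, adjointShiftConst, adjointInv, stateShift,
    stateConst]
  ring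

/-- `α² ‖p_α - p‖²` as a function of `k = 1 / α`. -/
def adjointShiftSq (r₁ r₂ g q b z k : ℝ) : ℝ :=
  4 * π * ((stateShift r₁ r₂ g q / 6) ^ 2 * (r₂ ^ 7 - r₁ ^ 7) / 7
    + adjointShiftConst r₁ r₂ k g q b z ^ 2 * (r₂ ^ 3 - r₁ ^ 3) / 3
    + (stateShift r₁ r₂ g q * r₂ ^ 3 / 3) ^ 2 * (r₂ - r₁)
    + 2 * (stateShift r₁ r₂ g q / 6) * adjointShiftConst r₁ r₂ k g q b z * (r₂ ^ 5 - r₁ ^ 5) / 5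
    + (stateShift r₁ r₂ g q / 6) * (stateShift r₁ r₂ g q * r₂ ^ 3 / 3) * (r₂ ^ 4 - r₁ ^ 4) / 2
    + adjointShiftConst r₁ r₂ k g q b z * (stateShift r₁ r₂ g q * r₂ ^ 3 / 3)
      * (r₂ ^ 2 - r₁ ^ 2))

theorem mul_norm_adjointR_sub_adjoint {r₁ r₂ α : ℝ} (hr₁ : 0 < r₁) (hr : r₁ < r₂) (hα : 0 < α)
    (g q b z : ℝ) :
    α * √(sqNormH r₁ r₂ (fun x => adjointR r₁ r₂ α g q b z x - adjoint r₁ r₂ g q b z x)) =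
      √(adjointShiftSq r₁ r₂ g q b z (1 / α)) := by
  rw [sqNormH_congr (adjointR_sub_adjoint hr₁ hr hα g q b z), sqNormH_profile hr₁ hr]
  nth_rw 1 [← Real.sqrt_sq hα.le]
  rw [← Real.sqrt_mul (sq_nonneg α), adjointShiftSq]
  congr 1
  generalize adjointShiftConst r₁ r₂ (1 / α) g q b z = c
  field_simp

theorem sqrt_adjointShiftSq_zero {r₁ r₂ : ℝ} (hr₁ : 0 < r₁) (g q b z : ℝ) :
    √(adjointShiftSq r₁ r₂ g q b z 0) = pRate r₁ r₂ g q b z := by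
  rw [pRate]
  congr 1
  simp only [adjointShiftSq, adjointShiftConst, adjointInv, stateShift, stateConst, stateInv]
  field_simp
  ring

theorem tendsto_mul_norm_adjointR_sub_adjoint {r₁ r₂ : ℝ} (hr₁ : 0 < r₁) (hr : r₁ < r₂)
    (g q b z : ℝ) :
    Tendsto (fun α => α * √(sqNormH r₁ r₂
      (fun x => adjointR r₁ r₂ α g q b z x - adjoint r₁ r₂ g q b z x)))
      atTop (𝓝 (pRate r₁ r₂ g q b z)) := by
  -- In the parameter `k = 1 / α` the expression extends continuously to `k = 0`, where it equals
  -- `pRate`.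
  have hc : Continuous (fun k => √(adjointShiftSq r₁ r₂ g q b z k)) := by
    simp only [adjointShiftSq, adjointShiftConst, adjointInv, stateConst]
    fun_prop
  have h0 : Tendsto (fun α : ℝ => 1 / α) atTop (𝓝 0) := by
    simpa using tendsto_one_div_mul_atTop one_pos
  rw [← sqrt_adjointShiftSq_zero hr₁]
  refine ((hc.tendsto 0).comp h0).congr' ?_
  filter_upwards [eventually_gt_atTop 0] with α hα
  exact (mul_norm_adjointR_sub_adjoint hr₁ hr hα g q b z).symm

end ShellControl

end

/-! ### Assembly -/

theorem mainTheorem3 (r₁ r₂ : ℝ) (hr₁ : 0 < r₁) (hr : r₁ < r₂) :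
    -- well-posedness: the states (and adjoint states) are the unique solutions of their problems
    (∀ g q b z : ℝ,
      IsUniqueSol r₁ r₂ (IsDirichletSol r₁ r₂ (fun _ => g) q b) (state r₁ r₂ g q b) ∧
      IsUniqueSol r₁ r₂ (IsDirichletSol r₁ r₂ (fun x => state r₁ r₂ g q b x - z) 0 0)
        (adjoint r₁ r₂ g q b z) ∧
      ∀ α : ℝ, 0 < α →
        IsUniqueSol r₁ r₂ (IsRobinSol r₁ r₂ α (fun _ => g) q b) (stateR r₁ r₂ α g q b) ∧
        IsUniqueSol r₁ r₂ (IsRobinSol r₁ r₂ α (fun x => stateR r₁ r₂ α g q b x - z) 0 0)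
          (adjointR r₁ r₂ α g q b z)) ∧
    -- i) distributed control
    (∀ M q b z : ℝ, 0 < M →
      IsUniqueMin (J₁ r₁ r₂ (state r₁ r₂) M q b z) (gOpt r₁ r₂ (coeffs r₁ r₂) M q b z) ∧
      J₁ r₁ r₂ (state r₁ r₂) M q b z (gOpt r₁ r₂ (coeffs r₁ r₂) M q b z)
        = J₁Opt r₁ r₂ (coeffs r₁ r₂) M q b z ∧
      ∀ α : ℝ, 0 < α →
        IsUniqueMin (J₁ r₁ r₂ (stateR r₁ r₂ α) M q b z)
          (gOpt r₁ r₂ (coeffsR r₁ r₂ α) M q b z) ∧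
        J₁ r₁ r₂ (stateR r₁ r₂ α) M q b z (gOpt r₁ r₂ (coeffsR r₁ r₂ α) M q b z)
          = J₁Opt r₁ r₂ (coeffsR r₁ r₂ α) M q b z) ∧
    -- ii) flux control on the outer sphere
    (∀ M g b z : ℝ, 0 < M →
      IsUniqueMin (J₂ r₁ r₂ (state r₁ r₂) M g b z) (qOpt r₁ r₂ (coeffs r₁ r₂) M g b z) ∧
      J₂ r₁ r₂ (state r₁ r₂) M g b z (qOpt r₁ r₂ (coeffs r₁ r₂) M g b z)
        = J₂Opt r₁ r₂ (coeffs r₁ r₂) M g b z ∧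
      ∀ α : ℝ, 0 < α →
        IsUniqueMin (J₂ r₁ r₂ (stateR r₁ r₂ α) M g b z)
          (qOpt r₁ r₂ (coeffsR r₁ r₂ α) M g b z) ∧
        J₂ r₁ r₂ (stateR r₁ r₂ α) M g b z (qOpt r₁ r₂ (coeffsR r₁ r₂ α) M g b z)
          = J₂Opt r₁ r₂ (coeffsR r₁ r₂ α) M g b z) ∧
    -- iii) temperature control on (or outside) the inner sphere
    (∀ M g q z : ℝ, 0 < M →
      IsUniqueMin (J₃ r₁ r₂ (state r₁ r₂) M g q z) (bOpt r₁ r₂ (coeffs r₁ r₂) M g q z) ∧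
      J₃ r₁ r₂ (state r₁ r₂) M g q z (bOpt r₁ r₂ (coeffs r₁ r₂) M g q z)
        = J₃Opt r₁ r₂ (coeffs r₁ r₂) M g q z ∧
      ∀ α : ℝ, 0 < α →
        IsUniqueMin (J₃ r₁ r₂ (stateR r₁ r₂ α) M g q z)
          (bOpt r₁ r₂ (coeffsR r₁ r₂ α) M g q z) ∧
        J₃ r₁ r₂ (stateR r₁ r₂ α) M g q z (bOpt r₁ r₂ (coeffsR r₁ r₂ α) M g q z)
          = J₃Opt r₁ r₂ (coeffsR r₁ r₂ α) M g q z) ∧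
    -- iv) simultaneous distributed-boundary control
    (∀ M N b z : ℝ, 0 < M → 0 < N →
      IsUniqueMin (J₄ r₁ r₂ (state r₁ r₂) M N b z) (gqOpt r₁ r₂ (coeffs r₁ r₂) M N b z) ∧
      J₄ r₁ r₂ (state r₁ r₂) M N b z (gqOpt r₁ r₂ (coeffs r₁ r₂) M N b z)
        = J₄Opt r₁ r₂ (coeffs r₁ r₂) M N b z ∧
      ∀ α : ℝ, 0 < α →
        IsUniqueMin (J₄ r₁ r₂ (stateR r₁ r₂ α) M N b z)
          (gqOpt r₁ r₂ (coeffsR r₁ r₂ α) M N b z) ∧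
        J₄ r₁ r₂ (stateR r₁ r₂ α) M N b z (gqOpt r₁ r₂ (coeffsR r₁ r₂ α) M N b z)
          = J₄Opt r₁ r₂ (coeffsR r₁ r₂ α) M N b z) ∧
    -- v) convergence of the optimal controls, order `1/α`, and the limit constants
    (∀ M q b z : ℝ, 0 < M →
      let gα : ℝ → ℝ := fun α => gOpt r₁ r₂ (coeffsR r₁ r₂ α) M q b z
      let g₀ : ℝ := gOpt r₁ r₂ (coeffs r₁ r₂) M q b z
      Tendsto gα atTop (𝓝 g₀) ∧
      (fun α => |gα α - g₀|) =O[atTop] (fun α => 1 / α) ∧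
      Tendsto (fun α => α * |gα α - g₀|) atTop (𝓝 (gRate r₁ r₂ M q b z))) ∧
    (∀ M g b z : ℝ, 0 < M →
      let qα : ℝ → ℝ := fun α => qOpt r₁ r₂ (coeffsR r₁ r₂ α) M g b z
      let q₀ : ℝ := qOpt r₁ r₂ (coeffs r₁ r₂) M g b z
      Tendsto qα atTop (𝓝 q₀) ∧
      (fun α => |qα α - q₀|) =O[atTop] (fun α => 1 / α) ∧
      Tendsto (fun α => α * |qα α - q₀|) atTop (𝓝 (qRate r₁ r₂ M g b z))) ∧
    (∀ M g q z : ℝ, 0 < M →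
      let bα : ℝ → ℝ := fun α => bOpt r₁ r₂ (coeffsR r₁ r₂ α) M g q z
      let b₀ : ℝ := bOpt r₁ r₂ (coeffs r₁ r₂) M g q z
      Tendsto bα atTop (𝓝 b₀) ∧
      (fun α => |bα α - b₀|) =O[atTop] (fun α => 1 / α) ∧
      ∀ α : ℝ, 0 < α → |bα α - b₀| = 1 / α * bRate r₁ r₂ M g q) ∧
    (∀ M N b z : ℝ, 0 < M → 0 < N →
      let cα : ℝ → ℝ × ℝ := fun α => gqOpt r₁ r₂ (coeffsR r₁ r₂ α) M N b z
      let c₀ : ℝ × ℝ := gqOpt r₁ r₂ (coeffs r₁ r₂) M N b z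
      Tendsto cα atTop (𝓝 c₀) ∧
      (fun α => |(cα α).1 - c₀.1|) =O[atTop] (fun α => 1 / α) ∧
      (fun α => |(cα α).2 - c₀.2|) =O[atTop] (fun α => 1 / α) ∧
      Tendsto (fun α => α * |(cα α).1 - c₀.1|) atTop (𝓝 (gRate₄ r₁ r₂ M N b z)) ∧
      Tendsto (fun α => α * |(cα α).2 - c₀.2|) atTop (𝓝 (qRate₄ r₁ r₂ M N b z))) ∧
    -- convergence of the optimal values, order `1/α`, and the limit constants
    (∀ M q b z : ℝ, 0 < M →
      let vα : ℝ → ℝ := fun α =>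
        J₁ r₁ r₂ (stateR r₁ r₂ α) M q b z (gOpt r₁ r₂ (coeffsR r₁ r₂ α) M q b z)
      let v₀ : ℝ := J₁ r₁ r₂ (state r₁ r₂) M q b z (gOpt r₁ r₂ (coeffs r₁ r₂) M q b z)
      Tendsto vα atTop (𝓝 v₀) ∧
      (fun α => |vα α - v₀|) =O[atTop] (fun α => 1 / α) ∧
      Tendsto (fun α => α * |vα α - v₀|) atTop (𝓝 (J₁Rate r₁ r₂ M q b z))) ∧
    (∀ M g b z : ℝ, 0 < M →
      let vα : ℝ → ℝ := fun α =>
        J₂ r₁ r₂ (stateR r₁ r₂ α) M g b z (qOpt r₁ r₂ (coeffsR r₁ r₂ α) M g b z)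
      let v₀ : ℝ := J₂ r₁ r₂ (state r₁ r₂) M g b z (qOpt r₁ r₂ (coeffs r₁ r₂) M g b z)
      Tendsto vα atTop (𝓝 v₀) ∧
      (fun α => |vα α - v₀|) =O[atTop] (fun α => 1 / α) ∧
      Tendsto (fun α => α * |vα α - v₀|) atTop (𝓝 (J₂Rate r₁ r₂ M g b z))) ∧
    (∀ M g q z : ℝ, 0 < M →
      let vα : ℝ → ℝ := fun α =>
        J₃ r₁ r₂ (stateR r₁ r₂ α) M g q z (bOpt r₁ r₂ (coeffsR r₁ r₂ α) M g q z)
      let v₀ : ℝ := J₃ r₁ r₂ (state r₁ r₂) M g q z (bOpt r₁ r₂ (coeffs r₁ r₂) M g q z)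
      Tendsto vα atTop (𝓝 v₀) ∧
      (fun α => |vα α - v₀|) =O[atTop] (fun α => 1 / α) ∧
      Tendsto (fun α => α * |vα α - v₀|) atTop (𝓝 (J₃Rate r₁ r₂ M g q z))) ∧
    (∀ M N b z : ℝ, 0 < M → 0 < N →
      let vα : ℝ → ℝ := fun α =>
        J₄ r₁ r₂ (stateR r₁ r₂ α) M N b z (gqOpt r₁ r₂ (coeffsR r₁ r₂ α) M N b z)
      let v₀ : ℝ := J₄ r₁ r₂ (state r₁ r₂) M N b z (gqOpt r₁ r₂ (coeffs r₁ r₂) M N b z)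
      Tendsto vα atTop (𝓝 v₀) ∧
      (fun α => |vα α - v₀|) =O[atTop] (fun α => 1 / α) ∧
      Tendsto (fun α => α * |vα α - v₀|) atTop (𝓝 (J₄Rate r₁ r₂ M N b z))) ∧
    -- convergence of the states and of the adjoint states
    (∀ g q b z : ℝ,
      (∀ α : ℝ, 0 < α →
        √(sqNormH1 r₁ r₂ (fun x => stateR r₁ r₂ α g q b x - state r₁ r₂ g q b x))
          = uRate r₁ r₂ g q / α) ∧
      Tendsto (fun α => α *
          √(sqNormH r₁ r₂ (fun x => adjointR r₁ r₂ α g q b z x - adjoint r₁ r₂ g q b z x)))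
        atTop (𝓝 (pRate r₁ r₂ g q b z))) := by
  have hr₂ : 0 < r₂ := hr₁.trans hr
  have hS := hasCostForm_state hr₁ hr
  have hR : ∀ α : ℝ, 0 < α → HasCostForm r₁ r₂ (stateR r₁ r₂ α) (coeffsR r₁ r₂ α) :=
    fun α hα => hasCostForm_stateR hr₁ hr hα
  have hG := hasCoeffsDeriv_coeffsOf (r₂ := r₂) hr₁
  refine ⟨fun g q b z => ⟨isUniqueSol_state hr₁ hr g q b, isUniqueSol_adjoint hr₁ hr g q b z,
      fun α hα => ⟨isUniqueSol_stateR hr₁ hr hα g q b, isUniqueSol_adjointR hr₁ hr hα g q b z⟩⟩,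
    fun M q b z hM => ⟨(hS.min_J₁ hr₁ hr hM q b z).1, (hS.min_J₁ hr₁ hr hM q b z).2,
      fun α hα => (hR α hα).min_J₁ hr₁ hr hM q b z⟩,
    fun M g b z hM => ⟨(hS.min_J₂ hr₁ hr hM g b z).1, (hS.min_J₂ hr₁ hr hM g b z).2,
      fun α hα => (hR α hα).min_J₂ hr₁ hr hM g b z⟩,
    fun M g q z hM => ⟨(hS.min_J₃ hr₁ hr hM g q z).1, (hS.min_J₃ hr₁ hr hM g q z).2,
      fun α hα => (hR α hα).min_J₃ hr₁ hr hM g q z⟩,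
    fun M N b z hM hN => ⟨(hS.min_J₄ hr₁ hr hM hN b z).1, (hS.min_J₄ hr₁ hr hM hN b z).2,
      fun α hα => (hR α hα).min_J₄ hr₁ hr hM hN b z⟩, ?_, ?_, ?_, ?_, ?_, ?_, ?_, ?_,
    fun g q b z => ⟨fun α hα => norm_stateR_sub_state hr₁ hr hα g q b,
      tendsto_mul_norm_adjointR_sub_adjoint hr₁ hr g q b z⟩⟩
  · intro M q b z hM gα g₀
    have h := hG.gOpt (r₁ := r₁) (r₂ := r₂) (M := M) q b z hr₁ (coeff_g_pos hr₁ hr hM)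
    have := rate_of_hasDerivAt (v := gα) hr₁ h (fun _ _ => rfl) (gRate_eq hr₁ hr hM q b z h)
    rwa [← coeffs_eq] at this
  · intro M g b z hM qα q₀
    have h := hG.qOpt (r₁ := r₁) (r₂ := r₂) (M := M) g b z hr₁ hr₂ (coeff_q_pos hr₁ hr hM)
    have := rate_of_hasDerivAt (v := qα) hr₁ h (fun _ _ => rfl) (qRate_eq hr₁ hr hM g b z h)
    rwa [← coeffs_eq] at this
  · intro M g q z hM bα b₀
    have h := hG.bOpt (r₁ := r₁) (r₂ := r₂) (M := M) g q z
    -- Only convergence and the order are taken from here, so the limit constant is left as whatever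
    -- the derivative gives; the exact formula is `abs_bOpt_sub`.
    have := rate_of_hasDerivAt (v := bα) hr₁ h (fun _ _ => rfl) rfl
    rw [← coeffs_eq] at this
    exact ⟨this.1, this.2.1, fun α hα => abs_bOpt_sub hr₁ hr hM g q z hα⟩
  · intro M N b z hM hN cα c₀
    have hD := den₄_pos hr₁ hr hM hN
    have h1 := (hG.Delta hD).const_mul ((b - z) / r₁ ^ 2)
    have h2 := (hG.Pi₃ hD).const_mul ((b - z) * r₁ / r₂ ^ 2)
    have t1 := rate_of_hasDerivAt (v := fun α => (cα α).1) hr₁ h1 (fun _ _ => rfl)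
      (gRate₄_eq hr₁ hr hM hN b z h1)
    have t2 := rate_of_hasDerivAt (v := fun α => (cα α).2) hr₁ h2 (fun _ _ => rfl)
      (qRate₄_eq hr₁ hr hM hN b z h2)
    rw [← coeffs_eq] at t1 t2
    exact ⟨t1.1.prodMk_nhds t2.1, t1.2.1, t2.2.1, t1.2.2, t2.2.2⟩
  · intro M q b z hM vα v₀
    have h := hG.J₁Opt (r₁ := r₁) (r₂ := r₂) (M := M) q b z hr₁ (coeff_g_pos hr₁ hr hM)
    -- The minimum values are replaced by their closed forms, which are valid for `α > 0` only; this
    -- is all that the limit `α → ∞` requires.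
    have := rate_of_hasDerivAt (v := vα) hr₁ h
      (fun α hα => ((hR α hα).min_J₁ hr₁ hr hM q b z).2) (J₁Rate_eq hr₁ hr hM q b z h)
    rwa [← coeffs_eq, ← (hS.min_J₁ hr₁ hr hM q b z).2] at this
  · intro M g b z hM vα v₀
    have h := hG.J₂Opt (r₁ := r₁) (r₂ := r₂) (M := M) g b z hr₁ hr₂ (coeff_q_pos hr₁ hr hM)
    have := rate_of_hasDerivAt (v := vα) hr₁ h
      (fun α hα => ((hR α hα).min_J₂ hr₁ hr hM g b z).2) (J₂Rate_eq hr₁ hr hM g b z h)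
    rwa [← coeffs_eq, ← (hS.min_J₂ hr₁ hr hM g b z).2] at this
  · intro M g q z hM vα v₀
    have h := hG.J₃Opt (r₁ := r₁) (r₂ := r₂) (M := M) g q z hr₁ (coeff_b_pos hr₁ hr hM)
    have := rate_of_hasDerivAt (v := vα) hr₁ h
      (fun α hα => ((hR α hα).min_J₃ hr₁ hr hM g q z).2) (J₃Rate_eq hr₁ hr hM g q z h)
    rwa [← coeffs_eq, ← (hS.min_J₃ hr₁ hr hM g q z).2] at this
  · intro M N b z hM hN vα v₀
    have h := hG.J₄Opt b z (den₄_pos hr₁ hr hM hN)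
    have := rate_of_hasDerivAt (v := vα) hr₁ h
      (fun α hα => ((hR α hα).min_J₄ hr₁ hr hM hN b z).2) (J₄Rate_eq hr₁ hr hM hN b z h)
    rwa [← coeffs_eq, ← (hS.min_J₄ hr₁ hr hM hN b z).2] at this
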